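/- Let $\mathcal H''$ be the $\mathbb C$-linear monoidal category with generating objects $\mathsf P$ (an upward strand) and $\mathsf Q$ (a downward strand) whose morphisms are $\mathbb C$-linear combinations of planar string diagrams (read from bottom to top, tensor product = horizontal juxtaposition), up to planar isotopy, generated by the upward crossing $\mathsf{PP}\to\mathsf{PP}$, the cups $1\to\mathsf{PQ}$, $1\to\mathsf{QP}$ and the caps $\mathsf{PQ}\to1$, $\mathsf{QP}\to1$, subject to the following local relations. The upward crossing squares to the identity and satisfies the braid relation. The composite of crossings $\mathsf{PQ}\to\mathsf{QP}\to\mathsf{PQ}$ is the identity. The composite of crossings $\mathsf{QP}\to\mathsf{PQ}\to\mathsf{QP}$ is the identity minus the composite of the cap $\mathsf{QP}\to 1$ followed by the cup $1\to\mathsf{QP}$. The counterclockwise circle equals $1$. The left curl on an upward strand is $0$. (Crossings involving downward strands are the rotated upward crossings.) Let $\mathcal H$, Khovanov's Heisenberg category, be the Karoubi envelope of the closure of $\mathcal H''$ under finite direct sums, and let $$\operatorname{Tr}(\mathcal H)=\Big(\bigoplus_{X}\operatorname{End}_{\mathcal H}(X)\Big)\Big/\operatorname{Span}_{\mathbb C}\{fg-gf\},$$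 where $f\colon X\to Y$, $g\colon Y\to X$; this is an associative unital algebra with product $[f][g]=[f\otimes g]$ and unit $[\mathrm{id}_1]$, and $[a,b]=ab-ba$. A dot on an upward strand denotes the right curl on it, and a dot on a downward strand is the rotation of this by half a turn. For $n\ge1$ let $\sigma_n=s_1s_2\cdots s_{n-1}\in S_n$ (the diagram in which the rightmost strand end at the bottom is joined to the leftmost strand end at the top), and let $h_n\otimes x_1^{j_1}\cdots x_n^{j_n}$ (respectively $h_{-n}\otimes x_1^{j_1}\cdots x_n^{j_n}$) be the class in $\operatorname{Tr}(\mathcal H)$ of the endomorphism of $\mathsf P^n$ (respectively $\mathsf Q^n$) given by the diagram of $\sigma_n$ drawn with upward (respectively downward) strands, with $j_i$ dots at the top of the $i$-th strand from the left; extend linearly to polynomials in $x_1,\dots,x_n$. Let $c_0$ be the class of the clockwise circle without dots. Put $$b_l=h_{-l}\otimes1\quad(l\ne0),\qquad b_0=0,\qquad L_l=\Big|\frac1l\Big|\,h_{-l}\otimes(x_1+\dots+x_{|l|})\quad(l\ne0),\qquad L_0=c_0 .$$ Then the elements $L_l$ ($l\in\mathbb Z$) and $b_l$ ($l\ne0$)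 generate a Heisenberg–Virasoro algebra of central charge one, that is: $$[b_k,b_l]=k\,\delta_{k,-l}\qquad(k,l\in\mathbb Z\setminus\{0\}),$$ $$[L_k,L_l]=(k-l)L_{k+l}+\frac{k^3-k}{12}\,\delta_{k,-l}\qquad(k,l\in\mathbb Z),$$ $$[L_l,b_k]=-k\,b_{l+k}\qquad(l\in\mathbb Z,\ k\in\mathbb Z\setminus\{0\}).$$ -/

import Mathlib

noncomputable section

open CategoryTheory MonoidalCategory


namespace CategoryTheory.Mat_

universe v u
variable {C : Type u} [Category.{v} C] [Preadditive C]

section Lin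
variable (k : Type) [CommRing k] [Linear k C]

instance (M N : Mat_ C) : Module k (M ⟶ N) :=
  inferInstanceAs <| Module k (∀ (i : M.ι) (j : N.ι), M.X i ⟶ N.X j)

@[simp]
theorem smul_apply' {M N : Mat_ C} (r : k) (f : M ⟶ N) (i j) : (r • f) i j = r • f i j :=
  rfl

instance : Linear k (Mat_ C) where
  smul_comp _ _ _ r f g := by ext; simp [Finset.smul_sum]
  comp_smul _ _ _ f r g := by ext; simp [Finset.smul_sum]

end Lin

section Diag

open scoped Classical in
/-- The matrix with entry `φ i` at the place `(i, e i)` for each `i` and zeros elsewhere. -/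
def diag {M N : Mat_ C} (e : M.ι → N.ι) (φ : ∀ i, M.X i ⟶ N.X (e i)) : M ⟶ N :=
  fun i j => if h : e i = j then φ i ≫ eqToHom (congrArg N.X h) else 0

theorem diag_apply_self {M N : Mat_ C} (e : M.ι → N.ι) (φ : ∀ i, M.X i ⟶ N.X (e i)) (i) :
    diag e φ i (e i) = φ i := by
  simp [diag]

theorem diag_apply_ne {M N : Mat_ C} (e : M.ι → N.ι) (φ : ∀ i, M.X i ⟶ N.X (e i)) {i j}
    (h : e i ≠ j) : diag e φ i j = 0 := by
  simp [diag, h]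

theorem diag_comp_apply {M N K : Mat_ C} (e : M.ι → N.ι) (φ : ∀ i, M.X i ⟶ N.X (e i))
    (g : N ⟶ K) (i k) : (diag e φ ≫ g) i k = φ i ≫ g (e i) k := by
  rw [comp_apply, Finset.sum_eq_single (e i), diag_apply_self]
  · intro j _ hj
    rw [diag_apply_ne e φ hj.symm, Limits.zero_comp]
  · intro h
    exact absurd (Finset.mem_univ _) h

theorem comp_diag_apply {M N K : Mat_ C} (f : M ⟶ N) (e : N.ι → K.ι)
    (he : Function.Injective e) (φ : ∀ i, N.X i ⟶ K.X (e i)) (i j) :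
    (f ≫ diag e φ) i (e j) = f i j ≫ φ j := by
  rw [comp_apply, Finset.sum_eq_single j, diag_apply_self]
  · intro l _ hl
    rw [diag_apply_ne e φ (fun h => hl (he h)), Limits.comp_zero]
  · intro h
    exact absurd (Finset.mem_univ _) h

theorem diag_comp_diag {M N K : Mat_ C} (e : M.ι → N.ι) (φ : ∀ i, M.X i ⟶ N.X (e i))
    (e' : N.ι → K.ι) (ψ : ∀ i, N.X i ⟶ K.X (e' i)) :
    diag e φ ≫ diag e' ψ = diag (fun i => e' (e i)) (fun i => φ i ≫ ψ (e i)) := by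
  ext i k
  rw [diag_comp_apply]
  by_cases h : e' (e i) = k
  · subst h
    rw [diag_apply_self]
    exact (diag_apply_self (fun i => e' (e i)) (fun i => φ i ≫ ψ (e i)) i).symm
  · rw [diag_apply_ne _ _ h, Limits.comp_zero]
    exact (diag_apply_ne (fun i => e' (e i)) (fun i => φ i ≫ ψ (e i)) h).symm

theorem id_eq_diag (M : Mat_ C) : 𝟙 M = diag (fun i => i) (fun i => 𝟙 (M.X i)) := by
  ext i j
  by_cases h : i = j
  · subst h
    rw [id_apply_self]
    exact (diag_apply_self (fun i => i) (fun i => 𝟙 (M.X i)) i).symm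
  · rw [id_apply_of_ne _ _ _ h, diag_apply_ne (fun i => i) _ h]

end Diag

section Monoidal
variable [MonoidalCategory C]

/-- `(⨁ i, X i) ⊗ (⨁ j, Y j) = ⨁ (i, j), X i ⊗ Y j`. -/
abbrev tensorObj' (M N : Mat_ C) : Mat_ C := ⟨M.ι × N.ι, fun p => M.X p.1 ⊗ N.X p.2⟩

/-- The Kronecker product of matrices of morphisms. -/
def tensorHom' {M N M' N' : Mat_ C} (f : M ⟶ M') (g : N ⟶ N') :
    tensorObj' M N ⟶ tensorObj' M' N' :=
  fun p q => f p.1 q.1 ⊗ₘ g p.2 q.2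

/-- The tensor unit of `C` as a one-term direct sum. -/
abbrev tensorUnit' : Mat_ C := ⟨PUnit, fun _ => 𝟙_ C⟩

def associator' (M N K : Mat_ C) :
    tensorObj' (tensorObj' M N) K ≅ tensorObj' M (tensorObj' N K) where
  hom := diag (fun p => (p.1.1, p.1.2, p.2)) (fun p => (α_ (M.X p.1.1) (N.X p.1.2) (K.X p.2)).hom)
  inv := diag (fun p => ((p.1, p.2.1), p.2.2))
    (fun p => (α_ (M.X p.1) (N.X p.2.1) (K.X p.2.2)).inv)
  hom_inv_id := by
    rw [diag_comp_diag, id_eq_diag]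
    simp
  inv_hom_id := by
    rw [diag_comp_diag, id_eq_diag]
    simp

def leftUnitor' (M : Mat_ C) : tensorObj' tensorUnit' M ≅ M where
  hom := diag (fun p => p.2) (fun p => (λ_ (M.X p.2)).hom)
  inv := diag (fun i => (PUnit.unit, i)) (fun i => (λ_ (M.X i)).inv)
  hom_inv_id := by
    rw [diag_comp_diag, id_eq_diag]
    simp
  inv_hom_id := by
    rw [diag_comp_diag, id_eq_diag]
    simp

def rightUnitor' (M : Mat_ C) : tensorObj' M tensorUnit' ≅ M where
  hom := diag (fun p => p.1) (fun p => (ρ_ (M.X p.1)).hom)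
  inv := diag (fun i => (i, PUnit.unit)) (fun i => (ρ_ (M.X i)).inv)
  hom_inv_id := by
    rw [diag_comp_diag, id_eq_diag]
    simp
  inv_hom_id := by
    rw [diag_comp_diag, id_eq_diag]
    simp

instance : MonoidalCategoryStruct (Mat_ C) where
  tensorObj := tensorObj'
  tensorHom := tensorHom'
  whiskerLeft M _ _ f := tensorHom' (𝟙 M) f
  whiskerRight f N := tensorHom' f (𝟙 N)
  tensorUnit := tensorUnit'
  associator := associator'
  leftUnitor := leftUnitor'
  rightUnitor := rightUnitor'

variable [MonoidalPreadditive C]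

theorem tensorHom_diag {M N M' N' : Mat_ C} (e : M.ι → M'.ι) (φ : ∀ i, M.X i ⟶ M'.X (e i))
    (e' : N.ι → N'.ι) (ψ : ∀ i, N.X i ⟶ N'.X (e' i)) :
    tensorHom' (diag e φ) (diag e' ψ) =
      diag (M := tensorObj' M N) (N := tensorObj' M' N') (fun p => (e p.1, e' p.2))
        (fun p => φ p.1 ⊗ₘ ψ p.2) := by
  ext ⟨i, j⟩ ⟨k, l⟩
  change diag e φ i k ⊗ₘ diag e' ψ j l = _
  by_cases h : e i = k
  · by_cases h' : e' j = l
    · subst h h'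
      rw [diag_apply_self, diag_apply_self]
      exact (diag_apply_self (M := tensorObj' M N) (N := tensorObj' M' N')
        (fun p => (e p.1, e' p.2)) (fun p => φ p.1 ⊗ₘ ψ p.2) (i, j)).symm
    · rw [diag_apply_ne _ _ h', MonoidalPreadditive.tensor_zero]
      exact (diag_apply_ne (M := tensorObj' M N) (N := tensorObj' M' N')
        (fun p => (e p.1, e' p.2)) (fun p => φ p.1 ⊗ₘ ψ p.2) (i := (i, j)) (j := (k, l))
        (fun hh => h' (Prod.ext_iff.mp hh).2)).symm
  · rw [diag_apply_ne _ _ h, MonoidalPreadditive.zero_tensor]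
    exact (diag_apply_ne (M := tensorObj' M N) (N := tensorObj' M' N')
      (fun p => (e p.1, e' p.2)) (fun p => φ p.1 ⊗ₘ ψ p.2) (i := (i, j)) (j := (k, l))
      (fun hh => h (Prod.ext_iff.mp hh).1)).symm

theorem tensorHom'_id (M N : Mat_ C) : tensorHom' (𝟙 M) (𝟙 N) = 𝟙 (tensorObj' M N) := by
  rw [id_eq_diag, id_eq_diag, id_eq_diag]
  refine (tensorHom_diag (fun i => i) _ (fun i => i) _).trans ?_
  simp

theorem sum_tensorHom_sum {ι κ : Type} [Fintype ι] [Fintype κ] {X Y Z W : C} (f : ι → (X ⟶ Y))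
    (g : κ → (Z ⟶ W)) : (∑ i, f i) ⊗ₘ (∑ j, g j) = ∑ p : ι × κ, f p.1 ⊗ₘ g p.2 := by
  rw [Fintype.sum_prod_type, sum_tensor]
  simp_rw [tensor_sum]

instance : MonoidalCategory (Mat_ C) := MonoidalCategory.ofTensorHom
  (id_tensorHom_id := tensorHom'_id)
  (id_tensorHom := fun _ _ _ _ => rfl)
  (tensorHom_id := fun _ _ => rfl)
  (tensorHom_comp_tensorHom := by
    intro X₁ Y₁ Z₁ X₂ Y₂ Z₂ f₁ f₂ g₁ g₂
    ext ⟨i, j⟩ ⟨k, l⟩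
    change ∑ p : Y₁.ι × Y₂.ι, (f₁ i p.1 ⊗ₘ f₂ j p.2) ≫ (g₁ p.1 k ⊗ₘ g₂ p.2 l) =
      (∑ a, f₁ i a ≫ g₁ a k) ⊗ₘ (∑ b, f₂ j b ≫ g₂ b l)
    rw [sum_tensorHom_sum]
    simp)
  (associator_naturality := by
    intro X₁ X₂ X₃ Y₁ Y₂ Y₃ f₁ f₂ f₃
    ext ⟨⟨i, j⟩, k⟩ ⟨a, b, c⟩
    refine (comp_diag_apply (N := tensorObj' (tensorObj' Y₁ Y₂) Y₃)
      (K := tensorObj' Y₁ (tensorObj' Y₂ Y₃)) (tensorHom' (tensorHom' f₁ f₂) f₃)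
      (fun p => (p.1.1, p.1.2, p.2)) (fun p q h => (Equiv.prodAssoc _ _ _).injective h)
      (fun p => (α_ (Y₁.X p.1.1) (Y₂.X p.1.2) (Y₃.X p.2)).hom) ((i, j), k) ((a, b), c)).trans ?_
    refine Eq.trans ?_ (diag_comp_apply (M := tensorObj' (tensorObj' X₁ X₂) X₃)
      (N := tensorObj' X₁ (tensorObj' X₂ X₃)) (fun p => (p.1.1, p.1.2, p.2))
      (fun p => (α_ (X₁.X p.1.1) (X₂.X p.1.2) (X₃.X p.2)).hom)
      (tensorHom' f₁ (tensorHom' f₂ f₃)) ((i, j), k) (a, b, c)).symm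
    exact associator_naturality _ _ _)
  (leftUnitor_naturality := by
    intro X Y f
    ext ⟨i, j⟩ k
    refine (comp_diag_apply (N := tensorObj' tensorUnit' Y) (K := Y)
      (tensorHom' (𝟙 tensorUnit') f) (fun p => p.2)
      (fun p q h => (Equiv.punitProd _).injective h)
      (fun p => (λ_ (Y.X p.2)).hom) (i, j) (i, k)).trans ?_
    refine Eq.trans ?_ (diag_comp_apply (M := tensorObj' tensorUnit' X) (N := X)
      (fun p => p.2) (fun p => (λ_ (X.X p.2)).hom) f (i, j) k).symm
    change ((𝟙 tensorUnit' : (tensorUnit' : Mat_ C) ⟶ tensorUnit') i i ⊗ₘ f j k) ≫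
      (λ_ (Y.X k)).hom = _
    rw [id_apply_self, id_tensorHom]
    exact leftUnitor_naturality _)
  (rightUnitor_naturality := by
    intro X Y f
    ext ⟨j, i⟩ k
    refine (comp_diag_apply (N := tensorObj' Y tensorUnit') (K := Y)
      (tensorHom' f (𝟙 tensorUnit')) (fun p => p.1)
      (fun p q h => (Equiv.prodPUnit _).injective h)
      (fun p => (ρ_ (Y.X p.1)).hom) (j, i) (k, i)).trans ?_
    refine Eq.trans ?_ (diag_comp_apply (M := tensorObj' X tensorUnit') (N := X)
      (fun p => p.1) (fun p => (ρ_ (X.X p.1)).hom) f (j, i) k).symm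
    change (f j k ⊗ₘ (𝟙 tensorUnit' : (tensorUnit' : Mat_ C) ⟶ tensorUnit') i i) ≫
      (ρ_ (Y.X k)).hom = _
    rw [id_apply_self, tensorHom_id]
    exact rightUnitor_naturality _)
  (pentagon := by
    intro W X Y Z
    change tensorHom' (associator' W X Y).hom (𝟙 Z) ≫ (associator' W (tensorObj' X Y) Z).hom ≫
        tensorHom' (𝟙 W) (associator' X Y Z).hom =
      (associator' (tensorObj' W X) Y Z).hom ≫ (associator' W X (tensorObj' Y Z)).hom
    rw [id_eq_diag, id_eq_diag]
    simp only [associator', tensorHom_diag, diag_comp_diag]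
    congr 1
    funext p
    simp)
  (triangle := by
    intro X Y
    change (associator' X tensorUnit' Y).hom ≫ tensorHom' (𝟙 X) (leftUnitor' Y).hom =
      tensorHom' (rightUnitor' X).hom (𝟙 Y)
    rw [id_eq_diag, id_eq_diag]
    simp only [associator', leftUnitor', rightUnitor', tensorHom_diag, diag_comp_diag]
    congr 1
    funext p
    simp)

instance : MonoidalPreadditive (Mat_ C) where
  whiskerLeft_zero {X Y Z} := by
    ext p q
    exact MonoidalPreadditive.tensor_zero _
  zero_whiskerRight {X Y Z} := by
    ext p q
    exact MonoidalPreadditive.zero_tensor _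
  whiskerLeft_add f g := by
    ext p q
    exact MonoidalPreadditive.tensor_add _ _ _
  add_whiskerRight f g := by
    ext p q
    exact MonoidalPreadditive.add_tensor _ _ _

instance (k : Type) [CommRing k] [Linear k C] [MonoidalLinear k C] :
    MonoidalLinear k (Mat_ C) where
  whiskerLeft_smul X _ _ r f := by
    ext p q
    change (𝟙 X : X ⟶ X) p.1 q.1 ⊗ₘ (r • f p.2 q.2) = r • ((𝟙 X : X ⟶ X) p.1 q.1 ⊗ₘ f p.2 q.2)
    simp [MonoidalCategory.tensorHom_def]
  smul_whiskerRight r _ _ f X := by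
    ext p q
    change (r • f p.1 q.1) ⊗ₘ (𝟙 X : X ⟶ X) p.2 q.2 = r • (f p.1 q.1 ⊗ₘ (𝟙 X : X ⟶ X) p.2 q.2)
    simp [MonoidalCategory.tensorHom_def]

end Monoidal
end CategoryTheory.Mat_

namespace CategoryTheory.Idempotents.Karoubi

universe v u
variable {C : Type u} [Category.{v} C]

section Lin
variable [Preadditive C] (k : Type) [CommRing k] [Linear k C]

instance (P Q : Karoubi C) : SMul k (P ⟶ Q) where
  smul r f := ⟨r • f.f, by rw [Linear.smul_comp, Linear.comp_smul, f.comm]⟩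

@[simp]
theorem smul_f {P Q : Karoubi C} (r : k) (f : P ⟶ Q) : (r • f).f = r • f.f := rfl

instance (P Q : Karoubi C) : Module k (P ⟶ Q) :=
  Function.Injective.module k (inclusionHom P Q) (fun _ _ h => Hom.ext h) (fun _ _ => rfl)

instance : Linear k (Karoubi C) where
  smul_comp _ _ _ r f g := by ext; simp
  comp_smul _ _ _ f r g := by ext; simp

end Lin

section Monoidal
variable [MonoidalCategory C]

/-- An isomorphism of the underlying objects that commutes with the idempotents. -/
def isoOfIso (P Q : Karoubi C) (i : P.X ≅ Q.X) (h : P.p ≫ i.hom = i.hom ≫ Q.p) : P ≅ Q where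
  hom := ⟨P.p ≫ i.hom, by simp [← h]⟩
  inv := ⟨Q.p ≫ i.inv, by
    have h' : i.inv ≫ P.p = Q.p ≫ i.inv := by
      rw [Iso.inv_comp_eq, ← Category.assoc, ← h, Category.assoc, Iso.hom_inv_id,
        Category.comp_id]
    simp [h']⟩
  hom_inv_id := by
    ext
    simp [← reassoc_of% h]
  inv_hom_id := by
    ext
    simp [h]

/-- `(X, p) ⊗ (Y, q) = (X ⊗ Y, p ⊗ q)`. -/
abbrev tensorObj' (P Q : Karoubi C) : Karoubi C := ⟨P.X ⊗ Q.X, P.p ⊗ₘ Q.p, by simp⟩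

abbrev tensorUnit' : Karoubi C := ⟨𝟙_ C, 𝟙 _, by simp⟩

def tensorHom' {P Q P' Q' : Karoubi C} (f : P ⟶ P') (g : Q ⟶ Q') :
    tensorObj' P Q ⟶ tensorObj' P' Q' :=
  ⟨f.f ⊗ₘ g.f, by simp⟩

instance : MonoidalCategoryStruct (Karoubi C) where
  tensorObj := tensorObj'
  tensorHom := tensorHom'
  whiskerLeft P _ _ f := tensorHom' (𝟙 P) f
  whiskerRight f Q := tensorHom' f (𝟙 Q)
  tensorUnit := tensorUnit'
  associator P Q R := isoOfIso (tensorObj' (tensorObj' P Q) R) (tensorObj' P (tensorObj' Q R))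
    (α_ P.X Q.X R.X) (associator_naturality _ _ _)
  leftUnitor P := isoOfIso (tensorObj' tensorUnit' P) P (λ_ P.X) (by simp)
  rightUnitor P := isoOfIso (tensorObj' P tensorUnit') P (ρ_ P.X) (by simp)

instance : MonoidalCategory (Karoubi C) := MonoidalCategory.ofTensorHom
  (id_tensorHom_id := fun _ _ => rfl)
  (id_tensorHom := fun _ _ _ _ => rfl)
  (tensorHom_id := fun _ _ => rfl)
  (tensorHom_comp_tensorHom := by
    intros; ext; exact MonoidalCategory.tensorHom_comp_tensorHom _ _ _ _)
  (associator_naturality := by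
    intro X₁ X₂ X₃ Y₁ Y₂ Y₃ f₁ f₂ f₃
    ext
    change ((f₁.f ⊗ₘ f₂.f) ⊗ₘ f₃.f) ≫ (((Y₁.p ⊗ₘ Y₂.p) ⊗ₘ Y₃.p) ≫ (α_ _ _ _).hom) =
      (((X₁.p ⊗ₘ X₂.p) ⊗ₘ X₃.p) ≫ (α_ _ _ _).hom) ≫ (f₁.f ⊗ₘ (f₂.f ⊗ₘ f₃.f))
    rw [Category.assoc, ← MonoidalCategory.associator_naturality]
    simp only [MonoidalCategory.tensorHom_comp_tensorHom, MonoidalCategory.tensorHom_comp_tensorHom_assoc,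
      p_comp, comp_p])
  (leftUnitor_naturality := by
    intro X Y f
    ext
    change (𝟙 (𝟙_ C) ⊗ₘ f.f) ≫ ((𝟙 (𝟙_ C) ⊗ₘ Y.p) ≫ (λ_ _).hom) =
      ((𝟙 (𝟙_ C) ⊗ₘ X.p) ≫ (λ_ _).hom) ≫ f.f
    simp)
  (rightUnitor_naturality := by
    intro X Y f
    ext
    change (f.f ⊗ₘ 𝟙 (𝟙_ C)) ≫ ((Y.p ⊗ₘ 𝟙 (𝟙_ C)) ≫ (ρ_ _).hom) =
      ((X.p ⊗ₘ 𝟙 (𝟙_ C)) ≫ (ρ_ _).hom) ≫ f.f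
    simp)
  (pentagon := by
    intro W X Y Z
    ext
    change ((((W.p ⊗ₘ X.p) ⊗ₘ Y.p) ≫ (α_ _ _ _).hom) ⊗ₘ Z.p) ≫
        (((W.p ⊗ₘ (X.p ⊗ₘ Y.p)) ⊗ₘ Z.p) ≫ (α_ _ _ _).hom) ≫
          (W.p ⊗ₘ (((X.p ⊗ₘ Y.p) ⊗ₘ Z.p) ≫ (α_ _ _ _).hom)) =
      ((((W.p ⊗ₘ X.p) ⊗ₘ Y.p) ⊗ₘ Z.p) ≫ (α_ _ _ _).hom) ≫
        (((W.p ⊗ₘ X.p) ⊗ₘ (Y.p ⊗ₘ Z.p)) ≫ (α_ _ _ _).hom)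
    have h₁ : (((W.p ⊗ₘ X.p) ⊗ₘ Y.p) ≫ (α_ W.X X.X Y.X).hom) ⊗ₘ Z.p =
        (α_ W.X X.X Y.X).hom ▷ Z.X ≫ ((W.p ⊗ₘ (X.p ⊗ₘ Y.p)) ⊗ₘ Z.p) := by
      rw [← tensorHom_id, MonoidalCategory.tensorHom_comp_tensorHom, Category.id_comp,
        MonoidalCategory.associator_naturality]
    have h₂ : W.p ⊗ₘ (((X.p ⊗ₘ Y.p) ⊗ₘ Z.p) ≫ (α_ X.X Y.X Z.X).hom) =
        W.X ◁ (α_ X.X Y.X Z.X).hom ≫ (W.p ⊗ₘ (X.p ⊗ₘ (Y.p ⊗ₘ Z.p))) := by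
      rw [← id_tensorHom, MonoidalCategory.tensorHom_comp_tensorHom, Category.id_comp,
        MonoidalCategory.associator_naturality]
    have h₃ : (W.p ⊗ₘ ((X.p ⊗ₘ Y.p) ⊗ₘ Z.p)) ≫ W.X ◁ (α_ X.X Y.X Z.X).hom =
        W.X ◁ (α_ X.X Y.X Z.X).hom ≫ (W.p ⊗ₘ (X.p ⊗ₘ (Y.p ⊗ₘ Z.p))) := by
      rw [← h₂, ← id_tensorHom, MonoidalCategory.tensorHom_comp_tensorHom, Category.comp_id]
    rw [h₁, h₂]
    simp only [MonoidalCategory.associator_naturality, Category.assoc,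
      MonoidalCategory.associator_naturality_assoc, reassoc_of% h₃,
      MonoidalCategory.tensorHom_comp_tensorHom, idem]
    exact MonoidalCategory.pentagon_assoc _ _ _ _ _)
  (triangle := by
    intro X Y
    ext
    change (((X.p ⊗ₘ 𝟙 (𝟙_ C)) ⊗ₘ Y.p) ≫ (α_ _ _ _).hom) ≫
        (X.p ⊗ₘ ((𝟙 (𝟙_ C) ⊗ₘ Y.p) ≫ (λ_ _).hom)) =
      ((X.p ⊗ₘ 𝟙 (𝟙_ C)) ≫ (ρ_ _).hom) ⊗ₘ Y.p
    have h₁ : X.p ⊗ₘ ((𝟙 (𝟙_ C) ⊗ₘ Y.p) ≫ (λ_ Y.X).hom) =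
        (X.p ⊗ₘ (𝟙 (𝟙_ C) ⊗ₘ Y.p)) ≫ X.X ◁ (λ_ Y.X).hom := by
      rw [← id_tensorHom, MonoidalCategory.tensorHom_comp_tensorHom, Category.comp_id]
    have h₂ : ((X.p ⊗ₘ 𝟙 (𝟙_ C)) ≫ (ρ_ X.X).hom) ⊗ₘ Y.p =
        ((X.p ⊗ₘ 𝟙 (𝟙_ C)) ⊗ₘ Y.p) ≫ (ρ_ X.X).hom ▷ Y.X := by
      rw [← tensorHom_id, MonoidalCategory.tensorHom_comp_tensorHom, Category.comp_id]
    rw [h₁, h₂, Category.assoc, ← MonoidalCategory.associator_naturality_assoc,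
      MonoidalCategory.triangle]
    simp only [MonoidalCategory.tensorHom_comp_tensorHom,
      MonoidalCategory.tensorHom_comp_tensorHom_assoc, idem, Category.comp_id])

variable [Preadditive C] [MonoidalPreadditive C]

instance : MonoidalPreadditive (Karoubi C) where
  whiskerLeft_zero {X Y Z} := by
    ext
    exact MonoidalPreadditive.tensor_zero _
  zero_whiskerRight {X Y Z} := by
    ext
    exact MonoidalPreadditive.zero_tensor _
  whiskerLeft_add f g := by
    ext
    exact MonoidalPreadditive.tensor_add _ _ _
  add_whiskerRight f g := by
    ext
    exact MonoidalPreadditive.add_tensor _ _ _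

instance (k : Type) [CommRing k] [Linear k C] [MonoidalLinear k C] :
    MonoidalLinear k (Karoubi C) where
  whiskerLeft_smul X _ _ r f := by
    ext
    change X.p ⊗ₘ (r • f.f) = r • (X.p ⊗ₘ f.f)
    simp [MonoidalCategory.tensorHom_def]
  smul_whiskerRight r _ _ f X := by
    ext
    change (r • f.f) ⊗ₘ X.p = r • (f.f ⊗ₘ X.p)
    simp [MonoidalCategory.tensorHom_def]

end Monoidal
end CategoryTheory.Idempotents.Karoubi

namespace CategoryTheory

universe v u

open scoped DirectSum

section Space
variable (k : Type) [CommRing k] (C : Type u) [Category.{v} C] [Preadditive C] [Linear k C]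

open scoped Classical in
/-- The span of all differences `f g - g f`, for `f : X ⟶ Y` and `g : Y ⟶ X`, in the direct sum
of the endomorphism spaces of all objects of `C`. -/
def traceRelations : Submodule k (⨁ X : C, (X ⟶ X)) :=
  Submodule.span k {z | ∃ (X Y : C) (f : X ⟶ Y) (g : Y ⟶ X),
    z = DirectSum.lof k C (fun X => (X ⟶ X)) X (f ≫ g) -
      DirectSum.lof k C (fun X => (X ⟶ X)) Y (g ≫ f)}

/-- The trace (zeroth Hochschild homology) of a `k`-linear category. -/
def Tr : Type (max u v) := (⨁ X : C, (X ⟶ X)) ⧸ traceRelations k C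

namespace Tr

instance : AddCommGroup (Tr k C) :=
  inferInstanceAs <| AddCommGroup ((⨁ X : C, (X ⟶ X)) ⧸ traceRelations k C)

instance : Module k (Tr k C) :=
  inferInstanceAs <| Module k ((⨁ X : C, (X ⟶ X)) ⧸ traceRelations k C)

variable {C}

open scoped Classical in
/-- The class `[f]` of an endomorphism `f`. -/
def mk {X : C} : (X ⟶ X) →ₗ[k] Tr k C :=
  (traceRelations k C).mkQ ∘ₗ DirectSum.lof k C (fun X => (X ⟶ X)) X

theorem mk_comp_comm {X Y : C} (f : X ⟶ Y) (g : Y ⟶ X) : mk k (f ≫ g) = mk k (g ≫ f) := by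
  refine (Submodule.Quotient.eq _).2 (Submodule.subset_span ?_)
  exact ⟨X, Y, f, g, rfl⟩

theorem hom_ext {M : Type*} [AddCommGroup M] [Module k M] {φ ψ : Tr k C →ₗ[k] M}
    (h : ∀ (X : C) (f : X ⟶ X), φ (mk k f) = ψ (mk k f)) : φ = ψ := by
  classical
  refine Submodule.linearMap_qext _ (DirectSum.linearMap_ext _ fun X => LinearMap.ext fun f => ?_)
  exact h X f

open scoped Classical in
/-- A linear map out of the trace. -/
def lift {M : Type*} [AddCommGroup M] [Module k M] (φ : ∀ X : C, (X ⟶ X) →ₗ[k] M)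
    (h : ∀ (X Y : C) (f : X ⟶ Y) (g : Y ⟶ X), φ X (f ≫ g) = φ Y (g ≫ f)) : Tr k C →ₗ[k] M :=
  (traceRelations k C).liftQ (DirectSum.toModule k C M φ) <| by
    refine Submodule.span_le.2 ?_
    rintro _ ⟨X, Y, f, g, rfl⟩
    simp [h X Y f g]

@[simp]
theorem lift_mk {M : Type*} [AddCommGroup M] [Module k M] (φ : ∀ X : C, (X ⟶ X) →ₗ[k] M)
    (h : ∀ (X Y : C) (f : X ⟶ Y) (g : Y ⟶ X), φ X (f ≫ g) = φ Y (g ≫ f)) {X : C} (f : X ⟶ X) :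
    lift k φ h (mk k f) = φ X f := by
  classical
  refine ((traceRelations k C).liftQ_apply _ _).trans ?_
  exact DirectSum.toModule_lof k (M := fun X : C => (X ⟶ X)) X f

/-- Conjugate endomorphisms have the same class. -/
theorem mk_eq_of_iso {X Y : C} (i : X ≅ Y) {f : X ⟶ X} {g : Y ⟶ Y}
    (h : f ≫ i.hom = i.hom ≫ g) : mk k f = mk k g := by
  have h₁ : f = i.hom ≫ (g ≫ i.inv) := by
    rw [← Category.assoc, ← h, Category.assoc, Iso.hom_inv_id, Category.comp_id]
  rw [h₁, mk_comp_comm, Category.assoc, Iso.inv_hom_id, Category.comp_id]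

theorem induction {motive : Tr k C → Prop} (a : Tr k C)
    (mk : ∀ (X : C) (f : X ⟶ X), motive (mk k f)) (zero : motive 0)
    (add : ∀ a b, motive a → motive b → motive (a + b)) : motive a := by
  classical
  obtain ⟨z, rfl⟩ := (traceRelations k C).mkQ_surjective a
  induction z using DirectSum.induction_on with
  | zero => rw [map_zero]; exact zero
  | of X f => exact mk X f
  | add x y hx hy => rw [map_add]; exact add _ _ hx hy

end Tr
end Space

namespace Tr
section Algebra
variable (k : Type) [CommRing k] {C : Type u} [Category.{v} C] [Preadditive C] [Linear k C]
variable [MonoidalCategory C] [MonoidalPreadditive C] [MonoidalLinear k C]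

/-- `g ↦ [f ⊗ g]`, for an endomorphism `f`. -/
def mulLeft {X : C} (f : X ⟶ X) : Tr k C →ₗ[k] Tr k C :=
  lift k (fun Y =>
    { toFun := fun g : Y ⟶ Y => mk k (f ⊗ₘ g)
      map_add' := fun g g' => by rw [MonoidalPreadditive.tensor_add, map_add]
      map_smul' := fun r g => by
        rw [MonoidalCategory.tensorHom_def, MonoidalLinear.whiskerLeft_smul, Linear.comp_smul,
          map_smul, MonoidalCategory.tensorHom_def]
        rfl })
    (fun Y Z g h => by
      have h₁ : f ⊗ₘ (g ≫ h) = (X ◁ g) ≫ (f ⊗ₘ h) := by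
        rw [whiskerLeft_comp_tensorHom]
      have h₂ : f ⊗ₘ (h ≫ g) = (f ⊗ₘ h) ≫ (X ◁ g) := by
        rw [tensorHom_comp_whiskerLeft]
      change mk k (f ⊗ₘ (g ≫ h)) = mk k (f ⊗ₘ (h ≫ g))
      rw [h₁, h₂, mk_comp_comm])

theorem mulLeft_mk {X Y : C} (f : X ⟶ X) (g : Y ⟶ Y) :
    mulLeft k f (mk k g) = mk k (f ⊗ₘ g) :=
  lift_mk k _ _ g

/-- The bilinear multiplication of the trace, given by `[f] [g] = [f ⊗ g]`. -/
def mulHom : Tr k C →ₗ[k] Tr k C →ₗ[k] Tr k C :=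
  lift k (fun X =>
    { toFun := fun f : X ⟶ X => mulLeft k f
      map_add' := fun f f' => hom_ext k fun Y g => by
        rw [LinearMap.add_apply, mulLeft_mk, mulLeft_mk, mulLeft_mk,
          MonoidalPreadditive.add_tensor, map_add]
      map_smul' := fun r f => hom_ext k fun Y g => by
        rw [LinearMap.smul_apply, mulLeft_mk, mulLeft_mk, MonoidalCategory.tensorHom_def,
          MonoidalLinear.smul_whiskerRight, Linear.smul_comp, map_smul,
          MonoidalCategory.tensorHom_def]
        rfl })
    (fun X Y f g => hom_ext k fun Z h => by
      have h₁ : (f ≫ g) ⊗ₘ h = (f ▷ Z) ≫ (g ⊗ₘ h) := by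
        rw [whiskerRight_comp_tensorHom]
      have h₂ : (g ≫ f) ⊗ₘ h = (g ⊗ₘ h) ≫ (f ▷ Z) := by
        rw [tensorHom_comp_whiskerRight]
      change mulLeft k (f ≫ g) (mk k h) = mulLeft k (g ≫ f) (mk k h)
      rw [mulLeft_mk, mulLeft_mk, h₁, h₂, mk_comp_comm])

instance : Mul (Tr k C) := ⟨fun a b => mulHom k a b⟩

instance : One (Tr k C) := ⟨mk k (𝟙 (𝟙_ C))⟩

theorem mul_def (a b : Tr k C) : a * b = mulHom k a b := rfl

theorem one_def : (1 : Tr k C) = mk k (𝟙 (𝟙_ C)) := rfl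

/-- The product of classes is the class of the tensor product. -/
theorem mk_mul_mk {X Y : C} (f : X ⟶ X) (g : Y ⟶ Y) :
    mk k f * mk k g = mk k (f ⊗ₘ g) := by
  rw [mul_def, mulHom, lift_mk]
  exact mulLeft_mk k f g

instance : Ring (Tr k C) := { (inferInstance : AddCommGroup (Tr k C)) with
  left_distrib a b c := by simp only [mul_def, map_add]
  right_distrib a b c := by simp only [mul_def, map_add, LinearMap.add_apply]
  zero_mul a := by simp only [mul_def, map_zero, LinearMap.zero_apply]
  mul_zero a := by simp only [mul_def, map_zero]
  mul_assoc a b c := by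
    induction a using Tr.induction k with
    | zero => simp only [mul_def, map_zero, LinearMap.zero_apply]
    | add a a' h h' => simp only [mul_def, map_add, LinearMap.add_apply] at h h' ⊢; rw [h, h']
    | mk X f =>
    induction b using Tr.induction k with
    | zero => simp only [mul_def, map_zero, LinearMap.zero_apply]
    | add b b' h h' => simp only [mul_def, map_add, LinearMap.add_apply] at h h' ⊢; rw [h, h']
    | mk Y g =>
    induction c using Tr.induction k with
    | zero => simp only [mul_def, map_zero]
    | add c c' h h' => simp only [mul_def, map_add] at h h' ⊢; rw [h, h']
    | mk Z h =>
      rw [mk_mul_mk, mk_mul_mk, mk_mul_mk, mk_mul_mk]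
      exact mk_eq_of_iso k (α_ X Y Z) (associator_naturality _ _ _)
  one_mul a := by
    induction a using Tr.induction k with
    | zero => simp only [mul_def, map_zero]
    | add a a' h h' => simp only [mul_def, map_add] at h h' ⊢; rw [h, h']
    | mk X f =>
      rw [one_def, mk_mul_mk]
      exact mk_eq_of_iso k (λ_ X) (by simp)
  mul_one a := by
    induction a using Tr.induction k with
    | zero => simp only [mul_def, map_zero, LinearMap.zero_apply]
    | add a a' h h' => simp only [mul_def, map_add, LinearMap.add_apply] at h h' ⊢; rw [h, h']
    | mk X f =>
      rw [one_def, mk_mul_mk]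
      exact mk_eq_of_iso k (ρ_ X) (by simp)
}

instance : Algebra k (Tr k C) :=
  Algebra.ofModule (fun r a b => by rw [mul_def, mul_def, map_smul, LinearMap.smul_apply])
    (fun r a b => by rw [mul_def, mul_def, map_smul])

end Algebra
end Tr
end CategoryTheory


/-- The objects of the category before adjoining direct sums and images of idempotents: formal
tensor products of `P` (an upward strand) and `Q` (a downward strand). Brackets and units are kept,
and associators and unitors are morphisms, so the resulting monoidal category is the (monoidally
equivalent) non-strict form of the strict one whose objects are words in `P` and `Q`. -/
inductive HeisObj : Type
  | P : HeisObj
  | Q : HeisObj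
  | unit : HeisObj
  | tensor : HeisObj → HeisObj → HeisObj

namespace HeisObj

/-- Formal `ℂ`-linear combinations of string diagrams, built from an upward crossing, cups and
caps by vertical composition (`comp f g` has `f` at the bottom and `g` on top) and horizontal
juxtaposition (`tensor f g` has `f` on the left). -/
inductive Diagram : HeisObj → HeisObj → Type
  | id (X : HeisObj) : Diagram X X
  | comp {X Y Z : HeisObj} (f : Diagram X Y) (g : Diagram Y Z) : Diagram X Z
  | tensor {X Y Z W : HeisObj} (f : Diagram X Y) (g : Diagram Z W) :
      Diagram (X.tensor Z) (Y.tensor W)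
  | assocHom (X Y Z : HeisObj) : Diagram ((X.tensor Y).tensor Z) (X.tensor (Y.tensor Z))
  | assocInv (X Y Z : HeisObj) : Diagram (X.tensor (Y.tensor Z)) ((X.tensor Y).tensor Z)
  | leftHom (X : HeisObj) : Diagram (unit.tensor X) X
  | leftInv (X : HeisObj) : Diagram X (unit.tensor X)
  | rightHom (X : HeisObj) : Diagram (X.tensor unit) X
  | rightInv (X : HeisObj) : Diagram X (X.tensor unit)
  | zero (X Y : HeisObj) : Diagram X Y
  | add {X Y : HeisObj} (f g : Diagram X Y) : Diagram X Y
  | smul {X Y : HeisObj} (r : ℂ) (f : Diagram X Y) : Diagram X Y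
  | cross : Diagram (P.tensor P) (P.tensor P)
  | cupPQ : Diagram unit (P.tensor Q)
  | cupQP : Diagram unit (Q.tensor P)
  | capPQ : Diagram (P.tensor Q) unit
  | capQP : Diagram (Q.tensor P) unit

namespace Diagram

local infixr:80 " ⋆ " => Diagram.comp
local infixr:85 " ⊠ " => Diagram.tensor

/-- `A f B`, bracketed so that outer strands can be joined to the ends of `f`. -/
def sandwich (A B : HeisObj) {X Y Z W : HeisObj} (f : Diagram (X.tensor Y) (Z.tensor W)) :
    Diagram ((A.tensor X).tensor (Y.tensor B)) ((A.tensor Z).tensor (W.tensor B)) :=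
  assocHom A X (Y.tensor B) ⋆ (id A ⊠ assocInv X Y B) ⋆ (id A ⊠ (f ⊠ id B)) ⋆
    (id A ⊠ assocHom Z W B) ⋆ assocInv A Z (W.tensor B)

/-- Rotation of `f : X Y ⟶ Z W` by which the right lower end `Y` is bent up to the right and the
left upper end `Z` is bent down to the left. -/
def rotateLeft {A B X Y Z W : HeisObj} (f : Diagram (X.tensor Y) (Z.tensor W))
    (cup : Diagram unit (Y.tensor B)) (cap : Diagram (A.tensor Z) unit) :
    Diagram (A.tensor X) (W.tensor B) :=
  rightInv (A.tensor X) ⋆ (id (A.tensor X) ⊠ cup) ⋆ sandwich A B f ⋆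
    (cap ⊠ id (W.tensor B)) ⋆ leftHom (W.tensor B)

/-- Rotation of `f : X Y ⟶ Z W` by which the left lower end `X` is bent up to the left and the
right upper end `W` is bent down to the right. -/
def rotateRight {A B X Y Z W : HeisObj} (f : Diagram (X.tensor Y) (Z.tensor W))
    (cup : Diagram unit (A.tensor X)) (cap : Diagram (W.tensor B) unit) :
    Diagram (Y.tensor B) (A.tensor Z) :=
  leftInv (Y.tensor B) ⋆ (cup ⊠ id (Y.tensor B)) ⋆ sandwich A B f ⋆
    (id (A.tensor Z) ⊠ cap) ⋆ rightHom (A.tensor Z)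

/-- The crossing `Q P ⟶ P Q`. -/
def crossQP : Diagram (Q.tensor P) (P.tensor Q) := rotateLeft cross cupPQ capQP

/-- The crossing `P Q ⟶ Q P`. -/
def crossPQ : Diagram (P.tensor Q) (Q.tensor P) := rotateRight cross cupQP capPQ

/-- The downward crossing `Q Q ⟶ Q Q`: the upward crossing rotated through half a turn. -/
def crossQQ : Diagram (Q.tensor Q) (Q.tensor Q) := rotateLeft crossQP cupPQ capQP

/-- The upward crossing rotated through half a turn in the other sense. -/
def crossQQ' : Diagram (Q.tensor Q) (Q.tensor Q) := rotateRight crossPQ cupQP capPQ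

/-- The right curl on an upward strand, drawn as a dot. -/
def dotP : Diagram P P :=
  rightInv P ⋆ (id P ⊠ cupPQ) ⋆ assocInv P P Q ⋆ (cross ⊠ id Q) ⋆ assocHom P P Q ⋆
    (id P ⊠ capPQ) ⋆ rightHom P

/-- The left curl on an upward strand. -/
def leftCurl : Diagram P P :=
  leftInv P ⋆ (cupQP ⊠ id P) ⋆ assocHom Q P P ⋆ (id Q ⊠ cross) ⋆ assocInv Q P P ⋆
    (capQP ⊠ id P) ⋆ leftHom P

/-- The dot on a downward strand: the dot on an upward strand rotated through half a turn. -/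
def dotQ : Diagram Q Q :=
  rightInv Q ⋆ (id Q ⊠ cupPQ) ⋆ (id Q ⊠ (dotP ⊠ id Q)) ⋆ assocInv Q P Q ⋆
    (capQP ⊠ id Q) ⋆ leftHom Q

/-- Equality of diagrams: the congruence generated by the axioms of a `ℂ`-linear monoidal
category, planar isotopy (the axioms of a monoidal category, the four zigzag identities and the
invariance of the crossing under a full turn) and the local relations. -/
inductive Rel : ∀ {X Y : HeisObj}, Diagram X Y → Diagram X Y → Prop
  -- equivalence relation and congruence
  | refl {X Y : HeisObj} (f : Diagram X Y) : Rel f f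
  | symm {X Y : HeisObj} {f g : Diagram X Y} : Rel f g → Rel g f
  | trans {X Y : HeisObj} {f g h : Diagram X Y} : Rel f g → Rel g h → Rel f h
  | comp {X Y Z : HeisObj} {f f' : Diagram X Y} {g g' : Diagram Y Z} :
      Rel f f' → Rel g g' → Rel (f ⋆ g) (f' ⋆ g')
  | tensor {X Y Z W : HeisObj} {f f' : Diagram X Y} {g g' : Diagram Z W} :
      Rel f f' → Rel g g' → Rel (f ⊠ g) (f' ⊠ g')
  | add {X Y : HeisObj} {f f' g g' : Diagram X Y} :
      Rel f f' → Rel g g' → Rel (f.add g) (f'.add g')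
  | smul {X Y : HeisObj} (r : ℂ) {f f' : Diagram X Y} : Rel f f' → Rel (f.smul r) (f'.smul r)
  -- category
  | id_comp {X Y : HeisObj} (f : Diagram X Y) : Rel (id X ⋆ f) f
  | comp_id {X Y : HeisObj} (f : Diagram X Y) : Rel (f ⋆ id Y) f
  | assoc {X Y Z W : HeisObj} (f : Diagram X Y) (g : Diagram Y Z) (h : Diagram Z W) :
      Rel ((f ⋆ g) ⋆ h) (f ⋆ (g ⋆ h))
  -- monoidal category
  | tensor_id (X Y : HeisObj) : Rel (id X ⊠ id Y) (id (X.tensor Y))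
  | tensor_comp {X₁ Y₁ Z₁ X₂ Y₂ Z₂ : HeisObj} (f₁ : Diagram X₁ Y₁) (f₂ : Diagram X₂ Y₂)
      (g₁ : Diagram Y₁ Z₁) (g₂ : Diagram Y₂ Z₂) :
      Rel ((f₁ ⊠ f₂) ⋆ (g₁ ⊠ g₂)) ((f₁ ⋆ g₁) ⊠ (f₂ ⋆ g₂))
  | assoc_hom_inv (X Y Z : HeisObj) : Rel (assocHom X Y Z ⋆ assocInv X Y Z) (id _)
  | assoc_inv_hom (X Y Z : HeisObj) : Rel (assocInv X Y Z ⋆ assocHom X Y Z) (id _)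
  | assoc_naturality {X₁ X₂ X₃ Y₁ Y₂ Y₃ : HeisObj} (f₁ : Diagram X₁ Y₁) (f₂ : Diagram X₂ Y₂)
      (f₃ : Diagram X₃ Y₃) :
      Rel (((f₁ ⊠ f₂) ⊠ f₃) ⋆ assocHom Y₁ Y₂ Y₃) (assocHom X₁ X₂ X₃ ⋆ (f₁ ⊠ (f₂ ⊠ f₃)))
  | left_hom_inv (X : HeisObj) : Rel (leftHom X ⋆ leftInv X) (id _)
  | left_inv_hom (X : HeisObj) : Rel (leftInv X ⋆ leftHom X) (id _)
  | left_naturality {X Y : HeisObj} (f : Diagram X Y) :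
      Rel ((id unit ⊠ f) ⋆ leftHom Y) (leftHom X ⋆ f)
  | right_hom_inv (X : HeisObj) : Rel (rightHom X ⋆ rightInv X) (id _)
  | right_inv_hom (X : HeisObj) : Rel (rightInv X ⋆ rightHom X) (id _)
  | right_naturality {X Y : HeisObj} (f : Diagram X Y) :
      Rel ((f ⊠ id unit) ⋆ rightHom Y) (rightHom X ⋆ f)
  | pentagon (W X Y Z : HeisObj) :
      Rel ((assocHom W X Y ⊠ id Z) ⋆ assocHom W (X.tensor Y) Z ⋆ (id W ⊠ assocHom X Y Z))
        (assocHom (W.tensor X) Y Z ⋆ assocHom W X (Y.tensor Z))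
  | triangle (X Y : HeisObj) :
      Rel (assocHom X unit Y ⋆ (id X ⊠ leftHom Y)) (rightHom X ⊠ id Y)
  -- vector spaces of morphisms
  | add_assoc {X Y : HeisObj} (f g h : Diagram X Y) : Rel ((f.add g).add h) (f.add (g.add h))
  | add_comm {X Y : HeisObj} (f g : Diagram X Y) : Rel (f.add g) (g.add f)
  | zero_add {X Y : HeisObj} (f : Diagram X Y) : Rel ((zero X Y).add f) f
  | neg_add {X Y : HeisObj} (f : Diagram X Y) : Rel ((f.smul (-1)).add f) (zero X Y)
  | one_smul {X Y : HeisObj} (f : Diagram X Y) : Rel (f.smul 1) f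
  | mul_smul {X Y : HeisObj} (r s : ℂ) (f : Diagram X Y) :
      Rel (f.smul (r * s)) ((f.smul s).smul r)
  | smul_add {X Y : HeisObj} (r : ℂ) (f g : Diagram X Y) :
      Rel ((f.add g).smul r) ((f.smul r).add (g.smul r))
  | add_smul {X Y : HeisObj} (r s : ℂ) (f : Diagram X Y) :
      Rel (f.smul (r + s)) ((f.smul r).add (f.smul s))
  -- bilinearity of the two products
  | add_comp {X Y Z : HeisObj} (f f' : Diagram X Y) (g : Diagram Y Z) :
      Rel (f.add f' ⋆ g) ((f ⋆ g).add (f' ⋆ g))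
  | comp_add {X Y Z : HeisObj} (f : Diagram X Y) (g g' : Diagram Y Z) :
      Rel (f ⋆ g.add g') ((f ⋆ g).add (f ⋆ g'))
  | smul_comp {X Y Z : HeisObj} (r : ℂ) (f : Diagram X Y) (g : Diagram Y Z) :
      Rel (f.smul r ⋆ g) ((f ⋆ g).smul r)
  | comp_smul {X Y Z : HeisObj} (f : Diagram X Y) (r : ℂ) (g : Diagram Y Z) :
      Rel (f ⋆ g.smul r) ((f ⋆ g).smul r)
  | add_tensor {X Y Z W : HeisObj} (f f' : Diagram X Y) (g : Diagram Z W) :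
      Rel (f.add f' ⊠ g) ((f ⊠ g).add (f' ⊠ g))
  | tensor_add {X Y Z W : HeisObj} (f : Diagram X Y) (g g' : Diagram Z W) :
      Rel (f ⊠ g.add g') ((f ⊠ g).add (f ⊠ g'))
  | smul_tensor {X Y Z W : HeisObj} (r : ℂ) (f : Diagram X Y) (g : Diagram Z W) :
      Rel (f.smul r ⊠ g) ((f ⊠ g).smul r)
  | tensor_smul {X Y Z W : HeisObj} (f : Diagram X Y) (r : ℂ) (g : Diagram Z W) :
      Rel (f ⊠ g.smul r) ((f ⊠ g).smul r)
  -- planar isotopy: zigzags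
  | zigzag_P : Rel (leftInv P ⋆ (cupPQ ⊠ id P) ⋆ assocHom P Q P ⋆ (id P ⊠ capQP) ⋆ rightHom P)
      (id P)
  | zigzag_P' : Rel (rightInv P ⋆ (id P ⊠ cupQP) ⋆ assocInv P Q P ⋆ (capPQ ⊠ id P) ⋆ leftHom P)
      (id P)
  | zigzag_Q : Rel (leftInv Q ⋆ (cupQP ⊠ id Q) ⋆ assocHom Q P Q ⋆ (id Q ⊠ capPQ) ⋆ rightHom Q)
      (id Q)
  | zigzag_Q' : Rel (rightInv Q ⋆ (id Q ⊠ cupPQ) ⋆ assocInv Q P Q ⋆ (capQP ⊠ id Q) ⋆ leftHom Q)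
      (id Q)
  -- planar isotopy: both half turns of the crossing agree
  | rotation : Rel crossQQ crossQQ'
  -- local relations: two upward strands, and three upward strands
  | cross_cross : Rel (cross ⋆ cross) (id (P.tensor P))
  | braid : Rel
      ((cross ⊠ id P) ⋆ assocHom P P P ⋆ (id P ⊠ cross) ⋆ assocInv P P P ⋆ (cross ⊠ id P))
      (assocHom P P P ⋆ (id P ⊠ cross) ⋆ assocInv P P P ⋆ (cross ⊠ id P) ⋆ assocHom P P P ⋆
        (id P ⊠ cross) ⋆ assocInv P P P)
  -- local relations: two strands of opposite directions
  | crossQP_crossPQ : Rel (crossQP ⋆ crossPQ)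
      ((id (Q.tensor P)).add ((capQP ⋆ cupQP).smul (-1)))
  | crossPQ_crossQP : Rel (crossPQ ⋆ crossQP) (id (P.tensor Q))
  -- local relations: the counterclockwise circle and the left curl
  | circle : Rel (cupQP ⋆ capQP) (id unit)
  | leftCurl : Rel leftCurl (zero P P)

instance setoid (X Y : HeisObj) : Setoid (Diagram X Y) :=
  ⟨Rel, Rel.refl, Rel.symm, Rel.trans⟩

end Diagram

open Diagram

instance : Category HeisObj where
  Hom X Y := Quotient (Diagram.setoid X Y)
  id X := ⟦Diagram.id X⟧
  comp := Quotient.map₂ Diagram.comp (fun _ _ hf _ _ hg => Rel.comp hf hg)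
  id_comp := by
    rintro X Y ⟨f⟩
    exact Quotient.sound (Rel.id_comp f)
  comp_id := by
    rintro X Y ⟨f⟩
    exact Quotient.sound (Rel.comp_id f)
  assoc := by
    rintro W X Y Z ⟨f⟩ ⟨g⟩ ⟨h⟩
    exact Quotient.sound (Rel.assoc f g h)

/-- The morphism given by a formal combination of diagrams. -/
def ofDiagram {X Y : HeisObj} (f : Diagram X Y) : X ⟶ Y := Quotient.mk (Diagram.setoid X Y) f

instance (X Y : HeisObj) : Zero (X ⟶ Y) := ⟨ofDiagram (Diagram.zero X Y)⟩

instance (X Y : HeisObj) : Add (X ⟶ Y) :=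
  ⟨Quotient.map₂ Diagram.add (fun _ _ hf _ _ hg => Rel.add hf hg)⟩

instance (X Y : HeisObj) : Neg (X ⟶ Y) :=
  ⟨Quotient.map (Diagram.smul (-1)) (fun _ _ hf => Rel.smul (-1) hf)⟩

instance (X Y : HeisObj) : AddCommGroup (X ⟶ Y) where
  add_assoc := by
    rintro ⟨f⟩ ⟨g⟩ ⟨h⟩
    exact Quotient.sound (Rel.add_assoc f g h)
  add_comm := by
    rintro ⟨f⟩ ⟨g⟩
    exact Quotient.sound (Rel.add_comm f g)
  zero_add := by
    rintro ⟨f⟩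
    exact Quotient.sound (Rel.zero_add f)
  add_zero := by
    rintro ⟨f⟩
    exact Quotient.sound (Rel.trans (Rel.add_comm f _) (Rel.zero_add f))
  neg_add_cancel := by
    rintro ⟨f⟩
    exact Quotient.sound (Rel.neg_add f)
  nsmul := nsmulRec
  zsmul := zsmulRec

instance : Preadditive HeisObj where
  add_comp := by
    rintro X Y Z ⟨f⟩ ⟨f'⟩ ⟨g⟩
    exact Quotient.sound (Rel.add_comp f f' g)
  comp_add := by
    rintro X Y Z ⟨f⟩ ⟨g⟩ ⟨g'⟩
    exact Quotient.sound (Rel.comp_add f g g')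

instance (X Y : HeisObj) : SMul ℂ (X ⟶ Y) where
  smul r := Quotient.map (Diagram.smul r) (fun _ _ hf => Rel.smul r hf)

instance (X Y : HeisObj) : Module ℂ (X ⟶ Y) :=
  Module.ofMinimalAxioms
    (by
      rintro r ⟨f⟩ ⟨g⟩
      exact Quotient.sound (Rel.smul_add r f g))
    (by
      rintro r s ⟨f⟩
      exact Quotient.sound (Rel.add_smul r s f))
    (by
      rintro r s ⟨f⟩
      exact Quotient.sound (Rel.mul_smul r s f))
    (by
      rintro ⟨f⟩
      exact Quotient.sound (Rel.one_smul f))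

instance : Linear ℂ HeisObj where
  smul_comp := by
    rintro X Y Z r ⟨f⟩ ⟨g⟩
    exact Quotient.sound (Rel.smul_comp r f g)
  comp_smul := by
    rintro X Y Z ⟨f⟩ r ⟨g⟩
    exact Quotient.sound (Rel.comp_smul f r g)

/-- The horizontal product of morphisms. -/
def tensorMap {X Y Z W : HeisObj} (f : X ⟶ Y) (g : Z ⟶ W) : X.tensor Z ⟶ Y.tensor W :=
  Quotient.map₂ Diagram.tensor (fun _ _ hf _ _ hg => Rel.tensor hf hg) f g

instance : MonoidalCategoryStruct HeisObj where
  tensorObj := HeisObj.tensor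
  tensorHom := tensorMap
  whiskerLeft X _ _ f := tensorMap (𝟙 X) f
  whiskerRight f X := tensorMap f (𝟙 X)
  tensorUnit := HeisObj.unit
  associator X Y Z :=
    ⟨ofDiagram (assocHom X Y Z), ofDiagram (assocInv X Y Z),
      Quotient.sound (Rel.assoc_hom_inv X Y Z), Quotient.sound (Rel.assoc_inv_hom X Y Z)⟩
  leftUnitor X :=
    ⟨ofDiagram (leftHom X), ofDiagram (leftInv X),
      Quotient.sound (Rel.left_hom_inv X), Quotient.sound (Rel.left_inv_hom X)⟩
  rightUnitor X :=
    ⟨ofDiagram (rightHom X), ofDiagram (rightInv X),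
      Quotient.sound (Rel.right_hom_inv X), Quotient.sound (Rel.right_inv_hom X)⟩

instance : MonoidalCategory HeisObj := MonoidalCategory.ofTensorHom
  (id_tensorHom_id := fun X Y => Quotient.sound (Rel.tensor_id X Y))
  (id_tensorHom := fun _ _ _ _ => rfl)
  (tensorHom_id := fun _ _ => rfl)
  (tensorHom_comp_tensorHom := by
    rintro X₁ Y₁ Z₁ X₂ Y₂ Z₂ ⟨f₁⟩ ⟨f₂⟩ ⟨g₁⟩ ⟨g₂⟩
    exact Quotient.sound (Rel.tensor_comp f₁ f₂ g₁ g₂))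
  (associator_naturality := by
    rintro X₁ X₂ X₃ Y₁ Y₂ Y₃ ⟨f₁⟩ ⟨f₂⟩ ⟨f₃⟩
    exact Quotient.sound (Rel.assoc_naturality f₁ f₂ f₃))
  (leftUnitor_naturality := by
    rintro X Y ⟨f⟩
    exact Quotient.sound (Rel.left_naturality f))
  (rightUnitor_naturality := by
    rintro X Y ⟨f⟩
    exact Quotient.sound (Rel.right_naturality f))
  (pentagon := fun W X Y Z => Quotient.sound (Rel.pentagon W X Y Z))
  (triangle := fun X Y => Quotient.sound (Rel.triangle X Y))

theorem tensorMap_add {X Y Z W : HeisObj} (f : X ⟶ Y) (g g' : Z ⟶ W) :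
    tensorMap f (g + g') = tensorMap f g + tensorMap f g' := by
  revert f g g'
  rintro ⟨f⟩ ⟨g⟩ ⟨g'⟩
  exact Quotient.sound (Rel.tensor_add f g g')

theorem add_tensorMap {X Y Z W : HeisObj} (f f' : X ⟶ Y) (g : Z ⟶ W) :
    tensorMap (f + f') g = tensorMap f g + tensorMap f' g := by
  revert f f' g
  rintro ⟨f⟩ ⟨f'⟩ ⟨g⟩
  exact Quotient.sound (Rel.add_tensor f f' g)

instance : MonoidalPreadditive HeisObj where
  whiskerLeft_zero {X Y Z} := by
    have h := tensorMap_add (𝟙 X) (0 : Y ⟶ Z) 0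
    rw [add_zero] at h
    exact left_eq_add.1 h
  zero_whiskerRight {X Y Z} := by
    have h := add_tensorMap (0 : Y ⟶ Z) 0 (𝟙 X)
    rw [add_zero] at h
    exact left_eq_add.1 h
  whiskerLeft_add f g := tensorMap_add _ f g
  add_whiskerRight f g := add_tensorMap f g _

instance : MonoidalLinear ℂ HeisObj where
  whiskerLeft_smul := by
    rintro X Y Z r ⟨f⟩
    exact Quotient.sound (Rel.tensor_smul _ r f)
  smul_whiskerRight := by
    rintro r Y Z ⟨f⟩ X
    exact Quotient.sound (Rel.smul_tensor r f _)

end HeisObj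

namespace Heis

/-! Morphisms of several parallel strands of one kind, in any monoidal category. -/

section Strands
universe v u
variable {C : Type u} [Category.{v} C] [MonoidalCategory C]

/-- `n` parallel strands `A ⊗ (A ⊗ (⋯ ⊗ 𝟙))`. -/
def strands (A : C) : ℕ → C
  | 0 => 𝟙_ C
  | n + 1 => A ⊗ strands A n

/-- The crossing `s_1` of the two leftmost of `n + 2` strands. -/
def firstCrossing {A : C} (t : A ⊗ A ⟶ A ⊗ A) (n : ℕ) :
    strands A (n + 2) ⟶ strands A (n + 2) :=
  (α_ A A (strands A n)).inv ≫ t ▷ strands A n ≫ (α_ A A (strands A n)).hom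

/-- The diagram of the `n`-cycle `σ_n = s_1 s_2 ⋯ s_{n-1}` (with `s_1` on top): the rightmost
lower end is joined to the leftmost upper end. -/
def longCycle {A : C} (t : A ⊗ A ⟶ A ⊗ A) : ∀ n : ℕ, strands A n ⟶ strands A n
  | 0 => 𝟙 _
  | 1 => 𝟙 _
  | n + 2 => A ◁ longCycle t (n + 1) ≫ firstCrossing t n

/-- `j i` dots on the `i`-th strand from the left, for each `i`. -/
def dots {A : C} (d : A ⟶ A) : ∀ (n : ℕ) (_ : Fin n → ℕ), strands A n ⟶ strands A n
  | 0, _ => 𝟙 _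
  | n + 1, j => ((show End A from d) ^ j 0 : End A) ⊗ₘ dots d n (fun i => j i.succ)

end Strands

/-- The category `H`: the idempotent completion of the additive monoidal category generated by
`P` and `Q`. -/
abbrev Cat : Type 1 := Idempotents.Karoubi (Mat_ HeisObj)

/-- The algebra `Tr(H)`, with product `[f] [g] = [f ⊗ g]`. -/
abbrev TrH : Type 1 := Tr ℂ Cat

/-- The inclusion of the category of diagrams in `H`. -/
def incl : HeisObj ⥤ Cat := Mat_.embedding HeisObj ⋙ Idempotents.toKaroubi (Mat_ HeisObj)

/-- The class in `Tr(H)` of an endomorphism given by diagrams. -/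
def cls {X : HeisObj} (f : X ⟶ X) : TrH := Tr.mk ℂ (incl.map f)

/-- The upward crossing. -/
def crossUp : (HeisObj.P ⊗ HeisObj.P) ⟶ (HeisObj.P ⊗ HeisObj.P) :=
  HeisObj.ofDiagram HeisObj.Diagram.cross

/-- The downward crossing. -/
def crossDown : (HeisObj.Q ⊗ HeisObj.Q) ⟶ (HeisObj.Q ⊗ HeisObj.Q) :=
  HeisObj.ofDiagram HeisObj.Diagram.crossQQ

/-- The dot on an upward strand. -/
def dotUp : HeisObj.P ⟶ HeisObj.P := HeisObj.ofDiagram HeisObj.Diagram.dotP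

/-- The dot on a downward strand. -/
def dotDown : HeisObj.Q ⟶ HeisObj.Q := HeisObj.ofDiagram HeisObj.Diagram.dotQ

/-- `h_n ⊗ (x_1 ^ j_1 ⋯ x_|n| ^ j_|n|)` for `n ≠ 0`: the class of the long cycle on `|n|` strands,
upward if `n > 0` and downward if `n < 0`, with `j_i` dots on top of its `i`-th strand. -/
def h (n : ℤ) (j : Fin n.natAbs → ℕ) : TrH :=
  if 0 < n then cls (longCycle crossUp n.natAbs ≫ dots dotUp n.natAbs j)
  else cls (longCycle crossDown n.natAbs ≫ dots dotDown n.natAbs j)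

/-- The class of the clockwise circle without dots. -/
def c₀ : TrH :=
  cls (X := HeisObj.unit)
    (HeisObj.ofDiagram (HeisObj.Diagram.comp HeisObj.Diagram.cupPQ HeisObj.Diagram.capPQ))

/-- `b_l = h_{-l} ⊗ 1` for `l ≠ 0`, and `b_0 = 0`. -/
def b (l : ℤ) : TrH := if l = 0 then 0 else h (-l) 0

/-- `L_l = |1 / l| h_{-l} ⊗ (x_1 + ⋯ + x_|l|)` for `l ≠ 0`, and `L_0 = c_0`. -/
def L (l : ℤ) : TrH :=
  if l = 0 then c₀
  else ((l.natAbs : ℂ)⁻¹) • ∑ i : Fin (-l).natAbs, h (-l) (Pi.single i 1)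

end Heis

end

/-!
The brackets are computed in three stages: a calculus of diagrams, the resulting commutators of
classes of diagrams in the trace, and a recursion in Lie algebras.

*Diagrams.* All diagrams are written with an arbitrary object on their right and bracketed to the
right (`tail`, `cupTail`, `capTail`), so that the local relations (`Data`) involve no associators.
The relations imply that the dot and the crossing of upward strands satisfy the relations of the
degenerate affine Hecke algebras (`Data.cross_dot`). Bending downward strands up gives the same for
these, except that the correction term in sliding a dot through a crossing changes its sign
(`Data.crossQQ_dot`). Both directions are therefore treated at once as a `Strand` with a sign `σ`.
Moreover a clockwise circle slides through a strand at the cost of `σ` times that strand, and a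
clockwise circle with a dot at the cost of `2 σ` times the strand with a dot (`Slides`).

*Classes.* Let `B n` be the class of the long cycle on `n` parallel strands, `x a` that of one
strand with `a` dots, `Σ n` the sum of the classes of the long cycle with one dot, `D` half of the
class of the clockwise circle with a dot, and `ℓ n = σ n⁻¹ Σ n`. As the trace is invariant under
conjugation, sliding a strand from the left of a long cycle to its right, where each transposition
in the correction of a dot merges the strand into the cycle, gives
`⁅x 0, B n⁆ = 0` and `⁅x 1, B n⁆ = σ n B (n + 1)`, and sliding the circle gives
`⁅D, B n⁆ = n ℓ n` and `⁅D, x a⁆ = σ x (a + 1)`. Computations in the Hecke algebras of two and three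
strands (`hecke_two`, `hecke_three`) express `⁅x 3, x 0⁆` by `⁅x 2, x 1⁆` and `⁅x 1, x 0⁆`, and show
that `x 1` commutes with `⁅x 2, x 1⁆`. For strands of opposite directions, resolving the identity
of `QP` gives `⁅Q, P⁆ = 1`, that a strand with a dot commutes with an opposite strand without, and
that the brackets of a dotted downward strand with an upward strand with one or two dots are
`2 c₀` and `6 D`.

*Lie algebras.* The relations for one direction determine all brackets of the `B n` and `ℓ n`
(`HalfHeisVir.B_B`, `HalfHeisVir.l_B`, `HalfHeisVir.l_l`): linear equations obtained from the Jacobi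
identity fix the brackets in low degrees, and bracketing with `ℓ 1` raises the degree. The brackets
of opposite directions follow in the same way from the few relations between single strands
(`HeisVir.b_b`, `HeisVir.V_b`, `HeisVir.V_V`). The central charge comes from
`⁅L 2, L (-2)⁆ = 4 L 0 + 1 / 2` (`HeisVir.V_two_V_neg_two`), whose constant term is produced by
`⁅b 2, b (-2)⁆ = 2` and the correction `b 2 / 2` in `⁅D, L 2⁆`.
-/

noncomputable section

open CategoryTheory MonoidalCategory

namespace Heis

universe v u
set_option linter.unusedSectionVars false

/-! ### Classes of diagrams in the trace -/

theorem cls_comp_comm {X Y : HeisObj} (f : X ⟶ Y) (g : Y ⟶ X) : cls (f ≫ g) = cls (g ≫ f) := by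
  simp only [cls, Functor.map_comp]
  exact Tr.mk_comp_comm ℂ _ _

instance : incl.Additive := by unfold incl; infer_instance

theorem cls_add {X : HeisObj} (f g : X ⟶ X) : cls (f + g) = cls f + cls g := by
  simp only [cls, Functor.map_add, map_add]

theorem one_eq_cls : (1 : TrH) = cls (𝟙 (𝟙_ HeisObj)) := by
  rw [Tr.one_def, cls, incl.map_id]
  rfl

/-- A direct sum with one term, as an object of the additive closure. -/
abbrev single (X : HeisObj) : Mat_ HeisObj := ⟨PUnit, fun _ => X⟩

/-- A tensor product of one-term direct sums is a direct sum indexed by `PUnit × PUnit`, hence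
again has one term. -/
def singleTensor (X Y : HeisObj) : Mat_.tensorObj' (single X) (single Y) ≅ single (X ⊗ Y) where
  hom := Mat_.diag (M := Mat_.tensorObj' (single X) (single Y)) (N := single (X ⊗ Y))
    (fun _ => PUnit.unit) (fun _ => 𝟙 (X ⊗ Y))
  inv := Mat_.diag (M := single (X ⊗ Y)) (N := Mat_.tensorObj' (single X) (single Y))
    (fun _ => (PUnit.unit, PUnit.unit)) (fun _ => 𝟙 (X ⊗ Y))
  hom_inv_id := by
    rw [Mat_.diag_comp_diag, Mat_.id_eq_diag]
    simp
  inv_hom_id := by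
    rw [Mat_.diag_comp_diag, Mat_.id_eq_diag]
    simp

theorem singleTensor_natural {X Y : HeisObj} (f : X ⟶ X) (g : Y ⟶ Y) :
    Mat_.tensorHom' (M := single X) (M' := single X) (N := single Y) (N' := single Y)
        (fun _ _ => f) (fun _ _ => g) ≫ (singleTensor X Y).hom =
      (singleTensor X Y).hom ≫ (fun _ _ => f ⊗ₘ g : single (X ⊗ Y) ⟶ single (X ⊗ Y)) := by
  ext ⟨⟨⟩, ⟨⟩⟩ ⟨⟩
  refine (Mat_.comp_diag_apply (N := Mat_.tensorObj' (single X) (single Y)) (K := single (X ⊗ Y))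
    _ (fun _ => PUnit.unit) (fun _ _ _ => Subsingleton.elim (α := PUnit × PUnit) _ _)
    (fun _ => 𝟙 (X ⊗ Y)) _
    (PUnit.unit, PUnit.unit)).trans ?_
  refine Eq.trans ?_ (Mat_.diag_comp_apply (M := Mat_.tensorObj' (single X) (single Y))
    (N := single (X ⊗ Y)) (fun _ => PUnit.unit) (fun _ => 𝟙 (X ⊗ Y)) _ _ _).symm
  exact (Category.comp_id _).trans (Category.id_comp _).symm

/-- The product of classes of diagrams is the class of their juxtaposition. In the additive closure
the tensor product of one-term sums is identified with a one-term sum by `singleTensor`. -/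
theorem cls_mul {X Y : HeisObj} (f : X ⟶ X) (g : Y ⟶ Y) : cls f * cls g = cls (f ⊗ₘ g) := by
  have hp : Mat_.tensorHom' (𝟙 (single X)) (𝟙 (single Y)) ≫ (singleTensor X Y).hom =
      (singleTensor X Y).hom ≫ 𝟙 (single (X ⊗ Y)) := by
    rw [Mat_.tensorHom'_id, Category.id_comp, Category.comp_id]
  rw [cls, cls, Tr.mk_mul_mk]
  refine Tr.mk_eq_of_iso ℂ (Idempotents.Karoubi.isoOfIso (incl.obj X ⊗ incl.obj Y)
    (incl.obj (X ⊗ Y)) (singleTensor X Y) hp) ?_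
  ext : 1
  have h := singleTensor_natural f g
  have h₁ : Mat_.tensorHom' (𝟙 (single X)) (𝟙 (single Y)) = 𝟙 _ := Mat_.tensorHom'_id _ _
  change Mat_.tensorHom' (M := single X) (M' := single X) (N := single Y) (N' := single Y)
        (fun _ _ => f) (fun _ _ => g) ≫ (Mat_.tensorHom' (𝟙 (single X)) (𝟙 (single Y)) ≫
          (singleTensor X Y).hom) =
      (Mat_.tensorHom' (𝟙 (single X)) (𝟙 (single Y)) ≫ (singleTensor X Y).hom) ≫
        (fun _ _ => f ⊗ₘ g : single (X ⊗ Y) ⟶ single (X ⊗ Y))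
  rw [h₁]
  erw [Category.id_comp]
  exact h

theorem cls_eq_of_iso {X Y : HeisObj} (i : X ≅ Y) {f : X ⟶ X} {g : Y ⟶ Y}
    (h : f ≫ i.hom = i.hom ≫ g) : cls f = cls g := by
  have h₁ : f = i.hom ≫ (g ≫ i.inv) := by
    rw [← Category.assoc, ← h, Category.assoc, Iso.hom_inv_id, Category.comp_id]
  rw [h₁, cls_comp_comm, Category.assoc, Iso.inv_hom_id, Category.comp_id]

/-! ### String diagrams with a tail -/

section Tail

variable {C : Type u} [Category.{v} C] [MonoidalCategory C]

/-- The diagram `f` with two ends on both sides, with an object `X` added on the right, bracketed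
to the right. -/
def tail {A B A' B' : C} (f : A ⊗ B ⟶ A' ⊗ B') (X : C) : A ⊗ (B ⊗ X) ⟶ A' ⊗ (B' ⊗ X) :=
  (α_ A B X).inv ≫ f ▷ X ≫ (α_ A' B' X).hom

/-- A cup to the left of the object `X`, bracketed to the right. -/
def cupTail {A B : C} (f : 𝟙_ C ⟶ A ⊗ B) (X : C) : X ⟶ A ⊗ (B ⊗ X) :=
  (λ_ X).inv ≫ f ▷ X ≫ (α_ A B X).hom

/-- A cap to the left of the object `X`, bracketed to the right. -/
def capTail {A B : C} (f : A ⊗ B ⟶ 𝟙_ C) (X : C) : A ⊗ (B ⊗ X) ⟶ X :=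
  (α_ A B X).inv ≫ f ▷ X ≫ (λ_ X).hom

theorem tail_naturality {A B A' B' : C} (f : A ⊗ B ⟶ A' ⊗ B') {X Y : C} (g : X ⟶ Y) :
    A ◁ (B ◁ g) ≫ tail f Y = tail f X ≫ A' ◁ (B' ◁ g) := by
  rw [tail, tail, associator_inv_naturality_right_assoc, whisker_exchange_assoc,
    associator_naturality_right, Category.assoc, Category.assoc]

theorem cupTail_naturality {A B : C} (f : 𝟙_ C ⟶ A ⊗ B) {X Y : C} (g : X ⟶ Y) :
    g ≫ cupTail f Y = cupTail f X ≫ A ◁ (B ◁ g) := by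
  rw [cupTail, cupTail, leftUnitor_inv_naturality_assoc, whisker_exchange_assoc,
    associator_naturality_right, Category.assoc, Category.assoc]

theorem capTail_naturality {A B : C} (f : A ⊗ B ⟶ 𝟙_ C) {X Y : C} (g : X ⟶ Y) :
    A ◁ (B ◁ g) ≫ capTail f Y = capTail f X ≫ g := by
  rw [capTail, capTail, associator_inv_naturality_right_assoc, whisker_exchange_assoc,
    leftUnitor_naturality, Category.assoc, Category.assoc]

@[simp]
theorem tail_id (A B X : C) : tail (𝟙 (A ⊗ B)) X = 𝟙 _ := by simp [tail]

theorem tail_comp {A B A' B' A'' B'' : C} (f : A ⊗ B ⟶ A' ⊗ B') (g : A' ⊗ B' ⟶ A'' ⊗ B'')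
    (X : C) : tail (f ≫ g) X = tail f X ≫ tail g X := by simp [tail]

theorem tail_add [Preadditive C] [MonoidalPreadditive C] {A B A' B' : C}
    (f g : A ⊗ B ⟶ A' ⊗ B') (X : C) : tail (f + g) X = tail f X + tail g X := by simp [tail]

theorem tail_cap_cup {A B A' B' : C} (f : A ⊗ B ⟶ 𝟙_ C) (g : 𝟙_ C ⟶ A' ⊗ B') (X : C) :
    tail (f ≫ g) X = capTail f X ≫ cupTail g X := by simp [tail, capTail, cupTail]

theorem cupTail_capTail {A B : C} (f : 𝟙_ C ⟶ A ⊗ B) (g : A ⊗ B ⟶ 𝟙_ C) (X : C) :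
    cupTail f X ≫ capTail g X = (λ_ X).inv ≫ (f ≫ g) ▷ X ≫ (λ_ X).hom := by
  simp [capTail, cupTail]

/-- A crossing rotated by a cup on its right and a cap on its left. -/
theorem tail_rotateLeft {A B X Y Z W : C} (f : X ⊗ Y ⟶ Z ⊗ W) (cup : 𝟙_ C ⟶ Y ⊗ B)
    (cap : A ⊗ Z ⟶ 𝟙_ C) (K : C) :
    tail ((ρ_ (A ⊗ X)).inv ≫ (A ⊗ X) ◁ cup ≫
      ((α_ A X (Y ⊗ B)).hom ≫ A ◁ (α_ X Y B).inv ≫ A ◁ (f ▷ B) ≫ A ◁ (α_ Z W B).hom ≫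
        (α_ A Z (W ⊗ B)).inv) ≫ cap ▷ (W ⊗ B) ≫ (λ_ (W ⊗ B)).hom) K =
      A ◁ (X ◁ cupTail cup K) ≫ A ◁ tail f (B ⊗ K) ≫ capTail cap (W ⊗ (B ⊗ K)) := by
  simp only [tail, cupTail, capTail]
  monoidal

/-- A crossing rotated by a cup on its left and a cap on its right. -/
theorem tail_rotateRight {A B X Y Z W : C} (f : X ⊗ Y ⟶ Z ⊗ W) (cup : 𝟙_ C ⟶ A ⊗ X)
    (cap : W ⊗ B ⟶ 𝟙_ C) (K : C) :
    tail ((λ_ (Y ⊗ B)).inv ≫ cup ▷ (Y ⊗ B) ≫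
      ((α_ A X (Y ⊗ B)).hom ≫ A ◁ (α_ X Y B).inv ≫ A ◁ (f ▷ B) ≫ A ◁ (α_ Z W B).hom ≫
        (α_ A Z (W ⊗ B)).inv) ≫ (A ⊗ Z) ◁ cap ≫ (ρ_ (A ⊗ Z)).hom) K =
      cupTail cup (Y ⊗ (B ⊗ K)) ≫ A ◁ tail f (B ⊗ K) ≫ A ◁ (Z ◁ capTail cap K) := by
  simp only [tail, cupTail, capTail]
  monoidal

/-- A zigzag identity turns into one with any object on the right. -/
theorem zigzag_tail {A B : C} (cup : 𝟙_ C ⟶ A ⊗ B) (cap : B ⊗ A ⟶ 𝟙_ C)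
    (h : (λ_ A).inv ≫ cup ▷ A ≫ (α_ A B A).hom ≫ A ◁ cap ≫ (ρ_ A).hom = 𝟙 A) (X : C) :
    cupTail cup (A ⊗ X) ≫ A ◁ capTail cap X = 𝟙 (A ⊗ X) := by
  have : cupTail cup (A ⊗ X) ≫ A ◁ capTail cap X =
      ((λ_ A).inv ≫ cup ▷ A ≫ (α_ A B A).hom ≫ A ◁ cap ≫ (ρ_ A).hom) ▷ X := by
    simp only [cupTail, capTail]
    monoidal
  rw [this, h, id_whiskerRight]

theorem zigzag_tail' {A B : C} (cup : 𝟙_ C ⟶ B ⊗ A) (cap : A ⊗ B ⟶ 𝟙_ C)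
    (h : (ρ_ A).inv ≫ A ◁ cup ≫ (α_ A B A).inv ≫ cap ▷ A ≫ (λ_ A).hom = 𝟙 A) (X : C) :
    A ◁ cupTail cup X ≫ capTail cap (A ⊗ X) = 𝟙 (A ⊗ X) := by
  have : A ◁ cupTail cup X ≫ capTail cap (A ⊗ X) =
      ((ρ_ A).inv ≫ A ◁ cup ≫ (α_ A B A).inv ≫ cap ▷ A ≫ (λ_ A).hom) ▷ X := by
    simp only [cupTail, capTail]
    monoidal
  rw [this, h, id_whiskerRight]

/-- The braid relation turns into one with any object on the right. -/
theorem braid_tail {A : C} (t : A ⊗ A ⟶ A ⊗ A)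
    (h : t ▷ A ≫ (α_ A A A).hom ≫ A ◁ t ≫ (α_ A A A).inv ≫ t ▷ A =
      (α_ A A A).hom ≫ A ◁ t ≫ (α_ A A A).inv ≫ t ▷ A ≫ (α_ A A A).hom ≫ A ◁ t ≫
        (α_ A A A).inv) (X : C) :
    tail t (A ⊗ X) ≫ A ◁ tail t X ≫ tail t (A ⊗ X) =
      A ◁ tail t X ≫ tail t (A ⊗ X) ≫ A ◁ tail t X := by
  have h₁ : tail t (A ⊗ X) ≫ A ◁ tail t X ≫ tail t (A ⊗ X) =
      (α_ A A (A ⊗ X)).inv ≫ (α_ (A ⊗ A) A X).inv ≫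
        (t ▷ A ≫ (α_ A A A).hom ≫ A ◁ t ≫ (α_ A A A).inv ≫ t ▷ A) ▷ X ≫
        (α_ (A ⊗ A) A X).hom ≫ (α_ A A (A ⊗ X)).hom := by
    simp only [tail]
    monoidal
  rw [h₁, h]
  simp only [tail]
  monoidal

theorem rightCurl_tail {A B : C} (t : A ⊗ A ⟶ A ⊗ A) (cup : 𝟙_ C ⟶ A ⊗ B)
    (cap : A ⊗ B ⟶ 𝟙_ C) (X : C) :
    ((ρ_ A).inv ≫ A ◁ cup ≫ (α_ A A B).inv ≫ t ▷ B ≫ (α_ A A B).hom ≫ A ◁ cap ≫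
      (ρ_ A).hom) ▷ X =
    A ◁ cupTail cup X ≫ tail t (B ⊗ X) ≫ A ◁ capTail cap X := by
  simp only [tail, cupTail, capTail]
  monoidal

theorem leftCurl_tail {A B : C} (t : A ⊗ A ⟶ A ⊗ A) (cup : 𝟙_ C ⟶ B ⊗ A)
    (cap : B ⊗ A ⟶ 𝟙_ C) (X : C) :
    ((λ_ A).inv ≫ cup ▷ A ≫ (α_ B A A).hom ≫ B ◁ t ≫ (α_ B A A).inv ≫ cap ▷ A ≫
      (λ_ A).hom) ▷ X =
    cupTail cup (A ⊗ X) ≫ B ◁ tail t X ≫ capTail cap (A ⊗ X) := by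
  simp only [tail, cupTail, capTail]
  monoidal

theorem rotate_tail {A B : C} (d : A ⟶ A) (cup : 𝟙_ C ⟶ A ⊗ B) (cap : B ⊗ A ⟶ 𝟙_ C) (X : C) :
    ((ρ_ B).inv ≫ B ◁ cup ≫ B ◁ (d ▷ B) ≫ (α_ B A B).inv ≫ cap ▷ B ≫ (λ_ B).hom) ▷ X =
    B ◁ cupTail cup X ≫ B ◁ (d ▷ (B ⊗ X)) ≫ capTail cap (B ⊗ X) := by
  simp only [cupTail, capTail]
  monoidal

end Tail

/-! ### The local relations with a tail -/

/-- The generating diagrams of the Heisenberg category in a monoidal category, subject to the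
local relations, each stated for diagrams with an arbitrary object `X` to the right. In this form
all diagrams are bracketed to the right and no associators occur. -/
structure Data (C : Type u) [Category.{v} C] [MonoidalCategory C] [Preadditive C] where
  /-- The upward strand. -/
  P : C
  /-- The downward strand. -/
  Q : C
  /-- The upward crossing. -/
  cross : P ⊗ P ⟶ P ⊗ P
  /-- The cup `1 ⟶ P Q`. -/
  cupPQ : 𝟙_ C ⟶ P ⊗ Q
  /-- The cup `1 ⟶ Q P`. -/
  cupQP : 𝟙_ C ⟶ Q ⊗ P
  /-- The cap `P Q ⟶ 1`. -/
  capPQ : P ⊗ Q ⟶ 𝟙_ C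
  /-- The cap `Q P ⟶ 1`. -/
  capQP : Q ⊗ P ⟶ 𝟙_ C
  /-- The crossing `Q P ⟶ P Q`. -/
  crossQP : Q ⊗ P ⟶ P ⊗ Q
  /-- The crossing `P Q ⟶ Q P`. -/
  crossPQ : P ⊗ Q ⟶ Q ⊗ P
  /-- The downward crossing. -/
  crossQQ : Q ⊗ Q ⟶ Q ⊗ Q
  /-- The dot on an upward strand. -/
  dotP : P ⟶ P
  /-- The dot on a downward strand. -/
  dotQ : Q ⟶ Q
  zigzag_P (X : C) : cupTail cupPQ (P ⊗ X) ≫ P ◁ capTail capQP X = 𝟙 (P ⊗ X)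
  zigzag_P' (X : C) : P ◁ cupTail cupQP X ≫ capTail capPQ (P ⊗ X) = 𝟙 (P ⊗ X)
  zigzag_Q' (X : C) : Q ◁ cupTail cupPQ X ≫ capTail capQP (Q ⊗ X) = 𝟙 (Q ⊗ X)
  crossQP_eq (X : C) : tail crossQP X =
    Q ◁ (P ◁ cupTail cupPQ X) ≫ Q ◁ tail cross (Q ⊗ X) ≫ capTail capQP (P ⊗ (Q ⊗ X))
  crossPQ_eq (X : C) : tail crossPQ X =
    cupTail cupQP (P ⊗ (Q ⊗ X)) ≫ Q ◁ tail cross (Q ⊗ X) ≫ Q ◁ (P ◁ capTail capPQ X)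
  crossQQ_eq (X : C) : tail crossQQ X =
    Q ◁ (Q ◁ cupTail cupPQ X) ≫ Q ◁ tail crossQP (Q ⊗ X) ≫ capTail capQP (Q ⊗ (Q ⊗ X))
  dotP_eq (X : C) : dotP ▷ X =
    P ◁ cupTail cupPQ X ≫ tail cross (Q ⊗ X) ≫ P ◁ capTail capPQ X
  dotQ_eq (X : C) : dotQ ▷ X =
    Q ◁ cupTail cupPQ X ≫ Q ◁ (dotP ▷ (Q ⊗ X)) ≫ capTail capQP (Q ⊗ X)
  cross_cross (X : C) : tail cross X ≫ tail cross X = 𝟙 (P ⊗ (P ⊗ X))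
  braid (X : C) : tail cross (P ⊗ X) ≫ P ◁ tail cross X ≫ tail cross (P ⊗ X) =
    P ◁ tail cross X ≫ tail cross (P ⊗ X) ≫ P ◁ tail cross X
  crossQP_crossPQ (X : C) : tail crossQP X ≫ tail crossPQ X =
    𝟙 (Q ⊗ (P ⊗ X)) - capTail capQP X ≫ cupTail cupQP X
  crossPQ_crossQP (X : C) : tail crossPQ X ≫ tail crossQP X = 𝟙 (P ⊗ (Q ⊗ X))
  circle (X : C) : cupTail cupQP X ≫ capTail capQP X = 𝟙 X
  leftCurl (X : C) :
    cupTail cupQP (P ⊗ X) ≫ Q ◁ tail cross X ≫ capTail capQP (P ⊗ X) = 0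

open HeisObj in
/-- The generating diagrams in the category of diagrams. -/
def diagrams : Data HeisObj where
  P := HeisObj.P
  Q := HeisObj.Q
  cross := ofDiagram Diagram.cross
  cupPQ := ofDiagram Diagram.cupPQ
  cupQP := ofDiagram Diagram.cupQP
  capPQ := ofDiagram Diagram.capPQ
  capQP := ofDiagram Diagram.capQP
  crossQP := ofDiagram Diagram.crossQP
  crossPQ := ofDiagram Diagram.crossPQ
  crossQQ := ofDiagram Diagram.crossQQ
  dotP := ofDiagram Diagram.dotP
  dotQ := ofDiagram Diagram.dotQ
  zigzag_P := zigzag_tail _ _ (Quotient.sound Diagram.Rel.zigzag_P)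
  zigzag_P' := zigzag_tail' _ _ (Quotient.sound Diagram.Rel.zigzag_P')
  zigzag_Q' := zigzag_tail' _ _ (Quotient.sound Diagram.Rel.zigzag_Q')
  crossQP_eq := tail_rotateLeft (ofDiagram Diagram.cross) (ofDiagram Diagram.cupPQ)
    (ofDiagram Diagram.capQP)
  crossPQ_eq := tail_rotateRight (ofDiagram Diagram.cross) (ofDiagram Diagram.cupQP)
    (ofDiagram Diagram.capPQ)
  crossQQ_eq := tail_rotateLeft (ofDiagram Diagram.crossQP) (ofDiagram Diagram.cupPQ)
    (ofDiagram Diagram.capQP)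
  dotP_eq := rightCurl_tail (ofDiagram Diagram.cross) (ofDiagram Diagram.cupPQ)
    (ofDiagram Diagram.capPQ)
  dotQ_eq := rotate_tail (ofDiagram Diagram.dotP) (ofDiagram Diagram.cupPQ)
    (ofDiagram Diagram.capQP)
  cross_cross X := by
    have h : ofDiagram Diagram.cross ≫ ofDiagram Diagram.cross = 𝟙 (HeisObj.P ⊗ HeisObj.P) :=
      Quotient.sound Diagram.Rel.cross_cross
    rw [← tail_comp, h, tail_id]
  braid := braid_tail (ofDiagram Diagram.cross) (Quotient.sound Diagram.Rel.braid)
  crossQP_crossPQ X := by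
    have h : ofDiagram Diagram.crossQP ≫ ofDiagram Diagram.crossPQ = 𝟙 (HeisObj.Q ⊗ HeisObj.P) -
        ofDiagram Diagram.capQP ≫ ofDiagram Diagram.cupQP := by
      rw [sub_eq_add_neg]
      exact Quotient.sound Diagram.Rel.crossQP_crossPQ
    rw [← tail_comp, ← tail_cap_cup, eq_sub_iff_add_eq, ← tail_add, h, sub_add_cancel, tail_id]
  crossPQ_crossQP X := by
    have h : ofDiagram Diagram.crossPQ ≫ ofDiagram Diagram.crossQP = 𝟙 (HeisObj.P ⊗ HeisObj.Q) :=
      Quotient.sound Diagram.Rel.crossPQ_crossQP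
    rw [← tail_comp, h, tail_id]
  circle X := by
    have h : ofDiagram Diagram.cupQP ≫ ofDiagram Diagram.capQP = 𝟙 (𝟙_ HeisObj) :=
      Quotient.sound Diagram.Rel.circle
    rw [cupTail_capTail, h]
    simp
  leftCurl X := by
    have h : ofDiagram Diagram.leftCurl = 0 := Quotient.sound Diagram.Rel.leftCurl
    refine (leftCurl_tail (ofDiagram Diagram.cross) _ _ X).symm.trans ?_
    refine (congrArg (fun f : HeisObj.P ⟶ HeisObj.P => f ▷ X) h).trans ?_
    exact MonoidalPreadditive.zero_whiskerRight

/-! ### Calculus of diagrams -/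

section Calculus

variable {C : Type u} [Category.{v} C] [MonoidalCategory C] [Preadditive C] [MonoidalPreadditive C]

theorem whiskerLeft_sub (A : C) {X Y : C} (f g : X ⟶ Y) : A ◁ (f - g) = A ◁ f - A ◁ g :=
  (tensorLeft A).map_sub

theorem whiskerLeft_zsmul (A : C) {X Y : C} (n : ℤ) (f : X ⟶ Y) : A ◁ (n • f) = n • A ◁ f :=
  (tensorLeft A).map_zsmul

namespace Data

variable (H : Data C)

local notation "P" => Data.P H
local notation "Q" => Data.Q H
local notation "η" => cupTail (Data.cupPQ H)
local notation "ε" => capTail (Data.capQP H)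
local notation "η₂" => cupTail (Data.cupQP H)
local notation "ε₂" => capTail (Data.capPQ H)
local notation "T" => tail (Data.cross H)
local notation "U" => tail (Data.crossQP H)
local notation "V" => tail (Data.crossPQ H)
local notation "S" => tail (Data.crossQQ H)
local notation "d" => Data.dotP H
local notation "dQ" => Data.dotQ H

/-- A cup can be pulled across an upward strand, on either side. -/
theorem cup_crossQP (X : C) : η (P ⊗ X) ≫ P ◁ U X = P ◁ η X ≫ T (Q ⊗ X) := by
  rw [crossQP_eq]
  simp only [whiskerLeft_comp]
  rw [← reassoc_of% cupTail_naturality, ← reassoc_of% cupTail_naturality, zigzag_P,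
    Category.comp_id]

/-- A cap can be pulled across an upward strand, on either side. -/
theorem crossPQ_cap (X : C) : P ◁ V X ≫ ε₂ (P ⊗ X) = T (Q ⊗ X) ≫ P ◁ ε₂ X := by
  rw [crossPQ_eq]
  simp only [whiskerLeft_comp, Category.assoc]
  rw [capTail_naturality, reassoc_of% capTail_naturality, reassoc_of% zigzag_P']

/-- Since the counterclockwise circle is `1`, the cap `Q P ⟶ 1` is killed by the complement of the
idempotent that it forms with the cup. -/
theorem crossPQ_capQP (X : C) : V X ≫ ε X = 0 := by
  have h : (U X ≫ V X) ≫ ε X = 0 := by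
    rw [crossQP_crossPQ, Preadditive.sub_comp, Category.assoc, circle]
    simp
  rw [← Category.id_comp (V X ≫ ε X), ← crossPQ_crossQP, Category.assoc, ← Category.assoc (U X),
    h, Limits.comp_zero]

/-- The dual of `crossPQ_capQP`. -/
theorem cupQP_crossQP (X : C) : η₂ X ≫ U X = 0 := by
  have h : η₂ X ≫ U X ≫ V X = 0 := by
    rw [crossQP_crossPQ, Preadditive.comp_sub, reassoc_of% circle]
    simp
  rw [← Category.comp_id (η₂ X ≫ U X), ← crossPQ_crossQP, Category.assoc, ← Category.assoc (U X),
    ← Category.assoc (η₂ X), h, Limits.zero_comp]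

/-- A strand is pulled through the curl by the braid relation. This leaves a double crossing of
strands of opposite directions, whose resolution produces the correction. -/
theorem cross_dot_cross (X : C) :
    T X ≫ P ◁ (d ▷ X) ≫ T X = d ▷ (P ⊗ X) - T X := by
  have h₁ : P ◁ (P ◁ η X) ≫ P ◁ T (Q ⊗ X) = P ◁ η (P ⊗ X) ≫ P ◁ (P ◁ U X) := by
    rw [← whiskerLeft_comp, ← cup_crossQP, whiskerLeft_comp]
  have h₂ : P ◁ T (Q ⊗ X) ≫ P ◁ (P ◁ ε₂ X) = P ◁ (P ◁ V X) ≫ P ◁ ε₂ (P ⊗ X) := by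
    rw [← whiskerLeft_comp, ← crossPQ_cap, whiskerLeft_comp]
  have h₃ : P ◁ η (P ⊗ X) ≫ P ◁ (P ◁ ε X) = 𝟙 _ := by
    rw [← whiskerLeft_comp, zigzag_P, whiskerLeft_id]
  have h₄ : P ◁ (P ◁ η₂ X) ≫ P ◁ ε₂ (P ⊗ X) = 𝟙 _ := by
    rw [← whiskerLeft_comp, zigzag_P', whiskerLeft_id]
  calc T X ≫ P ◁ (d ▷ X) ≫ T X
      = P ◁ (P ◁ η X) ≫ (T (P ⊗ (Q ⊗ X)) ≫ P ◁ T (Q ⊗ X) ≫ T (P ⊗ (Q ⊗ X))) ≫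
          P ◁ (P ◁ ε₂ X) := by
        rw [dotP_eq]
        simp only [whiskerLeft_comp, Category.assoc]
        rw [tail_naturality, reassoc_of% tail_naturality]
    _ = P ◁ η (P ⊗ X) ≫ P ◁ (P ◁ U X) ≫ T (P ⊗ (Q ⊗ X)) ≫ P ◁ (P ◁ V X) ≫ P ◁ ε₂ (P ⊗ X) := by
        rw [braid]
        simp only [Category.assoc]
        rw [h₂, reassoc_of% h₁]
    _ = P ◁ η (P ⊗ X) ≫ T (Q ⊗ (P ⊗ X)) ≫ P ◁ (P ◁ (U X ≫ V X)) ≫ P ◁ ε₂ (P ⊗ X) := by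
        rw [reassoc_of% tail_naturality]
        simp only [whiskerLeft_comp, Category.assoc]
    _ = d ▷ (P ⊗ X) - P ◁ η (P ⊗ X) ≫ (T (Q ⊗ (P ⊗ X)) ≫ P ◁ (P ◁ ε X)) ≫
          P ◁ (P ◁ η₂ X) ≫ P ◁ ε₂ (P ⊗ X) := by
        rw [crossQP_crossPQ, dotP_eq]
        simp [whiskerLeft_sub]
    _ = d ▷ (P ⊗ X) - T X := by
        rw [h₄, ← tail_naturality, Category.comp_id, reassoc_of% h₃]

theorem cross_dot (X : C) :
    T X ≫ d ▷ (P ⊗ X) = P ◁ (d ▷ X) ≫ T X + 𝟙 _ := by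
  have h := congrArg (T X ≫ ·) (cross_dot_cross H X)
  simp only [reassoc_of% cross_cross, Preadditive.comp_sub, cross_cross] at h
  rw [h, sub_add_cancel]

theorem dot_cross (X : C) :
    d ▷ (P ⊗ X) ≫ T X = T X ≫ P ◁ (d ▷ X) + 𝟙 _ := by
  have h := congrArg (· ≫ T X) (cross_dot_cross H X)
  simp only [Category.assoc, cross_cross, Preadditive.sub_comp, Category.comp_id] at h
  rw [h, sub_add_cancel]

/-! ### Bubbles -/

/-- A clockwise circle slides through an upward strand. -/
theorem bubble_P (X : C) : η (P ⊗ X) ≫ ε₂ (P ⊗ X) = P ◁ (η X ≫ ε₂ X) + 𝟙 _ := by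
  have h : P ◁ (η X ≫ ε₂ X) = η (P ⊗ X) ≫ P ◁ (U X ≫ V X) ≫ ε₂ (P ⊗ X) := by
    rw [whiskerLeft_comp, whiskerLeft_comp, Category.assoc, crossPQ_cap, ← Category.assoc,
      cup_crossQP, Category.assoc, reassoc_of% cross_cross]
  rw [h, crossQP_crossPQ]
  simp [whiskerLeft_sub, zigzag_P', zigzag_P]

/-- A clockwise circle with a dot slides through an upward strand. One of the two corrections
results from the dot passing a crossing, the other from the double crossing. -/
theorem dottedBubble_P (X : C) : η (P ⊗ X) ≫ d ▷ (Q ⊗ (P ⊗ X)) ≫ ε₂ (P ⊗ X) =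
    P ◁ (η X ≫ d ▷ (Q ⊗ X) ≫ ε₂ X) + (2 : ℕ) • d ▷ X := by
  have h : P ◁ (η X ≫ d ▷ (Q ⊗ X) ≫ ε₂ X) =
      η (P ⊗ X) ≫ d ▷ (Q ⊗ (P ⊗ X)) ≫ P ◁ (U X ≫ V X) ≫ ε₂ (P ⊗ X) - d ▷ X := by
    have h₁ : P ◁ (d ▷ (Q ⊗ X)) = T (Q ⊗ X) ≫ d ▷ (P ⊗ (Q ⊗ X)) ≫ T (Q ⊗ X) - T (Q ⊗ X) := by
      rw [dot_cross, Preadditive.comp_add, reassoc_of% cross_cross, Category.comp_id,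
        add_sub_cancel_right]
    rw [whiskerLeft_comp, whiskerLeft_comp, whiskerLeft_comp, Category.assoc, crossPQ_cap, h₁,
      ← whisker_exchange_assoc, ← Category.assoc (η (P ⊗ X)), cup_crossQP, dotP_eq H X]
    simp
  rw [h, crossQP_crossPQ]
  simp only [whiskerLeft_sub, whiskerLeft_id, Preadditive.sub_comp, Preadditive.comp_sub,
    Category.id_comp, whiskerLeft_comp, Category.assoc, zigzag_P', Category.comp_id,
    ← whisker_exchange, reassoc_of% zigzag_P]
  abel

/-- A family of endomorphisms that slides through upward strands with the correction `e` slides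
through downward strands with minus the rotation of `e` as correction. -/
theorem slide_Q (c : ∀ X : C, X ⟶ X) (hc : ∀ {X Y : C} (f : X ⟶ Y), c X ≫ f = f ≫ c Y)
    (e : ∀ X : C, P ⊗ X ⟶ P ⊗ X) (h : ∀ X : C, c (P ⊗ X) = P ◁ c X + e X) (X : C) :
    c (Q ⊗ X) = Q ◁ c X - Q ◁ η X ≫ Q ◁ e (Q ⊗ X) ≫ ε (Q ⊗ X) := by
  have h₁ : e (Q ⊗ X) = c (P ⊗ (Q ⊗ X)) - P ◁ c (Q ⊗ X) := by rw [h, add_sub_cancel_left]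
  rw [h₁, whiskerLeft_sub, Preadditive.sub_comp, Preadditive.comp_sub, capTail_naturality,
    reassoc_of% zigzag_Q', ← whiskerLeft_comp_assoc, ← hc, whiskerLeft_comp_assoc, zigzag_Q',
    Category.comp_id, sub_sub_cancel]

/-! ### Dots on strands of opposite directions -/

theorem dotP_crossQP (X : C) : Q ◁ (d ▷ X) ≫ U X = U X ≫ d ▷ (Q ⊗ X) + ε X ≫ η X := by
  rw [crossQP_eq, ← whiskerLeft_comp_assoc, ← whisker_exchange, ← whiskerLeft_comp_assoc,
    Category.assoc, dot_cross]
  simp only [Preadditive.comp_add, Category.comp_id, MonoidalPreadditive.whiskerLeft_add,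
    whiskerLeft_comp, Preadditive.add_comp, Category.assoc, capTail_naturality]

theorem cup_dotQ (X : C) : η X ≫ P ◁ (dQ ▷ X) = η X ≫ d ▷ (Q ⊗ X) := by
  rw [dotQ_eq]
  simp only [whiskerLeft_comp]
  rw [← reassoc_of% cupTail_naturality, ← reassoc_of% cupTail_naturality, zigzag_P,
    Category.comp_id]

theorem dotQ_cap (X : C) : dQ ▷ (P ⊗ X) ≫ ε X = Q ◁ (d ▷ X) ≫ ε X := by
  rw [dotQ_eq, Category.assoc, Category.assoc, ← capTail_naturality, ← whiskerLeft_comp_assoc,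
    ← whiskerLeft_comp_assoc, Category.assoc, ← whisker_exchange, reassoc_of% zigzag_P]

theorem dotQ_crossQP (X : C) :
    dQ ▷ (P ⊗ X) ≫ U X = U X ≫ P ◁ (dQ ▷ X) + ε X ≫ η X := by
  have h : η (P ⊗ X) ≫ d ▷ (Q ⊗ (P ⊗ X)) ≫ P ◁ U X =
      P ◁ η X ≫ T (Q ⊗ X) ≫ P ◁ (P ◁ (dQ ▷ X)) + P ◁ η X := by
    rw [← whisker_exchange, ← Category.assoc, cup_crossQP, Category.assoc, cross_dot,
      Preadditive.comp_add, ← whiskerLeft_comp_assoc, ← cup_dotQ, whiskerLeft_comp_assoc,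
      tail_naturality, Category.comp_id]
  rw [dotQ_eq, Category.assoc, Category.assoc, ← capTail_naturality, ← whiskerLeft_comp_assoc,
    ← whiskerLeft_comp_assoc, Category.assoc, h, crossQP_eq]
  simp only [MonoidalPreadditive.whiskerLeft_add, whiskerLeft_comp, Preadditive.add_comp,
    Category.assoc, capTail_naturality]

theorem crossPQ_dotP_cap (X : C) : V X ≫ Q ◁ (d ▷ X) ≫ ε X = ε₂ X := by
  have h : Q ◁ (P ◁ ε₂ X) ≫ Q ◁ (d ▷ X) ≫ ε X =
      Q ◁ (d ▷ (P ⊗ (Q ⊗ X))) ≫ ε (P ⊗ (Q ⊗ X)) ≫ ε₂ X := by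
    rw [← whiskerLeft_comp_assoc, whisker_exchange, whiskerLeft_comp_assoc, capTail_naturality]
  rw [crossPQ_eq, Category.assoc, Category.assoc, h, ← whiskerLeft_comp_assoc, cross_dot]
  simp only [MonoidalPreadditive.whiskerLeft_add, whiskerLeft_comp, Preadditive.add_comp,
    Preadditive.comp_add, Category.assoc, whiskerLeft_id, Category.id_comp]
  rw [reassoc_of% circle, ← reassoc_of% cupTail_naturality, ← Category.assoc (Q ◁ _),
    ← Category.assoc (η₂ _), leftCurl]
  simp

/-- A counterclockwise circle with a dot contains a left curl. -/
theorem leftBubble_one (X : C) : η₂ X ≫ Q ◁ (d ▷ X) ≫ ε X = 0 := by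
  rw [dotP_eq]
  simp only [whiskerLeft_comp, Category.assoc]
  rw [capTail_naturality, ← reassoc_of% cupTail_naturality, ← Category.assoc (Q ◁ _),
    ← Category.assoc (η₂ _), leftCurl]
  simp

theorem id_eq_crossQP_crossPQ (X : C) : 𝟙 (Q ⊗ (P ⊗ X)) = U X ≫ V X + ε X ≫ η₂ X := by
  rw [crossQP_crossPQ, sub_add_cancel]

theorem crossPQ_dotP (X : C) : V X ≫ Q ◁ (d ▷ X) = d ▷ (Q ⊗ X) ≫ V X + ε₂ X ≫ η₂ X := by
  calc V X ≫ Q ◁ (d ▷ X) = V X ≫ Q ◁ (d ▷ X) ≫ (U X ≫ V X + ε X ≫ η₂ X) := by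
        rw [← id_eq_crossQP_crossPQ, Category.comp_id]
    _ = V X ≫ (Q ◁ (d ▷ X) ≫ U X) ≫ V X + (V X ≫ Q ◁ (d ▷ X) ≫ ε X) ≫ η₂ X := by simp
    _ = _ := by
        rw [dotP_crossQP, crossPQ_dotP_cap, Preadditive.add_comp, Preadditive.comp_add,
          Category.assoc, Category.assoc, reassoc_of% crossPQ_crossQP, reassoc_of% crossPQ_capQP]
        simp

/-- Resolving the identity of `Q P` removes a dot from a counterclockwise circle and turns the
circle into a clockwise one. -/
theorem leftBubble_step (X : C) {Y : C} (g : Q ⊗ (P ⊗ X) ⟶ Y) :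
    η₂ X ≫ Q ◁ (d ▷ X) ≫ g = η X ≫ V X ≫ g := by
  calc η₂ X ≫ Q ◁ (d ▷ X) ≫ g = η₂ X ≫ Q ◁ (d ▷ X) ≫ (U X ≫ V X + ε X ≫ η₂ X) ≫ g := by
        rw [← id_eq_crossQP_crossPQ, Category.id_comp]
    _ = η₂ X ≫ (Q ◁ (d ▷ X) ≫ U X) ≫ V X ≫ g + (η₂ X ≫ Q ◁ (d ▷ X) ≫ ε X) ≫ η₂ X ≫ g := by
        simp
    _ = _ := by
        rw [dotP_crossQP, leftBubble_one, Preadditive.add_comp, Preadditive.comp_add,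
          Category.assoc, Category.assoc, reassoc_of% cupQP_crossQP, reassoc_of% circle]
        simp

theorem crossPQ_dotP_dotP_cap (X : C) :
    V X ≫ Q ◁ (d ▷ X) ≫ Q ◁ (d ▷ X) ≫ ε X = d ▷ (Q ⊗ X) ≫ ε₂ X := by
  rw [← Category.assoc, crossPQ_dotP, Preadditive.add_comp, Category.assoc, Category.assoc,
    crossPQ_dotP_cap, leftBubble_one, Limits.comp_zero, add_zero]

theorem leftBubble_two (X : C) : η₂ X ≫ Q ◁ (d ▷ X) ≫ Q ◁ (d ▷ X) ≫ ε X = η X ≫ ε₂ X := by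
  rw [leftBubble_step, crossPQ_dotP_cap]

theorem leftBubble_three (X : C) :
    η₂ X ≫ Q ◁ (d ▷ X) ≫ Q ◁ (d ▷ X) ≫ Q ◁ (d ▷ X) ≫ ε X = η X ≫ d ▷ (Q ⊗ X) ≫ ε₂ X := by
  rw [leftBubble_step, crossPQ_dotP_dotP_cap]

theorem crossPQ_dotP_crossQP (X : C) : V X ≫ Q ◁ (d ▷ X) ≫ U X = d ▷ (Q ⊗ X) := by
  rw [dotP_crossQP, Preadditive.comp_add, reassoc_of% crossPQ_crossQP, reassoc_of% crossPQ_capQP,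
    Limits.zero_comp, add_zero]

theorem crossPQ_dotQ_crossQP (X : C) : V X ≫ dQ ▷ (P ⊗ X) ≫ U X = P ◁ (dQ ▷ X) := by
  rw [dotQ_crossQP, Preadditive.comp_add, reassoc_of% crossPQ_crossQP, reassoc_of% crossPQ_capQP,
    Limits.zero_comp, add_zero]

theorem crossPQ_dotQ_dotP_crossQP (X : C) :
    V X ≫ dQ ▷ (P ⊗ X) ≫ Q ◁ (d ▷ X) ≫ U X =
      P ◁ (dQ ▷ X) ≫ d ▷ (Q ⊗ X) + ε₂ X ≫ η X := by
  rw [dotP_crossQP, Preadditive.comp_add, Preadditive.comp_add, reassoc_of% crossPQ_dotQ_crossQP,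
    ← Category.assoc (dQ ▷ _) (ε X), dotQ_cap, Category.assoc, reassoc_of% crossPQ_dotP_cap]

theorem crossPQ_dotQ_dotP_dotP_crossQP (X : C) :
    V X ≫ dQ ▷ (P ⊗ X) ≫ Q ◁ (d ▷ X) ≫ Q ◁ (d ▷ X) ≫ U X =
      P ◁ (dQ ▷ X) ≫ d ▷ (Q ⊗ X) ≫ d ▷ (Q ⊗ X) + ε₂ X ≫ η X ≫ d ▷ (Q ⊗ X) +
        d ▷ (Q ⊗ X) ≫ ε₂ X ≫ η X := by
  have h : V X ≫ dQ ▷ (P ⊗ X) ≫ Q ◁ (d ▷ X) ≫ ε X = d ▷ (Q ⊗ X) ≫ ε₂ X := by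
    rw [← whisker_exchange_assoc, dotQ_cap, crossPQ_dotP_dotP_cap]
  calc _ = V X ≫ dQ ▷ (P ⊗ X) ≫ Q ◁ (d ▷ X) ≫ (U X ≫ d ▷ (Q ⊗ X) + ε X ≫ η X) := by
        rw [dotP_crossQP]
    _ = (V X ≫ dQ ▷ (P ⊗ X) ≫ Q ◁ (d ▷ X) ≫ U X) ≫ d ▷ (Q ⊗ X) +
        (V X ≫ dQ ▷ (P ⊗ X) ≫ Q ◁ (d ▷ X) ≫ ε X) ≫ η X := by simp
    _ = _ := by
        rw [h, crossPQ_dotQ_dotP_crossQP, Preadditive.add_comp]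
        simp only [Category.assoc]

/-! ### Downward strands -/

/-- Bending a downward strand up is injective. -/
theorem bend_injective {X Y : C} {f g : Q ⊗ X ⟶ Y} (h : η X ≫ P ◁ f = η X ≫ P ◁ g) : f = g := by
  have key (f : Q ⊗ X ⟶ Y) : f = Q ◁ (η X ≫ P ◁ f) ≫ ε Y := by
    rw [whiskerLeft_comp, Category.assoc, capTail_naturality, reassoc_of% zigzag_Q']
  rw [key f, h, ← key g]

/-- Two nested cups. -/
def cup₂ (X : C) : X ⟶ P ⊗ (P ⊗ (Q ⊗ (Q ⊗ X))) := η X ≫ P ◁ η (Q ⊗ X)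

/-- Three nested cups. -/
def cup₃ (X : C) : X ⟶ P ⊗ (P ⊗ (P ⊗ (Q ⊗ (Q ⊗ (Q ⊗ X))))) :=
  H.cup₂ X ≫ P ◁ (P ◁ η (Q ⊗ (Q ⊗ X)))

theorem cup₃_eq (X : C) : H.cup₃ X = η X ≫ P ◁ H.cup₂ (Q ⊗ X) := by
  simp [cup₃, cup₂]

theorem bend₂_injective {X Y : C} {f g : Q ⊗ (Q ⊗ X) ⟶ Y}
    (h : H.cup₂ X ≫ P ◁ (P ◁ f) = H.cup₂ X ≫ P ◁ (P ◁ g)) : f = g := by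
  refine H.bend_injective (H.bend_injective ?_)
  simpa [cup₂] using h

theorem bend₃_injective {X Y : C} {f g : Q ⊗ (Q ⊗ (Q ⊗ X)) ⟶ Y}
    (h : H.cup₃ X ≫ P ◁ (P ◁ (P ◁ f)) = H.cup₃ X ≫ P ◁ (P ◁ (P ◁ g))) : f = g := by
  refine H.bend_injective (H.bend₂_injective ?_)
  simpa [cup₃] using h

theorem cup₂_crossQQ (X : C) :
    H.cup₂ X ≫ P ◁ (P ◁ S X) = H.cup₂ X ≫ T (Q ⊗ (Q ⊗ X)) := by
  have h : η (Q ⊗ X) ≫ P ◁ S X = Q ◁ η X ≫ U (Q ⊗ X) := by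
    rw [crossQQ_eq]
    simp only [whiskerLeft_comp]
    rw [← reassoc_of% cupTail_naturality, ← reassoc_of% cupTail_naturality, zigzag_P,
      Category.comp_id]
  rw [cup₂, Category.assoc, ← whiskerLeft_comp, h, whiskerLeft_comp,
    ← reassoc_of% cupTail_naturality,
    cup_crossQP, Category.assoc]

theorem cup₂_dotQ (X : C) :
    H.cup₂ X ≫ P ◁ (P ◁ (dQ ▷ (Q ⊗ X))) = H.cup₂ X ≫ P ◁ (d ▷ (Q ⊗ (Q ⊗ X))) := by
  rw [cup₂, Category.assoc, ← whiskerLeft_comp, cup_dotQ, whiskerLeft_comp, Category.assoc]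

theorem cup₂_dotQ' (X : C) :
    H.cup₂ X ≫ P ◁ (P ◁ (Q ◁ (dQ ▷ X))) = H.cup₂ X ≫ d ▷ (P ⊗ (Q ⊗ (Q ⊗ X))) := by
  rw [cup₂, Category.assoc, ← whiskerLeft_comp, ← cupTail_naturality, whiskerLeft_comp,
    reassoc_of% cup_dotQ, ← whisker_exchange, Category.assoc]

theorem cup₃_crossQQ (X : C) :
    H.cup₃ X ≫ P ◁ (P ◁ (P ◁ S (Q ⊗ X))) = H.cup₃ X ≫ P ◁ T (Q ⊗ (Q ⊗ (Q ⊗ X))) := by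
  rw [cup₃_eq, Category.assoc, ← whiskerLeft_comp, cup₂_crossQQ, whiskerLeft_comp, Category.assoc]

theorem cup₃_crossQQ' (X : C) :
    H.cup₃ X ≫ P ◁ (P ◁ (P ◁ (Q ◁ S X))) = H.cup₃ X ≫ T (P ⊗ (Q ⊗ (Q ⊗ (Q ⊗ X)))) := by
  rw [cup₃, Category.assoc, ← whiskerLeft_comp, ← whiskerLeft_comp, ← cupTail_naturality,
    whiskerLeft_comp, whiskerLeft_comp, reassoc_of% cup₂_crossQQ, ← tail_naturality, Category.assoc]

theorem crossQQ_crossQQ (X : C) : S X ≫ S X = 𝟙 _ := by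
  apply H.bend₂_injective
  simp only [whiskerLeft_comp, whiskerLeft_id]
  rw [reassoc_of% cup₂_crossQQ, ← tail_naturality, reassoc_of% cup₂_crossQQ, cross_cross]

theorem braid_QQ (X : C) : S (Q ⊗ X) ≫ Q ◁ S X ≫ S (Q ⊗ X) = Q ◁ S X ≫ S (Q ⊗ X) ≫ Q ◁ S X := by
  have h {Y Z : C} (f : Y ⟶ Z) : P ◁ T Y ≫ P ◁ (P ◁ (P ◁ f)) = P ◁ (P ◁ (P ◁ f)) ≫ P ◁ T Z := by
    rw [← whiskerLeft_comp, ← tail_naturality, whiskerLeft_comp]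
  apply H.bend₃_injective
  simp only [whiskerLeft_comp]
  rw [reassoc_of% cup₃_crossQQ, reassoc_of% h, h, reassoc_of% cup₃_crossQQ',
    ← reassoc_of% tail_naturality,
    reassoc_of% cup₃_crossQQ, reassoc_of% cup₃_crossQQ', ← reassoc_of% tail_naturality,
    ← tail_naturality,
    reassoc_of% cup₃_crossQQ, reassoc_of% h, reassoc_of% cup₃_crossQQ']
  rw [braid]

/-- Compared with upward strands, the correction in sliding a dot through a crossing of downward
strands changes its sign, since a half turn interchanges the two strands. -/
theorem crossQQ_dot (X : C) :
    S X ≫ dQ ▷ (Q ⊗ X) = Q ◁ (dQ ▷ X) ≫ S X - 𝟙 _ := by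
  rw [eq_sub_iff_add_eq]
  apply H.bend₂_injective
  simp only [MonoidalPreadditive.whiskerLeft_add, whiskerLeft_comp, whiskerLeft_id,
    Preadditive.comp_add]
  rw [reassoc_of% cup₂_crossQQ, ← tail_naturality, reassoc_of% cup₂_dotQ, reassoc_of% cup₂_dotQ',
    ← whisker_exchange, reassoc_of% cup₂_crossQQ, cross_dot, Preadditive.comp_add]

end Data

end Calculus

/-! ### Parallel strands -/

section Strands

variable {C : Type u} [Category.{v} C] [MonoidalCategory C]

/-- `n` parallel strands to the left of an object `X`, bracketed to the right. -/
@[reducible]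
def act (A : C) : ℕ → C → C
  | 0, X => X
  | n + 1, X => A ⊗ act A n X

/-- A morphism to the right of `n` parallel strands. -/
def actMap (A : C) : ∀ (n : ℕ) {X Y : C} (_ : X ⟶ Y), act A n X ⟶ act A n Y
  | 0, _, _, f => f
  | n + 1, _, _, f => A ◁ actMap A n f

/-- The long cycle on `n` strands to the left of an object `X`. -/
def cycle {A : C} (t : A ⊗ A ⟶ A ⊗ A) : ∀ (n : ℕ) (X : C), act A n X ⟶ act A n X
  | 0, _ => 𝟙 _
  | 1, _ => 𝟙 _
  | n + 2, X => A ◁ cycle t (n + 1) X ≫ tail t (act A n X)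

/-- Bracketing `n` parallel strands to the right. -/
def strandsIso (A : C) : ∀ (n : ℕ) (X : C), strands A n ⊗ X ≅ act A n X
  | 0, X => λ_ X
  | n + 1, X => α_ A (strands A n) X ≪≫ whiskerLeftIso A (strandsIso A n X)

theorem whiskerLeft_strandsIso (A : C) (n : ℕ) {X Y : C} (f : X ⟶ Y) :
    strands A n ◁ f ≫ (strandsIso A n Y).hom = (strandsIso A n X).hom ≫ actMap A n f := by
  induction n with
  | zero => exact leftUnitor_naturality f
  | succ n ih =>
    change (A ⊗ strands A n) ◁ f ≫ (α_ A (strands A n) Y).hom ≫ A ◁ (strandsIso A n Y).hom =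
      ((α_ A (strands A n) X).hom ≫ A ◁ (strandsIso A n X).hom) ≫ A ◁ actMap A n f
    rw [associator_naturality_right_assoc, ← whiskerLeft_comp, ih, whiskerLeft_comp,
      Category.assoc]

theorem firstCrossing_strandsIso {A : C} (t : A ⊗ A ⟶ A ⊗ A) (n : ℕ) (X : C) :
    firstCrossing t n ▷ X ≫ (strandsIso A (n + 2) X).hom =
      (strandsIso A (n + 2) X).hom ≫ tail t (act A n X) := by
  change ((α_ A A (strands A n)).inv ≫ t ▷ strands A n ≫ (α_ A A (strands A n)).hom) ▷ X ≫
      (α_ A (A ⊗ strands A n) X).hom ≫ A ◁ ((α_ A (strands A n) X).hom ≫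
        A ◁ (strandsIso A n X).hom) =
    ((α_ A (A ⊗ strands A n) X).hom ≫ A ◁ ((α_ A (strands A n) X).hom ≫
        A ◁ (strandsIso A n X).hom)) ≫ tail t (act A n X)
  have h := tail_naturality t (strandsIso A n X).hom
  simp only [whiskerLeft_comp, Category.assoc]
  rw [h]
  simp only [tail]
  monoidal

theorem longCycle_strandsIso {A : C} (t : A ⊗ A ⟶ A ⊗ A) (n : ℕ) (X : C) :
    longCycle t n ▷ X ≫ (strandsIso A n X).hom = (strandsIso A n X).hom ≫ cycle t n X := by
  induction n with
  | zero => simp [longCycle, cycle]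
  | succ n ih =>
    cases n with
    | zero => simp [longCycle, cycle]
    | succ n =>
      have h : (A ◁ longCycle t (n + 1)) ▷ X ≫ (strandsIso A (n + 2) X).hom =
          (strandsIso A (n + 2) X).hom ≫ A ◁ cycle t (n + 1) X := by
        change (A ◁ longCycle t (n + 1)) ▷ X ≫ (α_ A (strands A (n + 1)) X).hom ≫
            A ◁ (strandsIso A (n + 1) X).hom =
          ((α_ A (strands A (n + 1)) X).hom ≫ A ◁ (strandsIso A (n + 1) X).hom) ≫
            A ◁ cycle t (n + 1) X
        rw [associator_naturality_middle_assoc, ← whiskerLeft_comp, ih, whiskerLeft_comp,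
          Category.assoc]
      refine (congrArg (· ≫ _) (comp_whiskerRight (A ◁ longCycle t (n + 1))
        (firstCrossing t n) X)).trans ((Category.assoc _ _ _).trans ?_)
      refine (congrArg _ (firstCrossing_strandsIso t n X)).trans ?_
      exact ((Category.assoc _ _ _).symm.trans (congrArg (· ≫ tail t _) h)).trans
        (Category.assoc _ _ _)

end Strands

/-- An object of a monoidal category together with a crossing, subject to the relations of the
symmetric groups, and a dot, subject to those of the degenerate affine Hecke algebras. The sign is
the coefficient of the correction in sliding a dot through a crossing: it is `1` for upward and
`-1` for downward strands. -/
structure Strand (C : Type u) [Category.{v} C] [MonoidalCategory C] [Preadditive C] where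
  /-- The strand. -/
  A : C
  /-- The crossing of two strands. -/
  cross : A ⊗ A ⟶ A ⊗ A
  /-- The dot. -/
  dot : A ⟶ A
  /-- The coefficient of the correction in sliding a dot through a crossing. -/
  sign : ℤ
  sign_mul_sign : sign * sign = 1
  cross_cross (X : C) : tail cross X ≫ tail cross X = 𝟙 (A ⊗ (A ⊗ X))
  braid (X : C) : tail cross (A ⊗ X) ≫ A ◁ tail cross X ≫ tail cross (A ⊗ X) =
    A ◁ tail cross X ≫ tail cross (A ⊗ X) ≫ A ◁ tail cross X
  cross_dot (X : C) : tail cross X ≫ dot ▷ (A ⊗ X) = A ◁ (dot ▷ X) ≫ tail cross X + sign • 𝟙 _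

namespace Data

variable {C : Type u} [Category.{v} C] [MonoidalCategory C] [Preadditive C] [MonoidalPreadditive C]

/-- Upward strands. -/
def up (H : Data C) : Strand C where
  A := H.P
  cross := H.cross
  dot := H.dotP
  sign := 1
  sign_mul_sign := rfl
  cross_cross := H.cross_cross
  braid := H.braid
  cross_dot X := by rw [one_smul]; exact H.cross_dot X

/-- Downward strands. -/
def down (H : Data C) : Strand C where
  A := H.Q
  cross := H.crossQQ
  dot := H.dotQ
  sign := -1
  sign_mul_sign := rfl
  cross_cross := H.crossQQ_crossQQ
  braid := H.braid_QQ
  cross_dot X := by rw [neg_smul, one_smul, ← sub_eq_add_neg]; exact H.crossQQ_dot X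

end Data

namespace Strand

variable {C : Type u} [Category.{v} C] [MonoidalCategory C] [Preadditive C] [MonoidalPreadditive C]
variable (s : Strand C)

local notation "A" => Strand.A s
local notation "T" => tail (Strand.cross s)
local notation "d" => Strand.dot s

/-- The leftmost strand passes through `n` others to the right. -/
def shift : ∀ (n : ℕ) (X : C), A ⊗ act A n X ⟶ act A n (A ⊗ X)
  | 0, _ => 𝟙 _
  | n + 1, X => T (act A n X) ≫ A ◁ shift n X

/-- The inverse of `shift`. -/
def shiftInv : ∀ (n : ℕ) (X : C), act A n (A ⊗ X) ⟶ A ⊗ act A n X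
  | 0, _ => 𝟙 _
  | n + 1, X => A ◁ shiftInv n X ≫ T (act A n X)

theorem shift_shiftInv (n : ℕ) (X : C) : s.shift n X ≫ s.shiftInv n X = 𝟙 _ := by
  induction n with
  | zero => exact Category.id_comp _
  | succ n ih =>
    simp only [shift, shiftInv, Category.assoc]
    rw [← whiskerLeft_comp_assoc, ih, whiskerLeft_id, Category.id_comp, cross_cross]

theorem shiftInv_shift (n : ℕ) (X : C) : s.shiftInv n X ≫ s.shift n X = 𝟙 _ := by
  induction n with
  | zero => exact Category.id_comp _
  | succ n ih =>
    simp only [shift, shiftInv, Category.assoc]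
    rw [reassoc_of% cross_cross, ← whiskerLeft_comp, ih, whiskerLeft_id]

/-- The transposition of the leftmost strand with the strand after the next `j` ones. -/
def swap : ∀ (n _ : ℕ) (X : C), A ⊗ act A n X ⟶ A ⊗ act A n X
  | 0, _, _ => 0
  | n + 1, 0, X => T (act A n X)
  | n + 1, j + 1, X => T (act A n X) ≫ A ◁ swap n j X ≫ T (act A n X)

/-- Sliding a strand through `n` others commutes with the long cycle on these: the strand slides
through their crossings by the braid relation. -/
theorem cycle_shift (n : ℕ) (X : C) :
    A ◁ cycle s.cross n X ≫ s.shift n X = s.shift n X ≫ cycle s.cross n (A ⊗ X) := by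
  induction n with
  | zero => simp [cycle, shift]
  | succ n ih =>
    cases n with
    | zero =>
      simp only [cycle]
      erw [whiskerLeft_id, Category.id_comp, Category.comp_id]
    | succ n =>
      calc A ◁ (A ◁ cycle s.cross (n + 1) X ≫ T (act A n X)) ≫ T (A ⊗ act A n X) ≫
            A ◁ (T (act A n X) ≫ A ◁ s.shift n X)
          = A ◁ (A ◁ cycle s.cross (n + 1) X) ≫ (A ◁ T (act A n X) ≫ T (A ⊗ act A n X) ≫
            A ◁ T (act A n X)) ≫ A ◁ (A ◁ s.shift n X) := by
            simp only [whiskerLeft_comp, Category.assoc]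
        _ = T (A ⊗ act A n X) ≫ A ◁ (A ◁ cycle s.cross (n + 1) X ≫ s.shift (n + 1) X) ≫
            T (act A n (A ⊗ X)) := by
            rw [← braid, ← Category.assoc (A ◁ (A ◁ cycle s.cross (n + 1) X)),
              ← Category.assoc (A ◁ (A ◁ cycle s.cross (n + 1) X))]
            erw [tail_naturality]
            simp only [Category.assoc]
            rw [← tail_naturality]
            simp only [shift, whiskerLeft_comp, Category.assoc]
        _ = _ := by
            rw [ih]
            simp only [shift, whiskerLeft_comp, Category.assoc, cycle]

/-- Conjugation by the long cycle on all strands but the leftmost permutes the transpositions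
that involve the leftmost strand. -/
theorem cycle_swap (n j : ℕ) (hj : j + 1 < n) (X : C) :
    A ◁ cycle s.cross n X ≫ s.swap n (j + 1) X = s.swap n j X ≫ A ◁ cycle s.cross n X := by
  induction n generalizing j with
  | zero => omega
  | succ n ih =>
    obtain ⟨k, rfl⟩ : ∃ k, n = k + 1 := ⟨n - 1, by omega⟩
    have h₁ : A ◁ cycle s.cross (k + 2) X =
        A ◁ (A ◁ cycle s.cross (k + 1) X) ≫ A ◁ T (act A k X) := by
      rw [cycle, whiskerLeft_comp]
    cases j with
    | zero =>
      change A ◁ cycle s.cross (k + 2) X ≫ T (A ⊗ act A k X) ≫ A ◁ T (act A k X) ≫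
        T (A ⊗ act A k X) = T (A ⊗ act A k X) ≫ A ◁ cycle s.cross (k + 2) X
      rw [h₁, Category.assoc, ← reassoc_of% braid, cross_cross, Category.comp_id,
        reassoc_of% tail_naturality]
    | succ i =>
      have h₂ : A ◁ s.swap (k + 1) i X ≫ A ◁ (A ◁ cycle s.cross (k + 1) X) =
          A ◁ (A ◁ cycle s.cross (k + 1) X) ≫ A ◁ s.swap (k + 1) (i + 1) X := by
        rw [← whiskerLeft_comp, ← ih i (by omega), whiskerLeft_comp]
      change A ◁ cycle s.cross (k + 2) X ≫ T (A ⊗ act A k X) ≫ A ◁ (T (act A k X) ≫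
          A ◁ s.swap k i X ≫ T (act A k X)) ≫ T (A ⊗ act A k X) =
        (T (A ⊗ act A k X) ≫ A ◁ s.swap (k + 1) i X ≫ T (A ⊗ act A k X)) ≫
          A ◁ cycle s.cross (k + 2) X
      have h₃ : T (A ⊗ act A k X) ≫ A ◁ (A ◁ cycle s.cross (k + 1) X) =
          A ◁ (A ◁ cycle s.cross (k + 1) X) ≫ T (A ⊗ act A k X) :=
        (tail_naturality _ _).symm
      have h₄ : T (A ⊗ act A k X) ≫ A ◁ (A ◁ s.swap k i X) =
          A ◁ (A ◁ s.swap k i X) ≫ T (A ⊗ act A k X) :=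
        (tail_naturality _ _).symm
      rw [h₁, Category.assoc, Category.assoc, Category.assoc, reassoc_of% h₃,
        reassoc_of% h₂, reassoc_of% h₃]
      congr 1
      simp only [swap, whiskerLeft_comp, Category.assoc]
      rw [← reassoc_of% braid, reassoc_of% h₄, ← braid]

theorem dot_cross_dot (X : C) :
    d ▷ (A ⊗ X) = T X ≫ A ◁ (d ▷ X) ≫ T X + s.sign • T X := by
  have h := congrArg (T X ≫ ·) (s.cross_dot X)
  simp only [reassoc_of% cross_cross, Preadditive.comp_add, Preadditive.comp_zsmul,
    Category.comp_id] at h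
  exact h

/-- The dot on the leftmost strand is carried through `n` others by `shift`. The correction is the
sum of the transpositions of the leftmost strand with the others (a Jucys–Murphy element). -/
theorem dot_eq_shift (n : ℕ) (X : C) :
    d ▷ act A n X = s.shift n X ≫ actMap A n (d ▷ X) ≫ s.shiftInv n X +
      s.sign • ∑ j ∈ Finset.range n, s.swap n j X := by
  induction n with
  | zero => simp [shift, shiftInv, actMap]
  | succ n ih =>
    change d ▷ (A ⊗ act A n X) = _
    rw [dot_cross_dot, ih, Finset.sum_range_succ', smul_add, ← add_assoc]
    simp only [MonoidalPreadditive.whiskerLeft_add, whiskerLeft_zsmul, whiskerLeft_sum,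
      Preadditive.comp_add, Preadditive.add_comp, Preadditive.comp_zsmul, Preadditive.zsmul_comp,
      Preadditive.comp_sum, Preadditive.sum_comp, whiskerLeft_comp, shift, shiftInv, actMap, swap,
      Category.assoc]

end Strand

/-! ### Commutators of classes of parallel strands -/

/-- The class of a diagram, as an additive map. -/
def clsHom (X : HeisObj) : (X ⟶ X) →+ TrH := AddMonoidHom.mk' cls cls_add

theorem cls_zsmul {X : HeisObj} (n : ℤ) (f : X ⟶ X) : cls (n • f) = n • cls f :=
  map_zsmul (clsHom X) n f

theorem cls_zero (X : HeisObj) : cls (0 : X ⟶ X) = 0 := map_zero (clsHom X)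

theorem cls_sum {X : HeisObj} {ι : Type*} (u : Finset ι) (f : ι → (X ⟶ X)) :
    cls (∑ i ∈ u, f i) = ∑ i ∈ u, cls (f i) := map_sum (clsHom X) f u

theorem cls_whiskerRight_unit {X : HeisObj} (f : X ⟶ X) : cls (f ▷ 𝟙_ HeisObj) = cls f :=
  cls_eq_of_iso (ρ_ X) (rightUnitor_naturality f)

theorem cls_tail_mul {A B Y : HeisObj} (f : A ⊗ B ⟶ A ⊗ B) (g : Y ⟶ Y) :
    cls f * cls g = cls (tail f Y ≫ A ◁ (B ◁ g)) := by
  rw [cls_mul]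
  refine cls_eq_of_iso (α_ A B Y) ?_
  rw [tail, Category.assoc, Category.assoc, Iso.hom_inv_id_assoc,
    MonoidalCategory.tensorHom_def, Category.assoc,
    associator_naturality_right]

theorem cls_tail {A B : HeisObj} (f : A ⊗ B ⟶ A ⊗ B) : cls (tail f (𝟙_ HeisObj)) = cls f := by
  rw [← mul_one (cls f), one_eq_cls, cls_tail_mul, whiskerLeft_id, whiskerLeft_id,
    Category.comp_id]

/-! ### Traces on degenerate affine Hecke algebras -/

section Hecke

variable {R M : Type*} [Ring R] [AddCommGroup M] (τ : R →+ M) (hτ : ∀ a b, τ (a * b) = τ (b * a))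

/-- The product of the dots commutes with the crossing. -/
theorem hecke_comm {s x y : R} {κ : ℤ} (hxs : x * s = s * y + (κ : R))
    (hsx : s * x = y * s + (κ : R)) (hxy : x * y = y * x) : s * (x * y) = x * y * s := by
  have hκ : (κ : R) * y = y * κ := (Int.cast_commute κ y).eq
  rw [← mul_assoc, hsx, add_mul, hκ, hxy, mul_assoc y x, hxs, mul_add, mul_assoc]

include hτ in
/-- In the algebra of two strands with crossing `s` and dots `x`, `y`, for a trace `τ`. Both
identities result from conjugating by `s`, that is from `x = s * y * s + κ • s`. -/
theorem hecke_two {s x y : R} {κ : ℤ} (hκ : κ * κ = 1) (hs : s * s = 1)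
    (hxs : x * s = s * y + (κ : R)) (hsx : s * x = y * s + (κ : R)) (hxy : x * y = y * x) :
    τ (x * (x * y)) - τ (x * (y * y)) = κ • τ (s * (x * y)) ∧
      τ (x * (x * x)) - τ (y * (y * y)) =
        (3 : ℤ) • (τ (x * (x * y)) - τ (x * (y * y))) + (τ x - τ y) := by
  have hc := hecke_comm hxs hsx hxy
  have hx : x = s * y * s + κ • s := by
    rw [zsmul_eq_mul, ← add_mul, ← hxs, mul_assoc, hs, mul_one]
  have h₁ : τ (x * (x * y)) - τ (x * (y * y)) = κ • τ (s * (x * y)) := by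
    have h₂ : τ (s * y * s * (x * y)) = τ (x * (y * y)) := by
      rw [mul_assoc, hc, hτ, mul_assoc, mul_assoc, ← mul_assoc s s, hs, one_mul, ← mul_assoc x y,
        hxy, mul_assoc]
    nth_rw 1 [hx]
    rw [add_mul, map_add, smul_mul_assoc, map_zsmul, h₂, add_sub_cancel_left]
  refine ⟨h₁, ?_⟩
  have h₂ : τ (x * s * y) = τ (s * (x * y)) := by
    rw [hτ, hτ s, ← mul_assoc, hxy]
  have h₃ : τ (y * s * y) = τ (s * (x * y)) - κ • τ y := by
    have h : s * y = x * s - (κ : R) := by rw [hxs, add_sub_cancel_right]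
    rw [mul_assoc, h, mul_sub, map_sub, ← (Int.cast_commute κ y).eq, ← zsmul_eq_mul, map_zsmul,
      ← mul_assoc, ← hxy, hc]
  have h₄ : τ (x * x * s) = τ (s * (x * y)) + κ • τ x := by
    rw [mul_assoc, hxs, mul_add, map_add, ← (Int.cast_commute κ x).eq, ← zsmul_eq_mul, map_zsmul,
      ← mul_assoc, h₂]
  have h₅ : s * (x * x) = y * y * s + κ • x + κ • y := by
    rw [← mul_assoc, hsx, add_mul, mul_assoc, hsx, mul_add, zsmul_eq_mul, zsmul_eq_mul,
      (Int.cast_commute κ y).eq, mul_assoc]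
    abel
  have h₆ : τ (x * x * (s * y * s)) = τ (y * (y * y)) + κ • τ (x * s * y) + κ • τ (y * s * y) := by
    have h : s * (x * x * (s * y)) = y * (y * y) + κ • (x * s * y) + κ • (y * s * y) := by
      rw [← mul_assoc, h₅]
      simp only [add_mul, smul_mul_assoc, mul_assoc]
      rw [← mul_assoc s s, hs, one_mul]
    rw [← mul_assoc, hτ, h, map_add, map_add, map_zsmul, map_zsmul]
  have h₇ : τ (x * (x * x)) =
      τ (x * x * (s * y * s)) + κ • τ (x * x * s) := by
    rw [← map_zsmul, ← map_add, ← mul_smul_comm, ← mul_add, ← hx, mul_assoc]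
  have h₈ (m : M) : κ • κ • m = m := by rw [smul_smul, hκ, one_smul]
  rw [h₇, h₆, h₁, h₂, h₃, h₄, smul_add, smul_sub, h₈, h₈]
  abel

include hτ in
/-- In the algebra of three strands with crossings `s`, `t` and dots `x`, `y`, `z`: the product of
the three dots commutes with `s` and `t`, and these are conjugate under `s * t`. -/
theorem hecke_three {s t x y z : R} {κ : ℤ} (hs : s * s = 1) (ht : t * t = 1)
    (hst : s * (t * s) = t * (s * t))
    (hxs : x * s = s * y + (κ : R)) (hsx : s * x = y * s + (κ : R)) (hsz : s * z = z * s)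
    (hyt : y * t = t * z + (κ : R)) (hty : t * y = z * t + (κ : R)) (htx : t * x = x * t)
    (hxy : x * y = y * x) (hyz : y * z = z * y) :
    τ (t * (x * (y * z))) = τ (s * (x * (y * z))) := by
  have h₁ : s * (x * (y * z)) = x * (y * z) * s := by
    rw [← mul_assoc x, ← mul_assoc s, hecke_comm hxs hsx hxy, mul_assoc, hsz]
    simp only [mul_assoc]
  have h₂ : t * (x * (y * z)) = x * (y * z) * t := by
    rw [← mul_assoc t, htx, mul_assoc, hecke_comm hyt hty hyz]
    simp only [mul_assoc]
  have h₃ : t = s * t * (s * t * s) := by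
    rw [mul_assoc s t s, hst, mul_assoc, ← mul_assoc t t, ht, one_mul, ← mul_assoc, hs, one_mul]
  generalize x * (y * z) = w at *
  rw [h₃, mul_assoc, hτ, mul_assoc, ← mul_assoc w, ← h₁, mul_assoc s w, ← h₂]
  simp only [mul_assoc]
  rw [← mul_assoc s s, hs, one_mul, ← mul_assoc t t, ht, one_mul]

end Hecke

namespace Strand

variable (s : Strand HeisObj)

local notation "A" => Strand.A s
local notation "T" => tail (Strand.cross s)
local notation "d" => Strand.dot s
local notation "𝟏" => 𝟙_ HeisObj

/-- A strand with `a` dots. -/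
def dotPow : ℕ → (A ⟶ A)
  | 0 => 𝟙 _
  | a + 1 => dotPow a ≫ d

/-- The class of a strand with `a` dots. -/
def dotCls (a : ℕ) : TrH := cls (s.dotPow a)

/-- The class of the long cycle on `n` strands. -/
def cycCls (n : ℕ) : TrH := cls (longCycle s.cross n)

theorem cls_longCycle_mul (n : ℕ) {X : HeisObj} (f : X ⟶ X) :
    s.cycCls n * cls f = cls (cycle s.cross n X ≫ actMap A n f) := by
  rw [cycCls, cls_mul]
  refine cls_eq_of_iso (strandsIso A n X) ?_
  rw [MonoidalCategory.tensorHom_def, Category.assoc, whiskerLeft_strandsIso, ← Category.assoc,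
    longCycle_strandsIso, Category.assoc]

theorem actMap_id (n : ℕ) (X : HeisObj) : actMap A n (𝟙 X) = 𝟙 (act A n X) := by
  induction n with
  | zero => rfl
  | succ n ih => rw [actMap, ih, whiskerLeft_id]

theorem cycCls_eq (n : ℕ) : s.cycCls n = cls (cycle s.cross n 𝟏) := by
  rw [← mul_one (s.cycCls n), one_eq_cls, cls_longCycle_mul, actMap_id, Category.comp_id]

theorem cls_mul_cycCls (f : A ⟶ A) (n : ℕ) :
    cls f * s.cycCls n = cls (A ◁ cycle s.cross n 𝟏 ≫ f ▷ act A n 𝟏) := by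
  rw [cycCls_eq, cls_mul, tensorHom_def']

/-- Sliding the strand from the left of the long cycle to its right is a conjugation. -/
theorem dotCls_zero_mul_cycCls (n : ℕ) : s.dotCls 0 * s.cycCls n = s.cycCls n * s.dotCls 0 := by
  have h := s.cycle_shift n 𝟏
  rw [dotCls, dotPow, cls_mul_cycCls, ← cls_whiskerRight_unit (𝟙 A), cls_longCycle_mul]
  simp only [id_whiskerRight, actMap_id, Category.comp_id]
  refine cls_eq_of_iso ⟨s.shift n 𝟏, s.shiftInv n 𝟏, s.shift_shiftInv n 𝟏,
    s.shiftInv_shift n 𝟏⟩ h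

/-- The transposition of the strand on the left of a long cycle with any strand of the cycle merges
the two. All these classes agree by conjugation with the long cycle, and one of them is a long cycle
by definition. -/
theorem cls_cycle_swap (n j : ℕ) (hj : j < n) :
    cls (A ◁ cycle s.cross n 𝟏 ≫ s.swap n j 𝟏) = s.cycCls (n + 1) := by
  induction j with
  | zero =>
    obtain ⟨k, rfl⟩ : ∃ k, n = k + 1 := ⟨n - 1, by omega⟩
    rw [cycCls_eq]
    rfl
  | succ j ih => rw [cycle_swap _ _ _ hj, cls_comp_comm, ih (by omega)]

/-- The dot slides with its strand, and each of the `n` transpositions in the correction contributes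
a long cycle on `n + 1` strands. -/
theorem dotCls_one_mul_cycCls (n : ℕ) : s.dotCls 1 * s.cycCls n =
    s.cycCls n * s.dotCls 1 + ((n : ℤ) * s.sign) • s.cycCls (n + 1) := by
  have h : cls (A ◁ cycle s.cross n 𝟏 ≫ s.shift n 𝟏 ≫ actMap A n (d ▷ 𝟏) ≫ s.shiftInv n 𝟏) =
      cls (cycle s.cross n (A ⊗ 𝟏) ≫ actMap A n (d ▷ 𝟏)) := by
    rw [reassoc_of% cycle_shift, cls_comp_comm, Category.assoc, Category.assoc, shiftInv_shift,
      Category.comp_id]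
  rw [dotCls, dotPow, dotPow, Category.id_comp, cls_mul_cycCls, ← cls_whiskerRight_unit d,
    cls_longCycle_mul, dot_eq_shift, Preadditive.comp_add, cls_add, h, Preadditive.comp_zsmul,
    Preadditive.comp_sum, cls_zsmul, cls_sum,
    Finset.sum_congr rfl fun j hj => s.cls_cycle_swap n j (Finset.mem_range.1 hj),
    Finset.sum_const, Finset.card_range, ← natCast_zsmul, smul_smul, mul_comm s.sign]

theorem cycCls_one : s.cycCls 1 = s.dotCls 0 := by
  rw [cycCls_eq, dotCls, dotPow, ← cls_whiskerRight_unit (𝟙 A), id_whiskerRight]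
  rfl

theorem dotCls_mul_dotCls (a b : ℕ) : s.dotCls a * s.dotCls b =
    cls (s.dotPow a ▷ (A ⊗ 𝟏) ≫ A ◁ (s.dotPow b ▷ 𝟏)) := by
  rw [dotCls, dotCls, ← cls_whiskerRight_unit (s.dotPow b), cls_mul, MonoidalCategory.tensorHom_def]

theorem dot_cross (X : HeisObj) : d ▷ (A ⊗ X) ≫ T X = T X ≫ A ◁ (d ▷ X) + s.sign • 𝟙 _ := by
  rw [dot_cross_dot, Preadditive.add_comp, Category.assoc, Category.assoc, cross_cross,
    Category.comp_id, Preadditive.zsmul_comp, cross_cross]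

theorem zsmul_id_eq (X : HeisObj) (n : ℤ) : (n • 𝟙 X : X ⟶ X) = ((n : End X) : X ⟶ X) :=
  zsmul_one (R := End X) n

/-- The class of two crossing strands with a dot on each. -/
def dottedCrossCls : TrH := cls (s.cross ≫ d ▷ A ≫ A ◁ d)

theorem tail_dottedCross (X : HeisObj) :
    tail (s.cross ≫ d ▷ A ≫ A ◁ d) X = T X ≫ d ▷ (A ⊗ X) ≫ A ◁ (d ▷ X) := by
  simp [tail]

theorem dotCls_relations :
    s.dotCls 2 * s.dotCls 1 - s.dotCls 1 * s.dotCls 2 = s.sign • s.dottedCrossCls ∧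
      s.dotCls 3 * s.dotCls 0 - s.dotCls 0 * s.dotCls 3 =
        (3 : ℤ) • (s.dotCls 2 * s.dotCls 1 - s.dotCls 1 * s.dotCls 2) +
          (s.dotCls 1 * s.dotCls 0 - s.dotCls 0 * s.dotCls 1) := by
  obtain ⟨h₁, h₂⟩ := hecke_two (R := End (A ⊗ (A ⊗ 𝟏))) (clsHom _)
    (fun a b => cls_comp_comm _ _) (s := T 𝟏) (x := d ▷ (A ⊗ 𝟏)) (y := A ◁ (d ▷ 𝟏))
    s.sign_mul_sign (s.cross_cross 𝟏) ((s.cross_dot 𝟏).trans (congrArg _ (zsmul_id_eq _ _)))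
    ((s.dot_cross 𝟏).trans (congrArg _ (zsmul_id_eq _ _))) (whisker_exchange _ _)
  have e₁ : s.dotCls 2 * s.dotCls 1 = cls ((A ◁ (d ▷ 𝟏) ≫ d ▷ (A ⊗ 𝟏)) ≫ d ▷ (A ⊗ 𝟏)) := by
    rw [dotCls_mul_dotCls, Category.assoc, cls_comp_comm]
    simp [dotPow]
  have e₂ : s.dotCls 1 * s.dotCls 2 = cls ((A ◁ (d ▷ 𝟏) ≫ A ◁ (d ▷ 𝟏)) ≫ d ▷ (A ⊗ 𝟏)) := by
    rw [dotCls_mul_dotCls, cls_comp_comm]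
    simp [dotPow]
  have e₃ : s.dottedCrossCls = cls ((A ◁ (d ▷ 𝟏) ≫ d ▷ (A ⊗ 𝟏)) ≫ T 𝟏) := by
    rw [dottedCrossCls, ← cls_tail, tail_dottedCross, cls_comp_comm, whisker_exchange]
  have e₄ : s.dotCls 3 * s.dotCls 0 =
      cls ((d ▷ (A ⊗ 𝟏) ≫ d ▷ (A ⊗ 𝟏)) ≫ d ▷ (A ⊗ 𝟏)) := by
    rw [dotCls_mul_dotCls]
    simp [dotPow]
  have e₅ : s.dotCls 0 * s.dotCls 3 =
      cls ((A ◁ (d ▷ 𝟏) ≫ A ◁ (d ▷ 𝟏)) ≫ A ◁ (d ▷ 𝟏)) := by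
    rw [dotCls_mul_dotCls]
    simp [dotPow]
  have e₆ : s.dotCls 1 * s.dotCls 0 = cls (d ▷ (A ⊗ 𝟏)) := by
    rw [dotCls_mul_dotCls]
    simp [dotPow]
  have e₇ : s.dotCls 0 * s.dotCls 1 = cls (A ◁ (d ▷ 𝟏)) := by
    rw [dotCls_mul_dotCls]
    simp [dotPow]
  rw [e₁, e₂, e₃, e₄, e₅, e₆, e₇]
  exact ⟨h₁, h₂⟩

theorem dotCls_one_mul_dottedCrossCls :
    s.dotCls 1 * s.dottedCrossCls = s.dottedCrossCls * s.dotCls 1 := by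
  have hx : A ◁ T 𝟏 ≫ A ◁ (d ▷ (A ⊗ 𝟏)) = A ◁ (A ◁ (d ▷ 𝟏)) ≫ A ◁ T 𝟏 + s.sign • 𝟙 _ := by
    rw [← whiskerLeft_comp, s.cross_dot, MonoidalPreadditive.whiskerLeft_add,
      whiskerLeft_zsmul, whiskerLeft_id, whiskerLeft_comp]
  have hx' : A ◁ (d ▷ (A ⊗ 𝟏)) ≫ A ◁ T 𝟏 = A ◁ T 𝟏 ≫ A ◁ (A ◁ (d ▷ 𝟏)) + s.sign • 𝟙 _ := by
    rw [← whiskerLeft_comp, s.dot_cross, MonoidalPreadditive.whiskerLeft_add,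
      whiskerLeft_zsmul, whiskerLeft_id, whiskerLeft_comp]
  have h₁ : s.dotCls 1 * s.dottedCrossCls =
      cls (A ◁ (T 𝟏 ≫ d ▷ (A ⊗ 𝟏) ≫ A ◁ (d ▷ 𝟏)) ≫ d ▷ (A ⊗ (A ⊗ 𝟏))) := by
    rw [dotCls, dotPow, dotPow, Category.id_comp, dottedCrossCls, ← cls_tail, tail_dottedCross,
      cls_mul, tensorHom_def']
  have h₂ : s.dottedCrossCls * s.dotCls 1 = cls ((T (A ⊗ 𝟏) ≫ d ▷ (A ⊗ (A ⊗ 𝟏)) ≫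
      A ◁ (d ▷ (A ⊗ 𝟏))) ≫ A ◁ (A ◁ (d ▷ 𝟏))) := by
    rw [dotCls, dotPow, dotPow, Category.id_comp, dottedCrossCls, ← cls_whiskerRight_unit d,
      cls_tail_mul, tail_dottedCross]
  have h := hecke_three (R := End (A ⊗ (A ⊗ (A ⊗ 𝟏)))) (clsHom _)
    (fun a b => cls_comp_comm _ _) (s := T (A ⊗ 𝟏)) (t := A ◁ T 𝟏) (x := d ▷ (A ⊗ (A ⊗ 𝟏)))
    (y := A ◁ (d ▷ (A ⊗ 𝟏))) (z := A ◁ (A ◁ (d ▷ 𝟏))) (κ := s.sign)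
    (s.cross_cross _) (by
      change A ◁ T 𝟏 ≫ A ◁ T 𝟏 = 𝟙 _
      rw [← whiskerLeft_comp, s.cross_cross, whiskerLeft_id])
    (by
      change (T (A ⊗ 𝟏) ≫ A ◁ T 𝟏) ≫ T (A ⊗ 𝟏) = (A ◁ T 𝟏 ≫ T (A ⊗ 𝟏)) ≫ A ◁ T 𝟏
      rw [Category.assoc, s.braid, Category.assoc])
    ((s.cross_dot _).trans (congrArg _ (zsmul_id_eq _ _)))
    ((s.dot_cross _).trans (congrArg _ (zsmul_id_eq _ _)))
    (tail_naturality _ _)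
    (hx.trans (congrArg _ (zsmul_id_eq _ _))) (hx'.trans (congrArg _ (zsmul_id_eq _ _)))
    (whisker_exchange _ _).symm (whisker_exchange _ _)
    (by
      change A ◁ (A ◁ (d ▷ 𝟏)) ≫ A ◁ (d ▷ (A ⊗ 𝟏)) = A ◁ (d ▷ (A ⊗ 𝟏)) ≫ A ◁ (A ◁ (d ▷ 𝟏))
      rw [← whiskerLeft_comp, whisker_exchange, whiskerLeft_comp])
  have e₁ : cls (A ◁ (T 𝟏 ≫ d ▷ (A ⊗ 𝟏) ≫ A ◁ (d ▷ 𝟏)) ≫ d ▷ (A ⊗ (A ⊗ 𝟏))) =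
      cls (((A ◁ (A ◁ (d ▷ 𝟏)) ≫ A ◁ (d ▷ (A ⊗ 𝟏))) ≫ d ▷ (A ⊗ (A ⊗ 𝟏))) ≫ A ◁ T 𝟏) := by
    rw [whiskerLeft_comp, Category.assoc, cls_comp_comm, ← whisker_exchange, whiskerLeft_comp]
  have e₂ : cls ((T (A ⊗ 𝟏) ≫ d ▷ (A ⊗ (A ⊗ 𝟏)) ≫ A ◁ (d ▷ (A ⊗ 𝟏))) ≫
        A ◁ (A ◁ (d ▷ 𝟏))) =
      cls (((A ◁ (A ◁ (d ▷ 𝟏)) ≫ A ◁ (d ▷ (A ⊗ 𝟏))) ≫ d ▷ (A ⊗ (A ⊗ 𝟏))) ≫ T (A ⊗ 𝟏)) := by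
    rw [Category.assoc, Category.assoc, cls_comp_comm, ← whiskerLeft_comp, ← whisker_exchange,
      ← whisker_exchange, whiskerLeft_comp]
  rw [h₁, h₂, e₁, e₂]
  exact h

end Strand

/-! ### Commutators with bubbles -/

section Scalars

variable {C : Type u} [Category.{v} C] [MonoidalCategory C]

/-- A closed diagram to the left of an object. -/
def scalLeft (c : 𝟙_ C ⟶ 𝟙_ C) (X : C) : X ⟶ X := (λ_ X).inv ≫ c ▷ X ≫ (λ_ X).hom

/-- A closed diagram to the right of an object. -/
def scalRight (c : 𝟙_ C ⟶ 𝟙_ C) (X : C) : X ⟶ X := (ρ_ X).inv ≫ X ◁ c ≫ (ρ_ X).hom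

theorem scalLeft_naturality (c : 𝟙_ C ⟶ 𝟙_ C) {X Y : C} (f : X ⟶ Y) :
    scalLeft c X ≫ f = f ≫ scalLeft c Y := by
  rw [scalLeft, scalLeft, Category.assoc, Category.assoc, ← leftUnitor_naturality,
    ← whisker_exchange_assoc, leftUnitor_inv_naturality_assoc]

theorem scalRight_tensor (c : 𝟙_ C ⟶ 𝟙_ C) (A X : C) :
    scalRight c (A ⊗ X) = A ◁ scalRight c X := by
  simp only [scalRight]
  monoidal

theorem scalLeft_unit (c : 𝟙_ C ⟶ 𝟙_ C) : scalLeft c (𝟙_ C) = c := by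
  rw [scalLeft, unitors_equal, unitors_inv_equal, rightUnitor_naturality, Iso.inv_hom_id_assoc]

theorem scalRight_unit (c : 𝟙_ C ⟶ 𝟙_ C) : scalRight c (𝟙_ C) = c := by
  rw [scalRight, ← unitors_equal, ← unitors_inv_equal, leftUnitor_naturality,
    Iso.inv_hom_id_assoc]

/-- The sum of the diagrams with one `e` on `n` parallel strands. -/
def strandSum [Preadditive C] {A : C} (e : A ⟶ A) : ∀ n : ℕ, strands A n ⟶ strands A n
  | 0 => 0
  | n + 1 => e ▷ strands A n + A ◁ strandSum e n

variable [Preadditive C] [MonoidalPreadditive C]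

/-- If a closed diagram slides through one strand with the correction `e`, it slides through
parallel strands with the sum of the corrections of the strands. -/
theorem scalLeft_strands {A : C} {c : 𝟙_ C ⟶ 𝟙_ C} {e : A ⟶ A}
    (h : ∀ X : C, scalLeft c (A ⊗ X) = A ◁ scalLeft c X + e ▷ X) (n : ℕ) :
    scalLeft c (strands A n) = scalRight c (strands A n) + strandSum e n := by
  induction n with
  | zero =>
    change scalLeft c (𝟙_ C) = scalRight c (𝟙_ C) + 0
    rw [scalLeft_unit, scalRight_unit, add_zero]
  | succ n ih =>
    change scalLeft c (A ⊗ strands A n) = scalRight c (A ⊗ strands A n) +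
      (e ▷ strands A n + A ◁ strandSum e n)
    rw [h, scalRight_tensor, ih, MonoidalPreadditive.whiskerLeft_add]
    abel

theorem zsmul_whiskerRight {X Y : C} (n : ℤ) (f : X ⟶ Y) (Z : C) : (n • f) ▷ Z = n • f ▷ Z :=
  (tensorRight Z).map_zsmul

theorem strandSum_zsmul {A : C} (e : A ⟶ A) (m : ℤ) (n : ℕ) :
    strandSum (m • e) n = m • strandSum e n := by
  induction n with
  | zero => exact (smul_zero _).symm
  | succ n ih =>
    change (m • e) ▷ strands A n + A ◁ strandSum (m • e) n = m • (e ▷ _ + A ◁ _)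
    rw [ih, whiskerLeft_zsmul, zsmul_whiskerRight]
    exact (smul_add m _ _).symm

theorem strandSum_id (A : C) (n : ℕ) : strandSum (𝟙 A) n = n • 𝟙 (strands A n) := by
  induction n with
  | zero => exact (zero_smul _ _).symm
  | succ n ih =>
    change 𝟙 A ▷ strands A n + A ◁ strandSum (𝟙 A) n = (n + 1) • 𝟙 (A ⊗ strands A n)
    rw [ih, add_smul, one_smul, ← natCast_zsmul, ← natCast_zsmul, whiskerLeft_zsmul,
      whiskerLeft_id, id_whiskerRight, add_comm]

theorem dots_zero {A : C} (e : A ⟶ A) (n : ℕ) : dots e n (fun _ => 0) = 𝟙 (strands A n) := by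
  induction n with
  | zero => rfl
  | succ n ih =>
    rw [dots, ih, pow_zero]
    exact id_tensorHom_id _ _

theorem sum_dots {A : C} (e : A ⟶ A) (n : ℕ) :
    ∑ i : Fin n, dots e n (Pi.single i 1) = strandSum e n := by
  induction n with
  | zero => rfl
  | succ n ih =>
    have h₀ : dots e (n + 1) (Pi.single 0 1) = e ▷ strands A n := by
      have h : (fun i : Fin n => (Pi.single 0 1 : Fin (n + 1) → ℕ) i.succ) = fun _ => 0 := by
        funext i
        simp
      rw [dots, h, dots_zero, Pi.single_eq_same, pow_one]
      exact tensorHom_id _ _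
    have h₁ (i : Fin n) :
        dots e (n + 1) (Pi.single i.succ 1) = A ◁ dots e n (Pi.single i 1) := by
      have h : (fun k : Fin n => (Pi.single i.succ 1 : Fin (n + 1) → ℕ) k.succ) =
          Pi.single i 1 := by
        funext k
        simp [Pi.single_apply]
      rw [dots, h, Pi.single_eq_of_ne (Fin.succ_ne_zero i).symm, pow_zero]
      exact id_tensorHom _ _
    rw [Fin.sum_univ_succ, h₀, Finset.sum_congr rfl fun i _ => h₁ i]
    refine congrArg (e ▷ strands A n + ·) ?_
    exact (whiskerLeft_sum _ _ _).symm.trans (congrArg (A ◁ ·) ih)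

end Scalars

theorem cls_scal_mul (c : 𝟙_ HeisObj ⟶ 𝟙_ HeisObj) {X : HeisObj} (f : X ⟶ X) :
    cls c * cls f = cls (scalLeft c X ≫ f) := by
  rw [cls_mul]
  refine cls_eq_of_iso (λ_ X) ?_
  rw [MonoidalCategory.tensorHom_def, Category.assoc, leftUnitor_naturality, scalLeft]
  simp

theorem cls_mul_scal (c : 𝟙_ HeisObj ⟶ 𝟙_ HeisObj) {X : HeisObj} (f : X ⟶ X) :
    cls f * cls c = cls (f ≫ scalRight c X) := by
  rw [cls_mul]
  refine cls_eq_of_iso (ρ_ X) ?_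
  rw [MonoidalCategory.tensorHom_def, Category.assoc, scalRight,
    ← rightUnitor_naturality_assoc, Iso.hom_inv_id_assoc]

theorem cls_scal_comm (c c' : 𝟙_ HeisObj ⟶ 𝟙_ HeisObj) : cls c * cls c' = cls c' * cls c := by
  rw [cls_scal_mul, cls_mul_scal, scalLeft_unit, scalRight_unit, cls_comp_comm]

theorem cls_scal_mul_strands {A : HeisObj} {c : 𝟙_ HeisObj ⟶ 𝟙_ HeisObj} {e : A ⟶ A}
    (h : ∀ X : HeisObj, scalLeft c (A ⊗ X) = A ◁ scalLeft c X + e ▷ X) (n : ℕ)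
    (f : strands A n ⟶ strands A n) :
    cls c * cls f = cls f * cls c + cls (f ≫ strandSum e n) := by
  rw [cls_scal_mul, cls_mul_scal, ← cls_add, ← Preadditive.comp_add, ← scalLeft_strands h,
    scalLeft_naturality]

theorem cls_scal_mul_strand {A : HeisObj} {c : 𝟙_ HeisObj ⟶ 𝟙_ HeisObj} {e : A ⟶ A}
    (h : ∀ X : HeisObj, scalLeft c (A ⊗ X) = A ◁ scalLeft c X + e ▷ X) (f : A ⟶ A) :
    cls c * cls f = cls f * cls c + cls (f ≫ e) := by
  have h₁ := cls_scal_mul_strands h 1 (f ▷ 𝟙_ HeisObj)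
  have h₂ : strandSum e 1 = e ▷ 𝟙_ HeisObj := by
    change e ▷ 𝟙_ HeisObj + A ◁ (0 : 𝟙_ HeisObj ⟶ 𝟙_ HeisObj) = _
    rw [MonoidalPreadditive.whiskerLeft_zero, add_zero]
  rw [h₂] at h₁
  have h₃ : cls (f ▷ 𝟙_ HeisObj ≫ e ▷ 𝟙_ HeisObj) = cls (f ≫ e) := by
    rw [← comp_whiskerRight, cls_whiskerRight_unit]
  rw [← h₃, ← cls_whiskerRight_unit f]
  exact h₁

/-- The clockwise circle. -/
def circle₀ : 𝟙_ HeisObj ⟶ 𝟙_ HeisObj := diagrams.cupPQ ≫ diagrams.capPQ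

/-- The clockwise circle with a dot. -/
def circle₁ : 𝟙_ HeisObj ⟶ 𝟙_ HeisObj :=
  diagrams.cupPQ ≫ diagrams.dotP ▷ diagrams.Q ≫ diagrams.capPQ

theorem scalLeft_circle₀ (X : HeisObj) :
    scalLeft circle₀ X = cupTail diagrams.cupPQ X ≫ capTail diagrams.capPQ X :=
  (cupTail_capTail _ _ _).symm

theorem scalLeft_circle₁ (X : HeisObj) : scalLeft circle₁ X =
    cupTail diagrams.cupPQ X ≫ diagrams.dotP ▷ (diagrams.Q ⊗ X) ≫ capTail diagrams.capPQ X := by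
  simp [scalLeft, circle₁, cupTail, capTail]

theorem circle₀_up (X : HeisObj) : scalLeft circle₀ (diagrams.up.A ⊗ X) =
    diagrams.up.A ◁ scalLeft circle₀ X + (diagrams.up.sign • 𝟙 diagrams.up.A) ▷ X := by
  rw [zsmul_whiskerRight, id_whiskerRight, scalLeft_circle₀, scalLeft_circle₀]
  exact (diagrams.bubble_P X).trans (congrArg _ (one_smul ℤ _).symm)

theorem circle₁_up (X : HeisObj) : scalLeft circle₁ (diagrams.up.A ⊗ X) =
    diagrams.up.A ◁ scalLeft circle₁ X +
      ((2 * diagrams.up.sign) • diagrams.up.dot) ▷ X := by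
  rw [zsmul_whiskerRight, scalLeft_circle₁, scalLeft_circle₁]
  exact (diagrams.dottedBubble_P X).trans (congrArg _ (natCast_zsmul _ 2).symm)

theorem circle₀_down (X : HeisObj) : scalLeft circle₀ (diagrams.down.A ⊗ X) =
    diagrams.down.A ◁ scalLeft circle₀ X +
      (diagrams.down.sign • 𝟙 diagrams.down.A) ▷ X := by
  refine (diagrams.slide_Q (scalLeft circle₀) (scalLeft_naturality circle₀) (fun X => 𝟙 _)
    (fun X => ?_) X).trans ?_
  · rw [scalLeft_circle₀, scalLeft_circle₀, diagrams.bubble_P]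
  · rw [zsmul_whiskerRight, whiskerLeft_id, Category.id_comp, diagrams.zigzag_Q',
      sub_eq_add_neg, id_whiskerRight]
    exact congrArg _ (neg_one_zsmul _).symm

theorem circle₁_down (X : HeisObj) : scalLeft circle₁ (diagrams.down.A ⊗ X) =
    diagrams.down.A ◁ scalLeft circle₁ X +
      ((2 * diagrams.down.sign) • diagrams.down.dot) ▷ X := by
  refine (diagrams.slide_Q (scalLeft circle₁) (scalLeft_naturality circle₁)
    (fun X => (2 : ℤ) • diagrams.dotP ▷ X) (fun X => ?_) X).trans ?_
  · rw [scalLeft_circle₁, scalLeft_circle₁, diagrams.dottedBubble_P, ← natCast_zsmul]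
    rfl
  · rw [whiskerLeft_zsmul, Preadditive.zsmul_comp, Preadditive.comp_zsmul, ← diagrams.dotQ_eq,
      sub_eq_add_neg, zsmul_whiskerRight, ← neg_zsmul]
    rfl

/-- Clockwise circles without and with a dot slide through the strand `s`: the corrections are, up to
the sign of `s`, the strand itself and twice the strand with a dot. -/
structure Slides (s : Strand HeisObj) : Prop where
  circle₀ (X : HeisObj) : scalLeft circle₀ (s.A ⊗ X) =
    s.A ◁ scalLeft circle₀ X + (s.sign • 𝟙 s.A) ▷ X
  circle₁ (X : HeisObj) : scalLeft circle₁ (s.A ⊗ X) =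
    s.A ◁ scalLeft circle₁ X + ((2 * s.sign) • s.dot) ▷ X

theorem slides_up : Slides diagrams.up := ⟨circle₀_up, circle₁_up⟩

theorem slides_down : Slides diagrams.down := ⟨circle₀_down, circle₁_down⟩

namespace Slides

variable {s : Strand HeisObj} (hs : Slides s)
include hs

theorem circle₀_mul_cycCls (n : ℕ) : cls Heis.circle₀ * s.cycCls n =
    s.cycCls n * cls Heis.circle₀ + (s.sign * n) • s.cycCls n := by
  rw [Strand.cycCls, cls_scal_mul_strands hs.circle₀, strandSum_zsmul, strandSum_id,
    ← natCast_zsmul, smul_smul, Preadditive.comp_zsmul, cls_zsmul, Category.comp_id]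

theorem circle₁_mul_cycCls (n : ℕ) : cls Heis.circle₁ * s.cycCls n =
    s.cycCls n * cls Heis.circle₁ + (2 * s.sign) •
      ∑ i : Fin n, cls (longCycle s.cross n ≫ dots s.dot n (Pi.single i 1)) := by
  rw [Strand.cycCls, cls_scal_mul_strands hs.circle₁, strandSum_zsmul, ← sum_dots,
    Preadditive.comp_zsmul, cls_zsmul, Preadditive.comp_sum, cls_sum]

theorem circle₁_mul_dotCls (a : ℕ) : cls Heis.circle₁ * s.dotCls a =
    s.dotCls a * cls Heis.circle₁ + (2 * s.sign) • s.dotCls (a + 1) := by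
  rw [Strand.dotCls, cls_scal_mul_strand hs.circle₁, Preadditive.comp_zsmul, cls_zsmul]
  rfl

end Slides

/-! ### Commutators of strands of opposite directions -/

/-- In the trace, resolving the identity of `Q P` on one side of a diagram moves the rest of the
resolution to the other side. -/
theorem cls_QP {X : HeisObj}
    (f : diagrams.Q ⊗ (diagrams.P ⊗ X) ⟶ diagrams.Q ⊗ (diagrams.P ⊗ X)) :
    cls f = cls (tail diagrams.crossPQ X ≫ f ≫ tail diagrams.crossQP X) +
      cls (cupTail diagrams.cupQP X ≫ f ≫ capTail diagrams.capQP X) := by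
  nth_rw 1 [← Category.comp_id f]
  rw [diagrams.id_eq_crossQP_crossPQ, Preadditive.comp_add, cls_add, ← Category.assoc,
    cls_comp_comm, ← Category.assoc f, cls_comp_comm (f ≫ _) (cupTail _ _)]

theorem cls_Q_mul_cls_P (q : diagrams.Q ⟶ diagrams.Q) (p : diagrams.P ⟶ diagrams.P) :
    cls q * cls p =
      cls (tail diagrams.crossPQ (𝟙_ HeisObj) ≫ (q ▷ (diagrams.P ⊗ 𝟙_ HeisObj) ≫
        diagrams.Q ◁ (p ▷ 𝟙_ HeisObj)) ≫ tail diagrams.crossQP (𝟙_ HeisObj)) +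
      cls (cupTail diagrams.cupQP (𝟙_ HeisObj) ≫ (q ▷ (diagrams.P ⊗ 𝟙_ HeisObj) ≫
        diagrams.Q ◁ (p ▷ 𝟙_ HeisObj)) ≫ capTail diagrams.capQP (𝟙_ HeisObj)) := by
  rw [← cls_QP, ← cls_whiskerRight_unit p, cls_mul, MonoidalCategory.tensorHom_def]

theorem cls_P_mul_cls_Q (p : diagrams.P ⟶ diagrams.P) (q : diagrams.Q ⟶ diagrams.Q) :
    cls p * cls q = cls (diagrams.P ◁ (q ▷ 𝟙_ HeisObj) ≫ p ▷ (diagrams.Q ⊗ 𝟙_ HeisObj)) := by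
  rw [← cls_whiskerRight_unit q, cls_mul, tensorHom_def']

theorem cls_circle₀ : cls circle₀ = cls (cupTail diagrams.cupPQ (𝟙_ HeisObj) ≫
    capTail diagrams.capPQ (𝟙_ HeisObj)) := by
  rw [← scalLeft_circle₀, scalLeft_unit]

theorem cls_circle₁ : cls circle₁ = cls (cupTail diagrams.cupPQ (𝟙_ HeisObj) ≫
    diagrams.dotP ▷ (diagrams.Q ⊗ 𝟙_ HeisObj) ≫ capTail diagrams.capPQ (𝟙_ HeisObj)) := by
  rw [← scalLeft_circle₁, scalLeft_unit]

theorem cls_Q_mul_P : cls (𝟙 diagrams.Q) * cls (𝟙 diagrams.P) =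
    cls (𝟙 diagrams.P) * cls (𝟙 diagrams.Q) + 1 := by
  rw [cls_Q_mul_cls_P, cls_P_mul_cls_Q, one_eq_cls]
  simp only [id_whiskerRight, whiskerLeft_id, Category.id_comp, diagrams.crossPQ_crossQP,
    diagrams.circle]

theorem cls_Q_mul_dotP : cls (𝟙 diagrams.Q) * cls diagrams.dotP =
    cls diagrams.dotP * cls (𝟙 diagrams.Q) := by
  rw [cls_Q_mul_cls_P, cls_P_mul_cls_Q]
  simp only [id_whiskerRight, whiskerLeft_id, Category.id_comp, diagrams.crossPQ_dotP_crossQP,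
    diagrams.leftBubble_one, cls_zero, add_zero]

theorem cls_dotQ_mul_P : cls diagrams.dotQ * cls (𝟙 diagrams.P) =
    cls (𝟙 diagrams.P) * cls diagrams.dotQ := by
  rw [cls_Q_mul_cls_P, cls_P_mul_cls_Q]
  simp only [id_whiskerRight, whiskerLeft_id, Category.comp_id, diagrams.crossPQ_dotQ_crossQP,
    diagrams.dotQ_cap, diagrams.leftBubble_one, cls_zero, add_zero]

theorem cls_dotQ_mul_dotP : cls diagrams.dotQ * cls diagrams.dotP =
    cls diagrams.dotP * cls diagrams.dotQ + (2 : ℤ) • cls circle₀ := by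
  rw [cls_Q_mul_cls_P, cls_P_mul_cls_Q]
  simp only [Category.assoc]
  rw [diagrams.crossPQ_dotQ_dotP_crossQP, cls_add, cls_comp_comm (capTail _ _),
    ← whisker_exchange_assoc, diagrams.dotQ_cap, diagrams.leftBubble_two, ← cls_circle₀, add_assoc,
    two_zsmul]

theorem cls_dotQ_mul_dotP_dotP : cls diagrams.dotQ * cls (diagrams.dotP ≫ diagrams.dotP) =
    cls (diagrams.dotP ≫ diagrams.dotP) * cls diagrams.dotQ + (3 : ℤ) • cls circle₁ := by
  rw [cls_Q_mul_cls_P, cls_P_mul_cls_Q]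
  simp only [Category.assoc, comp_whiskerRight, whiskerLeft_comp]
  have h : cls (cupTail diagrams.cupQP (𝟙_ HeisObj) ≫ diagrams.dotQ ▷ (diagrams.P ⊗ 𝟙_ HeisObj) ≫
      diagrams.Q ◁ (diagrams.dotP ▷ 𝟙_ HeisObj) ≫ diagrams.Q ◁ (diagrams.dotP ▷ 𝟙_ HeisObj) ≫
        capTail diagrams.capQP (𝟙_ HeisObj)) = cls circle₁ := by
    rw [← whisker_exchange_assoc, ← whisker_exchange_assoc, diagrams.dotQ_cap,
      diagrams.leftBubble_three, cls_circle₁]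
  have h₁ : cls (capTail diagrams.capPQ (𝟙_ HeisObj) ≫ cupTail diagrams.cupPQ (𝟙_ HeisObj) ≫
      diagrams.dotP ▷ (diagrams.Q ⊗ 𝟙_ HeisObj)) = cls circle₁ := by
    rw [cls_comp_comm, cls_circle₁, Category.assoc]
  have h₂ : cls (diagrams.dotP ▷ (diagrams.Q ⊗ 𝟙_ HeisObj) ≫ capTail diagrams.capPQ (𝟙_ HeisObj) ≫
      cupTail diagrams.cupPQ (𝟙_ HeisObj)) = cls circle₁ := by
    rw [← Category.assoc, cls_comp_comm, cls_circle₁]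
  rw [h, diagrams.crossPQ_dotQ_dotP_dotP_crossQP, cls_add, cls_add, h₁, h₂]
  abel

/-! ### The Lie algebra of one direction -/

/-- The relations from which all the brackets between the classes of one orientation follow: `D`
plays the role of half the once-dotted circle, `B n` of the cyclic permutation of `n` strands, and
`ℓ n` of `± n⁻¹` times the sum of its one-dot decorations. -/
structure HalfHeisVir (K : Type*) {L : Type*} [Field K] [LieRing L] [LieAlgebra K L]
    (D : L) (B ℓ : ℕ → L) : Prop where
  D_B : ∀ n, ⁅D, B n⁆ = (n : K) • ℓ n
  l_one_B : ∀ n, ⁅ℓ 1, B n⁆ = (n : K) • B (n + 1)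
  B_one_B : ∀ n, ⁅B 1, B n⁆ = 0
  cubic_B : ⁅⁅D, ⁅D, ℓ 1⁆⁆, B 1⁆ = (3 : K) • ⁅⁅D, ℓ 1⁆, ℓ 1⁆ + ⁅ℓ 1, B 1⁆
  serre : ⁅ℓ 1, ⁅ℓ 1, ⁅D, ℓ 1⁆⁆⁆ = 0

namespace HalfHeisVir

variable {K L : Type*} [Field K] [CharZero K] [LieRing L] [LieAlgebra K L]
  {D : L} {B ℓ : ℕ → L} (H : HalfHeisVir K D B ℓ)
include H

lemma B_B (m n : ℕ) : ⁅B (m + 1), B n⁆ = 0 := by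
  induction m generalizing n with
  | zero => exact H.B_one_B n
  | succ m ih =>
    have hm : ((m : K) + 1) ≠ 0 := by exact_mod_cast Nat.succ_ne_zero m
    have h := leibniz_lie (ℓ 1) (B (m + 1)) (B n)
    simp only [H.l_one_B, ih, lie_zero, lie_smul, smul_lie, smul_zero, add_zero] at h
    push_cast at h
    linear_combination (norm := (match_scalars; field_simp; ring)) (-((m : K) + 1)⁻¹) • h

/-- This is the bracket of `D` with `⁅B (m + 1), B n⁆ = 0`. -/
lemma l_B_symm (m n : ℕ) :
    ((m : K) + 1) • ⁅ℓ (m + 1), B n⁆ = (n : K) • ⁅ℓ n, B (m + 1)⁆ := by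
  have h := leibniz_lie D (B (m + 1)) (B n)
  simp only [H.D_B, H.B_B, lie_zero, lie_smul, smul_lie] at h
  push_cast at h
  rw [← lie_skew (B (m + 1)) (ℓ n)] at h
  linear_combination (norm := module) (-1 : K) • h

lemma l_B_one (m : ℕ) : ⁅ℓ (m + 1), B 1⁆ = B (m + 2) := by
  have hm : ((m : K) + 1) ≠ 0 := by exact_mod_cast Nat.succ_ne_zero m
  have h := H.l_B_symm m 1
  have h' := H.l_one_B (m + 1)
  push_cast at h h'
  linear_combination (norm := (match_scalars <;> field_simp <;> ring))
    (((m : K) + 1)⁻¹) • h + (((m : K) + 1)⁻¹) • h'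

/-- This is the bracket of `D` with `⁅ℓ 1, B 1⁆ = B 2`. -/
lemma two_l_two : (2 : K) • ℓ 2 = ⁅⁅D, ℓ 1⁆, B 1⁆ := by
  have h := leibniz_lie D (ℓ 1) (B 1)
  simp only [H.D_B, H.l_one_B, lie_smul, lie_self] at h
  push_cast at h
  linear_combination (norm := module) h

/-- This is the bracket of `D` with `two_l_two`; the correction `B 2` comes from `cubic_B`. -/
lemma D_l_two : ⁅D, ℓ 2⁆ = -((2 : K) • ⁅ℓ 1, ⁅D, ℓ 1⁆⁆) + (2⁻¹ : K) • B 2 := by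
  have h := leibniz_lie D ⁅D, ℓ 1⁆ (B 1)
  rw [← H.two_l_two, H.cubic_B, H.D_B, H.l_one_B, lie_smul, lie_smul,
    ← lie_skew ⁅D, ℓ 1⁆ (ℓ 1)] at h
  push_cast at h
  linear_combination (norm := (match_scalars <;> field_simp <;> ring)) (2⁻¹ : K) • h

/-- The system of three linear equations that determines these brackets is obtained by bracketing
the relations among `B 1`, `B 2`, `B 3` with `D` and `ℓ 1`. -/
lemma base : ⁅⁅ℓ 1, ⁅D, ℓ 1⁆⁆, B 1⁆ = -((2 : K) • ℓ 3) ∧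
    ⁅⁅D, ℓ 1⁆, B 2⁆ = (4 : K) • ℓ 3 ∧ ⁅ℓ 1, ℓ 2⁆ = ℓ 3 := by
  have h1 := leibniz_lie D (ℓ 2) (B 1)
  have h2 := leibniz_lie D (ℓ 1) (B 2)
  have h3 := leibniz_lie (ℓ 1) ⁅D, ℓ 1⁆ (B 1)
  have hb : ⁅B 2, B 1⁆ = 0 := H.B_B 1 1
  rw [← H.two_l_two] at h3
  rw [H.l_B_one 1] at h1
  simp only [H.D_l_two, H.D_B, H.l_one_B, lie_smul, smul_lie, add_lie, neg_lie, hb, smul_zero]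
    at h1 h2 h3
  rw [← lie_skew (ℓ 2) (ℓ 1)] at h1
  simp only [Nat.reduceAdd, Nat.cast_ofNat, Nat.cast_one] at h1 h2 h3
  -- With `p`, `q`, `b` the three brackets, the equations are `3 ℓ 3 = -2 p - b`, `6 ℓ 3 = q + 2 b`
  -- and `2 b = p + q`; the coefficients below solve this system.
  refine ⟨?_, ?_, ?_⟩
  · linear_combination (norm := module) (4/9 : K) • h1 + (1/9 : K) • h2 - (1/9 : K) • h3
  · linear_combination (norm := module) (-(2/9) : K) • h1 - (5/9 : K) • h2 - (4/9 : K) • h3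
  · linear_combination (norm := module) (1/9 : K) • h1 - (2/9 : K) • h2 + (2/9 : K) • h3

/-- In the step from `n` to `n + 1`, bracketing the first two relations with `ℓ 1` and the relation
`⁅ℓ 1, B (n + 3)⁆ = (n + 3) • B (n + 4)` with `D` gives linear equations for the three brackets. -/
lemma ladder (n : ℕ) :
    ⁅⁅ℓ 1, ⁅D, ℓ 1⁆⁆, B (n + 1)⁆ = -((2 * ((n : K) + 1)) • ℓ (n + 3)) ∧
    ⁅⁅D, ℓ 1⁆, B (n + 2)⁆ = (2 * ((n : K) + 2)) • ℓ (n + 3) ∧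
    ⁅ℓ 1, ℓ (n + 2)⁆ = ((n : K) + 1) • ℓ (n + 3) := by
  induction n with
  | zero =>
    obtain ⟨h1, h2, h3⟩ := H.base
    refine ⟨?_, ?_, ?_⟩
    · rw [h1]; norm_num
    · rw [h2]; norm_num
    · rw [h3]; norm_num
  | succ n ih =>
    obtain ⟨h1, h2, -⟩ := ih
    have e1 := leibniz_lie (ℓ 1) ⁅ℓ 1, ⁅D, ℓ 1⁆⁆ (B (n + 1))
    have e2 := leibniz_lie (ℓ 1) ⁅D, ℓ 1⁆ (B (n + 2))
    have e3 := leibniz_lie D (ℓ 1) (B (n + 3))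
    have n1 : ((n : K) + 1) ≠ 0 := by exact_mod_cast Nat.succ_ne_zero n
    have n2 : ((n : K) + 2) ≠ 0 := by exact_mod_cast Nat.succ_ne_zero (n + 1)
    have n3 : ((n : K) + 3) ≠ 0 := by exact_mod_cast Nat.succ_ne_zero (n + 2)
    have n4 : ((n : K) + 4) ≠ 0 := by exact_mod_cast Nat.succ_ne_zero (n + 3)
    rw [h1, H.serre, zero_lie, zero_add, H.l_one_B, lie_neg, lie_smul, lie_smul] at e1
    rw [h2, H.l_one_B, lie_smul, lie_smul] at e2
    rw [H.l_one_B, H.D_B, lie_smul, lie_smul, H.D_B] at e3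
    push_cast at e1 e2 e3
    have e1' : ⁅⁅ℓ 1, ⁅D, ℓ 1⁆⁆, B (n + 2)⁆ = -((2 : K) • ⁅ℓ 1, ℓ (n + 3)⁆) := by
      linear_combination (norm := (match_scalars <;> field_simp <;> ring))
        (-((n : K) + 1)⁻¹) • e1
    rw [e1'] at e2
    have e4 : ⁅ℓ 1, ℓ (n + 3)⁆ = ((n : K) + 2) • ℓ (n + 4) := by
      linear_combination (norm := (match_scalars <;> field_simp <;> ring))
        ((((n : K) + 3) * ((n : K) + 4))⁻¹) • e2 -
          (((n : K) + 2) * (((n : K) + 3) * ((n : K) + 4))⁻¹) • e3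
    rw [e4] at e3 e1'
    refine ⟨?_, ?_, ?_⟩
    · rw [show n + 1 + 1 = n + 2 from rfl, e1']; push_cast; module
    · show ⁅⁅D, ℓ 1⁆, B (n + 3)⁆ = _ • ℓ (n + 4)
      push_cast
      linear_combination (norm := module) (-1 : K) • e3
    · show ⁅ℓ 1, ℓ (n + 3)⁆ = _ • ℓ (n + 4)
      rw [e4]; push_cast; module

lemma l_one_l (n : ℕ) : ⁅ℓ 1, ℓ (n + 1)⁆ = (n : K) • ℓ (n + 2) := by
  cases n with
  | zero => simp
  | succ n => rw [(H.ladder n).2.2]; push_cast; rfl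

/-- Bracketing with `ℓ 1` raises the degree of `B n`. -/
lemma l_B (m n : ℕ) : ⁅ℓ (m + 1), B n⁆ = (n : K) • B (m + 1 + n) := by
  have hm (m : ℕ) : ((m : K) + 1) ≠ 0 := by exact_mod_cast Nat.succ_ne_zero m
  cases n with
  | zero =>
    have h := H.l_B_symm m 0
    rw [Nat.cast_zero, zero_smul, smul_eq_zero] at h
    rw [h.resolve_left (hm m), Nat.cast_zero, zero_smul]
  | succ n =>
    induction n generalizing m with
    | zero => rw [H.l_B_one]; norm_num
    | succ n ih =>
      have h := leibniz_lie (ℓ (m + 1)) (ℓ 1) (B (n + 1))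
      rw [← lie_skew (ℓ (m + 1)) (ℓ 1), H.l_one_l, H.l_one_B, ih m, neg_lie, smul_lie, ih (m + 1),
        lie_smul, lie_smul, H.l_one_B] at h
      rw [show m + 1 + 1 + (n + 1) = m + n + 3 by ring,
        show m + 1 + (n + 1) + 1 = m + n + 3 by ring] at h
      rw [show m + 1 + (n + 1 + 1) = m + n + 3 by ring]
      push_cast at h ⊢
      have hn := hm n
      linear_combination (norm := (match_scalars <;> field_simp <;> ring)) (((n : K) + 1)⁻¹) • h

/-- The bracket of `ℓ 2` with `⁅D, B (n + 1)⁆`; the bracket `⁅ℓ 2, D⁆` is known from `D_l_two`. -/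
lemma l_two_l (n : ℕ) : ⁅ℓ 2, ℓ (n + 1)⁆ = ((n : K) - 1) • ℓ (n + 3) := by
  have hn : ((n : K) + 1) ≠ 0 := by exact_mod_cast Nat.succ_ne_zero n
  have h := leibniz_lie (ℓ 2) D (B (n + 1))
  rw [← lie_skew (ℓ 2) D, H.D_l_two, H.l_B 1, H.D_B, lie_smul, lie_smul, H.D_B, neg_lie, add_lie,
    neg_lie, smul_lie, smul_lie, H.B_B 1, (H.ladder n).1,
    show 1 + 1 + (n + 1) = n + 3 by ring] at h
  push_cast at h
  linear_combination (norm := (match_scalars <;> field_simp <;> ring)) (((n : K) + 1)⁻¹) • h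

lemma l_l (m n : ℕ) : ⁅ℓ (m + 1), ℓ (n + 1)⁆ = ((n : K) - m) • ℓ (m + n + 2) := by
  cases m with
  | zero => rw [zero_add, H.l_one_l, zero_add]; simp
  | succ m =>
    induction m generalizing n with
    | zero => rw [H.l_two_l, show 0 + 1 + n + 2 = n + 3 by ring]; simp
    | succ m ih =>
      have hm : ((m : K) + 1) ≠ 0 := by exact_mod_cast Nat.succ_ne_zero m
      have h := leibniz_lie (ℓ 1) (ℓ (m + 1 + 1)) (ℓ (n + 1))
      rw [ih n, H.l_one_l, H.l_one_l, lie_smul, smul_lie, lie_smul, ih (n + 1),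
        show m + 1 + n + 2 = (m + n + 2) + 1 by ring, H.l_one_l,
        show m + 1 + (n + 1) + 2 = m + n + 4 by ring] at h
      rw [show m + 1 + 1 + n + 2 = m + n + 4 by ring]
      push_cast at h ⊢
      linear_combination (norm := (match_scalars <;> field_simp <;> ring))
        (-((m : K) + 1)⁻¹) • h

end HalfHeisVir

/-! ### The Lie algebra of both directions -/

/-- Relations among elements `b k`, `V k`, a central element `I` and an auxiliary element `D` that
force the `b k` and `V k` to satisfy all the Heisenberg–Virasoro relations with central element
`I`: the relations within each of the two halves, and a few relations between them. -/
structure HeisVir (K : Type*) {L : Type*} [Field K] [LieRing L] [LieAlgebra K L]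
    (b V : ℤ → L) (I D : L) : Prop where
  b_zero : b 0 = 0
  lie_I : ∀ x : L, ⁅x, I⁆ = 0
  V_zero_b : ∀ k, ⁅V 0, b k⁆ = -((k : K) • b k)
  V_zero_D : ⁅V 0, D⁆ = 0
  D_b : ∀ k, ⁅D, b k⁆ = -((k : K) • V k)
  b_b_pos : ∀ k l, 0 < k → 0 < l → ⁅b k, b l⁆ = 0
  b_b_neg : ∀ k l, k < 0 → l < 0 → ⁅b k, b l⁆ = 0
  V_b_pos : ∀ k l, 0 < k → 0 < l → ⁅V k, b l⁆ = -((l : K) • b (k + l))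
  V_b_neg : ∀ k l, k < 0 → l < 0 → ⁅V k, b l⁆ = -((l : K) • b (k + l))
  V_V_pos : ∀ k l, 0 < k → 0 < l → ⁅V k, V l⁆ = ((k : K) - l) • V (k + l)
  V_V_neg : ∀ k l, k < 0 → l < 0 → ⁅V k, V l⁆ = ((k : K) - l) • V (k + l)
  b_one_b_neg_one : ⁅b 1, b (-1)⁆ = I
  V_one_b_neg_one : ⁅V 1, b (-1)⁆ = 0
  V_neg_one_b_one : ⁅V (-1), b 1⁆ = 0
  V_one_V_neg_one : ⁅V 1, V (-1)⁆ = (2 : K) • V 0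
  V_one_D_V_neg_one : ⁅V 1, ⁅D, V (-1)⁆⁆ = (6 : K) • D
  D_V_two : ⁅D, V 2⁆ = (2 : K) • ⁅V 1, ⁅D, V 1⁆⁆ - (2⁻¹ : K) • b 2
  D_V_neg_two : ⁅D, V (-2)⁆ = -((2 : K) • ⁅V (-1), ⁅D, V (-1)⁆⁆) + (2⁻¹ : K) • b (-2)

namespace HeisVir

variable {K L : Type*} [Field K] [CharZero K] [LieRing L] [LieAlgebra K L]
  {b V : ℤ → L} {I D : L} (H : HeisVir K b V I D)
include H

/-- The relations are invariant under the involution exchanging the two halves. -/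
lemma swap : HeisVir K (fun k => b (-k)) (fun k => -V (-k)) (-I) D where
  b_zero := by simpa using H.b_zero
  lie_I x := by rw [lie_neg, H.lie_I, neg_zero]
  V_zero_b k := by
    have h := H.V_zero_b (-k)
    simp only [neg_zero, neg_lie, h]
    push_cast; module
  V_zero_D := by simp [H.V_zero_D]
  D_b k := by simp only [H.D_b]; push_cast; module
  b_b_pos k l hk hl := H.b_b_neg _ _ (by omega) (by omega)
  b_b_neg k l hk hl := H.b_b_pos _ _ (by omega) (by omega)
  V_b_pos k l hk hl := by
    simp only [neg_lie, H.V_b_neg (-k) (-l) (by omega) (by omega), neg_add]; push_cast; module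
  V_b_neg k l hk hl := by
    simp only [neg_lie, H.V_b_pos (-k) (-l) (by omega) (by omega), neg_add]; push_cast; module
  V_V_pos k l hk hl := by
    simp only [neg_lie, lie_neg, H.V_V_neg (-k) (-l) (by omega) (by omega), neg_add]
    push_cast; module
  V_V_neg k l hk hl := by
    simp only [neg_lie, lie_neg, H.V_V_pos (-k) (-l) (by omega) (by omega), neg_add]
    push_cast; module
  b_one_b_neg_one := by
    simp only [neg_neg]
    rw [← lie_skew, H.b_one_b_neg_one]
  V_one_b_neg_one := by simp [H.V_neg_one_b_one]
  V_neg_one_b_one := by simp [H.V_one_b_neg_one]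
  V_one_V_neg_one := by
    simp only [neg_neg, neg_zero, neg_lie, lie_neg]
    rw [← lie_skew, H.V_one_V_neg_one]; module
  V_one_D_V_neg_one := by
    have h := leibniz_lie (V 1) D (V (-1))
    have h0 := H.V_zero_D
    rw [← lie_skew] at h0
    rw [H.V_one_D_V_neg_one, H.V_one_V_neg_one, lie_smul, neg_eq_zero.mp h0, smul_zero, add_zero,
      ← lie_skew, ← lie_skew (V 1) D, lie_neg, neg_neg] at h
    simp only [neg_neg, neg_lie, lie_neg]
    exact h.symm
  D_V_two := by
    simp only [lie_neg, neg_lie, H.D_V_neg_two]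
    module
  D_V_neg_two := by
    simp only [lie_neg, neg_lie, neg_neg, H.D_V_two]
    module

/-- Since `V 0` commutes with `D`, this follows from `⁅V 0, b k⁆` by bracketing with `D`. -/
lemma V_zero_V (k : ℤ) : ⁅V 0, V k⁆ = -((k : K) • V k) := by
  rcases eq_or_ne k 0 with rfl | hk
  · simp
  have hk' : (k : K) ≠ 0 := by exact_mod_cast hk
  have h := leibniz_lie (V 0) D (b k)
  rw [H.V_zero_D, zero_lie, H.V_zero_b, H.D_b, lie_neg, lie_neg, lie_smul, lie_smul, H.D_b] at h
  linear_combination (norm := (match_scalars <;> field_simp <;> ring)) (-(k : K)⁻¹) • h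

lemma V_one_b (k : ℤ) : ⁅V 1, b k⁆ = -((k : K) • b (k + 1)) := by
  rcases lt_trichotomy k 0 with hk | rfl | hk
  · have hk : k ≤ -1 := by omega
    induction k, hk using Int.leInductionDown with
    | base => simp [H.V_one_b_neg_one, H.b_zero]
    | pred k hk ih =>
      have hk' : (k : K) ≠ 0 := by exact_mod_cast (show k ≠ 0 by omega)
      have e : ⁅V (-1), b (k + 1)⁆ = -(((k : K) + 1) • b k) := by
        rcases eq_or_ne k (-1) with rfl | h
        · simp [H.b_zero]
        · rw [H.V_b_neg _ _ (by omega) (by omega), show -1 + (k + 1) = k by ring]; push_cast; rfl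
      -- The step lowers the index by `⁅V (-1), b k⁆ = -k • b (k - 1)`.
      have h := leibniz_lie (V 1) (V (-1)) (b k)
      rw [ih (by omega), H.V_b_neg _ _ (by omega) (by omega), H.V_one_V_neg_one, smul_lie,
        H.V_zero_b,
        lie_neg, lie_neg, lie_smul, lie_smul, e, show -1 + k = k - 1 by ring] at h
      rw [show k - 1 + 1 = k by ring]
      push_cast
      linear_combination (norm := (match_scalars <;> field_simp <;> ring)) (-(k : K)⁻¹) • h
  · simp [H.b_zero]
  · rw [H.V_b_pos _ _ one_pos hk, add_comm]

lemma V_neg_one_b (k : ℤ) : ⁅V (-1), b k⁆ = -((k : K) • b (k - 1)) := by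
  have h := H.swap.V_one_b (-k)
  rw [neg_lie, neg_neg, show -(-k + 1) = k - 1 by ring] at h
  push_cast at h
  linear_combination (norm := module) (-1 : K) • h

lemma b_b_neg_one (k : ℤ) : ⁅b k, b (-1)⁆ = if k = 1 then (k : K) • I else 0 := by
  rcases lt_trichotomy k 0 with hk | rfl | hk
  · rw [H.b_b_neg _ _ hk (by omega), if_neg (by omega)]
  · simp [H.b_zero]
  · have hk : 1 ≤ k := hk
    induction k, hk using Int.leInduction with
    | base => simp [H.b_one_b_neg_one]
    | succ k hk ih =>
      have hk' : (k : K) ≠ 0 := by exact_mod_cast (show k ≠ 0 by omega)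
      have h := leibniz_lie (V 1) (b k) (b (-1))
      have e : ⁅V 1, ⁅b k, b (-1)⁆⁆ = 0 := by
        rw [ih (by omega)]; split_ifs <;> simp [H.lie_I]
      rw [e, H.V_one_b, H.V_one_b_neg_one, lie_zero, add_zero, neg_lie, smul_lie, eq_comm,
        neg_eq_zero, smul_eq_zero] at h
      rw [h.resolve_left hk', if_neg (by omega)]

lemma b_b (k l : ℤ) : ⁅b k, b l⁆ = if k = -l then (k : K) • I else 0 := by
  -- Bracketing with `V (-1)` lowers the negative index `l` and kills the central element.
  have key (l : ℤ) (hl : l ≤ -1) : ∀ k, ⁅b k, b l⁆ = if k = -l then (k : K) • I else 0 := by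
    induction l, hl using Int.leInductionDown with
    | base => simpa using H.b_b_neg_one
    | pred l hl ih =>
      intro k
      have hl' : (l : K) ≠ 0 := by exact_mod_cast (show l ≠ 0 by omega)
      have h := leibniz_lie (V (-1)) (b k) (b l)
      have e : ⁅V (-1), ⁅b k, b l⁆⁆ = 0 := by
        rw [ih]; split_ifs <;> simp [H.lie_I]
      rw [e, H.V_neg_one_b, H.V_neg_one_b, neg_lie, smul_lie, lie_neg, lie_smul, ih] at h
      by_cases hkl : k = -(l - 1)
      · rw [if_pos (by omega)] at h
        rw [if_pos hkl]
        subst hkl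
        push_cast at h ⊢
        linear_combination (norm := (match_scalars <;> field_simp <;> ring)) ((l : K)⁻¹) • h
      · rw [if_neg (by omega), smul_zero, neg_zero, zero_add, eq_comm,
          neg_eq_zero, smul_eq_zero] at h
        rw [h.resolve_left hl', if_neg hkl]
  rcases lt_trichotomy l 0 with hl | rfl | hl
  · exact key l (by omega) k
  · rw [H.b_zero, lie_zero, neg_zero]
    split_ifs with h <;> simp [h]
  · rcases lt_trichotomy k 0 with hk | rfl | hk
    · rw [← lie_skew, key k (by omega) l]
      by_cases h : k = -l
      · rw [if_pos h, if_pos (by omega), h]; push_cast; module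
      · rw [if_neg h, if_neg (by omega), neg_zero]
    · simp [H.b_zero]
    · rw [H.b_b_pos _ _ hk hl, if_neg (by omega)]

/-- This is the bracket of `D` with the central element `⁅b k, b l⁆`. -/
lemma V_b_symm (k l : ℤ) : (k : K) • ⁅V k, b l⁆ = (l : K) • ⁅V l, b k⁆ := by
  have h := leibniz_lie D (b k) (b l)
  have e : ⁅D, ⁅b k, b l⁆⁆ = 0 := by
    rw [H.b_b]; split_ifs <;> simp [H.lie_I]
  rw [e, H.D_b, H.D_b, neg_lie, lie_neg, smul_lie, lie_smul, ← lie_skew (b k)] at h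
  linear_combination (norm := module) h

/-- Both elements are reached from single strands, `V 2` through `b 2 = -⁅V 1, b 1⁆`, so that the
bracket follows from that of `⁅D, V (-1)⁆` with `V 1` and `b 1`. -/
lemma V_neg_one_V_two : ⁅V (-1), V 2⁆ = -((3 : K) • V 1) := by
  have h1 := leibniz_lie D (V (-1)) (b 1)
  have h2 := leibniz_lie ⁅D, V (-1)⁆ (V 1) (b 1)
  have h3 := leibniz_lie D (V (-1)) (b 2)
  rw [← lie_skew _ (V 1), H.V_one_D_V_neg_one, H.V_one_b] at h2
  rw [H.V_neg_one_b_one, lie_zero, H.D_b, lie_neg, lie_smul, ← lie_skew (V (-1)) (V 1),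
    H.V_one_V_neg_one] at h1
  have h1' : ⁅⁅D, V (-1)⁆, b 1⁆ = -((2 : K) • V 0) := by
    push_cast at h1
    linear_combination (norm := module) (-1 : K) • h1
  rw [h1', lie_neg, lie_neg, lie_smul, lie_smul, neg_lie, smul_lie, H.D_b, ← lie_skew (V 1),
    H.V_zero_V] at h2
  rw [H.V_neg_one_b, lie_neg, lie_smul, H.D_b, H.D_b, lie_neg, lie_smul] at h3
  norm_num at h2 h3
  linear_combination (norm := module) (2⁻¹ : K) • h3 - (2⁻¹ : K) • h2

lemma V_two_b (k : ℤ) : ⁅V 2, b k⁆ = -((k : K) • b (k + 2)) := by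
  rcases lt_trichotomy k 0 with hk | rfl | hk
  · have hk : k ≤ -1 := by omega
    induction k, hk using Int.leInductionDown with
    | base =>
      have h := H.V_b_symm 2 (-1)
      rw [H.V_neg_one_b] at h
      push_cast at h ⊢
      linear_combination (norm := module) (2⁻¹ : K) • h
    | pred k hk ih =>
      have hk' : (k : K) ≠ 0 := by exact_mod_cast (show k ≠ 0 by omega)
      have h := leibniz_lie (V 2) (V (-1)) (b k)
      rw [ih (by omega), H.V_neg_one_b, ← lie_skew (V 2) (V (-1)), H.V_neg_one_V_two, neg_neg,
        smul_lie, H.V_one_b,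
        lie_neg, lie_neg, lie_smul, lie_smul, H.V_neg_one_b, show k + 2 - 1 = k + 1 by ring] at h
      rw [show k - 1 + 2 = k + 1 by ring]
      push_cast at h ⊢
      linear_combination (norm := (match_scalars <;> field_simp <;> ring)) (-(k : K)⁻¹) • h
  · simp [H.b_zero]
  · rw [H.V_b_pos _ _ two_pos hk, add_comm]

lemma V_b_of_pos (l : ℤ) (hl : 0 < l) (k : ℤ) : ⁅V l, b k⁆ = -((k : K) • b (l + k)) := by
  rcases eq_or_ne l 1 with rfl | hl1
  · rw [H.V_one_b, add_comm]
  have hl : 2 ≤ l := by omega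
  clear hl1
  induction l, hl using Int.leInduction generalizing k with
  | base => rw [H.V_two_b, add_comm]
  | succ l hl ih =>
    have hl' : (l : K) - 1 ≠ 0 := by
      exact_mod_cast (show l - 1 ≠ 0 by omega)
    -- The factor `1 - l` of `V (l + 1)` in `⁅V 1, V l⁆` is why `l = 2` is a separate base case.
    have h := leibniz_lie (V 1) (V l) (b k)
    rw [ih (by omega), H.V_V_pos _ _ one_pos (by omega), H.V_one_b, smul_lie, lie_neg, lie_neg,
      lie_smul, lie_smul, ih (by omega), H.V_one_b, show l + k + 1 = l + 1 + k by ring,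
      show l + (k + 1) = l + 1 + k by ring, add_comm 1 l] at h
    push_cast at h ⊢
    linear_combination (norm := (match_scalars <;> field_simp <;> ring)) (((l : K) - 1)⁻¹) • h

lemma V_b (l k : ℤ) : ⁅V l, b k⁆ = -((k : K) • b (l + k)) := by
  rcases lt_trichotomy l 0 with hl | rfl | hl
  · have h := H.swap.V_b_of_pos (-l) (by omega) (-k)
    simp only [neg_neg, neg_lie, neg_add_rev] at h
    push_cast at h
    rw [add_comm]
    linear_combination (norm := module) (-1 : K) • h
  · rw [H.V_zero_b, zero_add]
  · exact H.V_b_of_pos l hl k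

lemma V_neg_one_V (l : ℤ) : ⁅V (-1), V l⁆ = -(((l : K) + 1) • V (l - 1)) := by
  rcases lt_trichotomy l 0 with hl | rfl | hl
  · rw [H.V_V_neg _ _ (by omega) hl, show -1 + l = l - 1 by ring]; push_cast; module
  · rw [← lie_skew, H.V_zero_V]; push_cast; simp
  rcases eq_or_ne l 1 with rfl | hl1
  · rw [← lie_skew, H.V_one_V_neg_one]; norm_num
  have hl : 2 ≤ l := by omega
  clear hl1
  induction l, hl using Int.leInduction with
  | base => rw [H.V_neg_one_V_two]; norm_num
  | succ l hl ih =>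
    have hl' : (l : K) - 1 ≠ 0 := by
      exact_mod_cast (show l - 1 ≠ 0 by omega)
    have h := leibniz_lie (V (-1)) (V 1) (V l)
    rw [ih (by omega), H.V_V_pos _ _ one_pos (by omega), ← lie_skew _ (V 1), H.V_one_V_neg_one,
      neg_lie, lie_neg, lie_smul, lie_smul, smul_lie, H.V_zero_V,
      H.V_V_pos _ _ one_pos (by omega), show 1 + (l - 1) = l by ring, add_comm 1 l] at h
    rw [show l + 1 - 1 = l by ring]
    push_cast at h ⊢
    linear_combination (norm := (match_scalars <;> field_simp <;> ring)) (-((l : K) - 1)⁻¹) • h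

lemma V_one_V (l : ℤ) : ⁅V 1, V l⁆ = (1 - (l : K)) • V (l + 1) := by
  have h := H.swap.V_neg_one_V (-l)
  rw [neg_lie, lie_neg, neg_neg, neg_neg, neg_neg, show -(-l - 1) = l + 1 by ring] at h
  push_cast at h
  linear_combination (norm := module) h

lemma D_V_one_b (k : ℤ) : ⁅⁅D, V 1⁆, b k⁆ = (2 * (k : K)) • V (k + 1) := by
  have h := leibniz_lie D (V 1) (b k)
  rw [H.V_one_b, H.D_b, lie_neg, lie_neg, lie_smul, lie_smul, H.V_one_V, H.D_b] at h
  push_cast at h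
  linear_combination (norm := module) (-1 : K) • h

/-- The first bracket in which a central term occurs. With `V (-2)` written as half of `⁅D, b
(-2)⁆`, the central term is the bracket of `b (-2)` with the correction `b 2` in `⁅D, V 2⁆`. -/
lemma V_two_V_neg_two : ⁅V 2, V (-2)⁆ = (4 : K) • V 0 + (2⁻¹ : K) • I := by
  have h1 := leibniz_lie (V 2) D (b (-2))
  have h2 := leibniz_lie (V 1) ⁅D, V 1⁆ (b (-2))
  rw [H.D_V_one_b, H.V_one_b, lie_smul, lie_neg, lie_smul, H.V_one_V, H.D_V_one_b] at h2
  rw [H.V_two_b, ← lie_skew _ D, H.D_V_two, H.D_b, neg_lie, sub_lie, smul_lie, smul_lie, H.b_b]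
    at h1
  norm_num [H.b_zero] at h1 h2
  linear_combination (norm := module) (2⁻¹ : K) • h1 + h2

/-- For negative `k` the index is lowered by bracketing with `V (-1)`. -/
lemma V_two_V (k : ℤ) :
    ⁅V 2, V k⁆ = (2 - (k : K)) • V (k + 2) + if k = -2 then (2⁻¹ : K) • I else 0 := by
  rcases lt_trichotomy k 0 with hk | rfl | hk
  · rcases eq_or_ne k (-1) with rfl | hk1
    · rw [← lie_skew, H.V_neg_one_V_two, if_neg (by omega)]; norm_num
    have hk : k ≤ -2 := by omega
    clear hk1
    induction k, hk using Int.leInductionDown with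
    | base => rw [H.V_two_V_neg_two]; norm_num
    | pred k hk ih =>
      have hk' : (k : K) + 1 ≠ 0 := by exact_mod_cast (show k + 1 ≠ 0 by omega)
      have h := leibniz_lie (V 2) (V (-1)) (V k)
      have e : ⁅V (-1), (if k = -2 then (2⁻¹ : K) • I else 0)⁆ = 0 := by
        split_ifs <;> simp [H.lie_I]
      rw [ih (by omega), H.V_neg_one_V, ← lie_skew (V 2) (V (-1)), H.V_neg_one_V_two, neg_neg,
        smul_lie,
        H.V_one_V, lie_neg, lie_smul, lie_add, e, lie_smul, H.V_neg_one_V,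
        show k + 2 - 1 = k + 1 by ring] at h
      rw [show k - 1 + 2 = k + 1 by ring, if_neg (by omega)]
      push_cast at h ⊢
      linear_combination (norm := (match_scalars <;> field_simp <;> ring)) (-((k : K) + 1)⁻¹) • h
  · rw [← lie_skew, H.V_zero_V, if_neg (by omega)]; norm_num
  · rw [H.V_V_pos _ _ two_pos hk, add_comm 2 k, if_neg (by omega)]; norm_num

/-- The index `l` is raised by bracketing with `V 1`. -/
lemma V_V_of_pos (l : ℤ) (hl : 0 < l) (k : ℤ) : ⁅V l, V k⁆ = ((l : K) - k) • V (l + k) +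
    if l = -k then (((l : K) ^ 3 - l) / 12) • I else 0 := by
  rcases eq_or_ne l 1 with rfl | hl1
  · rw [H.V_one_V, add_comm]; simp
  have hl : 2 ≤ l := by omega
  clear hl1
  induction l, hl using Int.leInduction generalizing k with
  | base =>
    rw [H.V_two_V, add_comm k 2]
    norm_num
    congr 1
    simp only [show (2 = -k) ↔ (k = -2) by omega]
  | succ l hl ih =>
    have hl' : (l : K) - 1 ≠ 0 := by
      exact_mod_cast (show l - 1 ≠ 0 by omega)
    have h := leibniz_lie (V 1) (V l) (V k)
    have e : ⁅V 1, (if l = -k then (((l : K) ^ 3 - l) / 12) • I else 0)⁆ = 0 := by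
      split_ifs <;> simp [H.lie_I]
    rw [ih (by omega), H.V_one_V, H.V_one_V, smul_lie, lie_add, e, lie_smul, lie_smul,
      ih (by omega), H.V_one_V, show l + k + 1 = l + 1 + k by ring,
      show l + (k + 1) = l + 1 + k by ring] at h
    by_cases hkl : l + 1 = -k
    · rw [if_pos (by omega)] at h
      rw [if_pos hkl]
      obtain rfl : k = -(l + 1) := by omega
      push_cast at h ⊢
      linear_combination (norm := (match_scalars <;> field_simp <;> ring)) (((l : K) - 1)⁻¹) • h
    · rw [if_neg (by omega)] at h
      rw [if_neg hkl]
      push_cast at h ⊢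
      linear_combination (norm := (match_scalars <;> field_simp <;> ring)) (((l : K) - 1)⁻¹) • h

lemma V_V (l k : ℤ) : ⁅V l, V k⁆ = ((l : K) - k) • V (l + k) +
    if l = -k then (((l : K) ^ 3 - l) / 12) • I else 0 := by
  rcases lt_trichotomy l 0 with hl | rfl | hl
  · have h := H.swap.V_V_of_pos (-l) (by omega) (-k)
    simp only [neg_neg, neg_lie, lie_neg, neg_add_rev] at h
    rw [h, add_comm k l]
    by_cases hkl : l = -k
    · rw [if_pos hkl, if_pos (by omega)]; push_cast; module
    · rw [if_neg hkl, if_neg (by omega)]; push_cast; module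
  · rw [H.V_zero_V]; simp
  · exact H.V_V_of_pos l hl k

end HeisVir

/-! ### The Lie algebra of classes of diagrams -/

attribute [local instance] LieRing.ofAssociativeRing

/-- The element of which the bracket adds dots: half of the clockwise circle with one dot. -/
def dotter : TrH := (2⁻¹ : ℂ) • cls circle₁

/-- The sum of the classes of the long cycle on `n` strands with one dot on one of the strands,
divided by `n` and taken with the sign of the strand. -/
def Strand.virCls (s : Strand HeisObj) (n : ℕ) : TrH := ((s.sign : ℂ) * (n : ℂ)⁻¹) •
  ∑ i : Fin n, cls (longCycle s.cross n ≫ dots s.dot n (Pi.single i 1))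

theorem Strand.sign_smul_sign_smul (s : Strand HeisObj) (x : TrH) :
    (s.sign : ℂ) • (s.sign : ℂ) • x = x := by
  rw [smul_smul, ← Int.cast_mul, s.sign_mul_sign, Int.cast_one, one_smul]

namespace Slides

variable {s : Strand HeisObj} (hs : Slides s)
include hs

theorem lie_circle₀_cycCls (n : ℕ) :
    ⁅cls Heis.circle₀, s.cycCls n⁆ = ((s.sign : ℂ) * n) • s.cycCls n := by
  rw [Ring.lie_def, hs.circle₀_mul_cycCls, add_sub_cancel_left, ← Int.cast_smul_eq_zsmul ℂ]
  push_cast; rfl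

theorem lie_dotter_dotCls (a : ℕ) :
    ⁅dotter, s.dotCls a⁆ = (s.sign : ℂ) • s.dotCls (a + 1) := by
  rw [dotter, smul_lie, Ring.lie_def, hs.circle₁_mul_dotCls, add_sub_cancel_left,
    ← Int.cast_smul_eq_zsmul ℂ, smul_smul]
  push_cast
  rw [inv_mul_cancel_left₀ two_ne_zero]

theorem lie_dotter_cycCls (n : ℕ) : ⁅dotter, s.cycCls n⁆ = (n : ℂ) • s.virCls n := by
  rw [dotter, smul_lie, Ring.lie_def, hs.circle₁_mul_cycCls, add_sub_cancel_left,
    ← Int.cast_smul_eq_zsmul ℂ, smul_smul]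
  push_cast
  rw [inv_mul_cancel_left₀ two_ne_zero, Strand.virCls, smul_smul]
  -- For `n = 0` the sum is empty, so that the junk value of `n⁻¹` does not matter.
  rcases eq_or_ne n 0 with rfl | hn
  · simp
  · rw [mul_left_comm, mul_inv_cancel₀ (Nat.cast_ne_zero.mpr hn), mul_one]

theorem virCls_one : s.virCls 1 = (s.sign : ℂ) • s.dotCls 1 := by
  have h := hs.lie_dotter_cycCls 1
  rw [s.cycCls_one, hs.lie_dotter_dotCls, Nat.cast_one, one_smul] at h
  exact h.symm

theorem lie_dotter_virCls_one : ⁅dotter, s.virCls 1⁆ = s.dotCls 2 := by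
  rw [hs.virCls_one, lie_smul, hs.lie_dotter_dotCls, s.sign_smul_sign_smul]

theorem halfHeisVir : HalfHeisVir ℂ dotter s.cycCls s.virCls where
  D_B := hs.lie_dotter_cycCls
  l_one_B n := by
    rw [hs.virCls_one, smul_lie, Ring.lie_def, s.dotCls_one_mul_cycCls, add_sub_cancel_left,
      ← Int.cast_smul_eq_zsmul ℂ]
    push_cast
    rw [mul_comm, ← smul_smul, s.sign_smul_sign_smul]
  B_one_B n := by
    rw [s.cycCls_one, Ring.lie_def, s.dotCls_zero_mul_cycCls, sub_self]
  cubic_B := by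
    rw [hs.lie_dotter_virCls_one, hs.lie_dotter_dotCls, s.cycCls_one, hs.virCls_one, smul_lie,
      Ring.lie_def, s.dotCls_relations.2, smul_lie, lie_smul, ← Int.cast_smul_eq_zsmul ℂ,
      Ring.lie_def, Ring.lie_def]
    push_cast
    module
  serre := by
    rw [hs.lie_dotter_virCls_one, hs.virCls_one, smul_lie, smul_lie, lie_smul,
      s.sign_smul_sign_smul, ← lie_skew (s.dotCls 1) (s.dotCls 2), Ring.lie_def (s.dotCls 2),
      s.dotCls_relations.1, lie_neg, lie_zsmul, Ring.lie_def, s.dotCls_one_mul_dottedCrossCls,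
      sub_self, smul_zero, neg_zero]

end Slides

theorem b_neg_natCast {n : ℕ} (hn : 0 < n) : b (-n) = diagrams.up.cycCls n := by
  have h0 : (0 : ℤ) < n := by exact_mod_cast hn
  rw [b, if_neg (by omega), neg_neg, h, if_pos h0]
  exact (congrArg (fun x => cls (longCycle crossUp n ≫ x)) (dots_zero dotUp n)).trans
    (congrArg cls (Category.comp_id _))

theorem b_natCast {n : ℕ} (hn : 0 < n) : b n = diagrams.down.cycCls n := by
  have key (m : ℕ) (hm : n = m) : cls (longCycle crossDown m ≫ dots dotDown m 0) =
      diagrams.down.cycCls n := by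
    subst hm
    exact (congrArg (fun x => cls (longCycle crossDown n ≫ x)) (dots_zero dotDown n)).trans
      (congrArg cls (Category.comp_id _))
  rw [b, if_neg (by omega), h, if_neg (by omega)]
  exact key _ (by simp)

theorem L_neg_natCast {n : ℕ} (hn : 0 < n) : L (-n) = diagrams.up.virCls n := by
  have h0 : (0 : ℤ) < n := by exact_mod_cast hn
  have key (m : ℤ) (hm : m = n) : (((-(n : ℤ)).natAbs : ℂ)⁻¹) •
      ∑ i : Fin m.natAbs, h m (Pi.single i 1) = diagrams.up.virCls n := by
    subst hm
    simp only [h, if_pos h0, Int.natAbs_neg, Int.natAbs_natCast]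
    rw [Strand.virCls, show diagrams.up.sign = 1 from rfl, Int.cast_one, one_mul]
    rfl
  rw [L, if_neg (by omega)]
  exact key _ (neg_neg _)

theorem L_natCast {n : ℕ} (hn : 0 < n) : L n = -diagrams.down.virCls n := by
  have key (m : ℕ) (hm : m = n) : ((n : ℂ)⁻¹) • ∑ i : Fin m,
      cls (longCycle crossDown m ≫ dots dotDown m (Pi.single i 1)) =
        -diagrams.down.virCls n := by
    subst hm
    rw [Strand.virCls, show diagrams.down.sign = -1 from rfl, Int.cast_neg, Int.cast_one,
      neg_one_mul, neg_smul, neg_neg]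
    rfl
  rw [L, if_neg (by omega)]
  simp only [h, if_neg (show ¬ (0 : ℤ) < -(n : ℤ) by omega)]
  exact key _ (by simp)

theorem L_zero : L 0 = cls circle₀ := rfl

theorem b_one : b 1 = cls (𝟙 diagrams.Q) :=
  (b_natCast one_pos).trans (Strand.cycCls_one _)

theorem b_neg_one : b (-1) = cls (𝟙 diagrams.P) :=
  (b_neg_natCast one_pos).trans (Strand.cycCls_one _)

theorem L_one : L 1 = cls diagrams.dotQ := by
  refine (L_natCast one_pos).trans ?_
  rw [slides_down.virCls_one, show diagrams.down.sign = -1 from rfl, Int.cast_neg, Int.cast_one,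
    neg_smul, one_smul, neg_neg]
  exact congrArg cls (Category.id_comp _)

theorem L_neg_one : L (-1) = cls diagrams.dotP := by
  refine (L_neg_natCast one_pos).trans ?_
  rw [slides_up.virCls_one, show diagrams.up.sign = 1 from rfl, Int.cast_one, one_smul]
  exact congrArg cls (Category.id_comp _)

/-- The classes of diagrams satisfy the relations from which the Heisenberg–Virasoro relations
follow. For `n > 0`, `b (-n)` and `L (-n)` are `cycCls n` and `virCls n` of upward strands, while
`b n` and `L n` are `cycCls n` and `-virCls n` of downward strands. -/
theorem heisVir : HeisVir ℂ b L 1 dotter := by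
  have pos {k : ℤ} (hk : 0 < k) : ∃ n : ℕ, k = ((n + 1 : ℕ) : ℤ) := ⟨(k - 1).toNat, by omega⟩
  have neg {k : ℤ} (hk : k < 0) : ∃ n : ℕ, k = -((n + 1 : ℕ) : ℤ) := ⟨(-k - 1).toNat, by omega⟩
  have hb (n : ℕ) := b_natCast n.succ_pos
  have hb' (n : ℕ) := b_neg_natCast n.succ_pos
  have hL (n : ℕ) := L_natCast n.succ_pos
  have hL' (n : ℕ) := L_neg_natCast n.succ_pos
  simp only [Nat.succ_eq_add_one] at hb hb' hL hL'
  have hadd (m n : ℕ) : ((m + 1 : ℕ) : ℤ) + ((n + 1 : ℕ) : ℤ) = ((m + n + 1 + 1 : ℕ) : ℤ) := by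
    push_cast; ring
  have hadd' (m n : ℕ) : -((m + 1 : ℕ) : ℤ) + -((n + 1 : ℕ) : ℤ) = -((m + n + 1 + 1 : ℕ) : ℤ) := by
    push_cast; ring
  have hD := slides_down.halfHeisVir
  have hU := slides_up.halfHeisVir
  exact {
    b_zero := by
      rfl
    lie_I := by
      intro x; rw [Ring.lie_def, mul_one, one_mul, sub_self]
    V_zero_b := by
      intro k
      rcases lt_trichotomy k 0 with hk | rfl | hk
      · obtain ⟨n, rfl⟩ := neg hk
        rw [L_zero, hb', slides_up.lie_circle₀_cycCls, show diagrams.up.sign = 1 from rfl]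
        push_cast; module
      · simp [show b 0 = 0 from rfl]
      · obtain ⟨n, rfl⟩ := pos hk
        rw [L_zero, hb, slides_down.lie_circle₀_cycCls, show diagrams.down.sign = -1 from rfl]
        push_cast; module
    V_zero_D := by
      rw [L_zero, dotter, lie_smul, Ring.lie_def, cls_scal_comm, sub_self, smul_zero]
    D_b := by
      intro k
      rcases lt_trichotomy k 0 with hk | rfl | hk
      · obtain ⟨n, rfl⟩ := neg hk
        rw [hb', hL', hU.D_B]
        push_cast; module
      · simp [show b 0 = 0 from rfl]
      · obtain ⟨n, rfl⟩ := pos hk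
        rw [hb, hL, hD.D_B]
        push_cast; module
    b_b_pos := by
      intro k l hk hl
      obtain ⟨m, rfl⟩ := pos hk
      obtain ⟨n, rfl⟩ := pos hl
      rw [hb, hb, hD.B_B]
    b_b_neg := by
      intro k l hk hl
      obtain ⟨m, rfl⟩ := neg hk
      obtain ⟨n, rfl⟩ := neg hl
      rw [hb', hb', hU.B_B]
    V_b_pos := by
      intro k l hk hl
      obtain ⟨m, rfl⟩ := pos hk
      obtain ⟨n, rfl⟩ := pos hl
      rw [hL, hb, hadd, hb, neg_lie, hD.l_B, show m + 1 + (n + 1) = m + n + 1 + 1 by ring]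
      push_cast; rfl
    V_b_neg := by
      intro k l hk hl
      obtain ⟨m, rfl⟩ := neg hk
      obtain ⟨n, rfl⟩ := neg hl
      rw [hL', hb', hadd', hb', hU.l_B, show m + 1 + (n + 1) = m + n + 1 + 1 by ring]
      push_cast; module
    V_V_pos := by
      intro k l hk hl
      obtain ⟨m, rfl⟩ := pos hk
      obtain ⟨n, rfl⟩ := pos hl
      rw [hL, hL, hadd, hL, neg_lie, lie_neg, hD.l_l]
      push_cast; module
    V_V_neg := by
      intro k l hk hl
      obtain ⟨m, rfl⟩ := neg hk
      obtain ⟨n, rfl⟩ := neg hl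
      rw [hL', hL', hadd', hL', hU.l_l]
      push_cast; module
    b_one_b_neg_one := by
      rw [b_one, b_neg_one, Ring.lie_def, cls_Q_mul_P, add_sub_cancel_left]
    V_one_b_neg_one := by
      rw [L_one, b_neg_one, Ring.lie_def, cls_dotQ_mul_P, sub_self]
    V_neg_one_b_one := by
      rw [b_one, L_neg_one, Ring.lie_def, cls_Q_mul_dotP, sub_self]
    V_one_V_neg_one := by
      rw [L_one, L_neg_one, L_zero, Ring.lie_def, cls_dotQ_mul_dotP, add_sub_cancel_left,
        ← Int.cast_smul_eq_zsmul ℂ]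
      norm_num
    V_one_D_V_neg_one := by
      have h : ⁅dotter, L (-1)⁆ = cls (diagrams.dotP ≫ diagrams.dotP) := by
        refine (congrArg _ (L_neg_natCast one_pos)).trans ?_
        rw [slides_up.lie_dotter_virCls_one]
        exact congrArg (fun x => cls (x ≫ diagrams.dotP)) (Category.id_comp _)
      rw [h, L_one, Ring.lie_def, cls_dotQ_mul_dotP_dotP, add_sub_cancel_left,
        ← Int.cast_smul_eq_zsmul ℂ, dotter]
      push_cast; module
    D_V_two := by
      have h1 : L 1 = _ := hL 0
      have h2 : L 2 = _ := hL 1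
      have h3 : b 2 = _ := hb 1
      have h := hD.D_l_two
      rw [h1, h2, h3, lie_neg, lie_neg, lie_neg, neg_lie]
      simp only [zero_add, one_add_one_eq_two]
      rw [h]
      module
    D_V_neg_two := by
      have h1 : L (-1) = _ := hL' 0
      have h2 : L (-2) = _ := hL' 1
      have h3 : b (-2) = _ := hb' 1
      rw [h1, h2, h3]
      exact hU.D_l_two }

theorem lie_b_b (k l : ℤ) : ⁅b k, b l⁆ = if k = -l then (k : ℂ) • (1 : TrH) else 0 :=
  heisVir.b_b k l

theorem lie_L_L (k l : ℤ) : ⁅L k, L l⁆ = ((k : ℂ) - (l : ℂ)) • L (k + l) +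
    if k = -l then (((k : ℂ) ^ 3 - (k : ℂ)) / 12) • (1 : TrH) else 0 :=
  heisVir.V_V k l

theorem lie_L_b (l k : ℤ) : ⁅L l, b k⁆ = -((k : ℂ) • b (l + k)) := heisVir.V_b l k

end Heis

end

theorem mainTheorem2 :
    (∀ k l : ℤ, k ≠ 0 → l ≠ 0 →
      ⁅Heis.b k, Heis.b l⁆ = if k = -l then (k : ℂ) • (1 : Heis.TrH) else 0) ∧
    (∀ k l : ℤ,
      ⁅Heis.L k, Heis.L l⁆ = ((k : ℂ) - (l : ℂ)) • Heis.L (k + l) +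
        if k = -l then (((k : ℂ) ^ 3 - (k : ℂ)) / 12) • (1 : Heis.TrH) else 0) ∧
    (∀ k l : ℤ, k ≠ 0 →
      ⁅Heis.L l, Heis.b k⁆ = -((k : ℂ) • Heis.b (l + k))) :=
  ⟨fun k l _ _ => Heis.lie_b_b k l, Heis.lie_L_L, fun k l _ => Heis.lie_L_b l k⟩
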